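/- **Theorem 3.1.** Let $d,k\ge 1$, let $f:\mathbb R\to\mathbb R^d$ be Lipschitz continuous and $u_0\in L^1_{\rm loc}(\mathbb R^d)$. Consider the conservation law $$\partial_t u+\nabla\cdot f(u)=0\ \text{ on }\mathbb R^d\times(0,\infty),\qquad u(x,0)=u_0(x).$$ *Meshes.* Let $\mathcal T_h=\{K\}$ run through a sequence of locally finite partitions of $\mathbb R^d$ into convex polytopes with non-empty, pairwise disjoint interiors, with $h=\sup_K \operatorname{diam}K<\infty$ and $h\to0$. The sequence is quasi-uniform: for some $\sigma>0$ independent of the mesh, every cell contains a ball of radius $\sigma h$. The edges $e\in\partial K$ are the interfaces $e=K\cap K^{\rm ext}$ of positive $(d-1)$-dimensional measure with other cells $K^{\rm ext}$, and $\nu_{e,K}$ is the unit normal on $e$ outward from $K$. Let $\mathcal V_h^\ell$ be the space of functions whose restriction to each cell is a polynomial of degree at most $\ell$. *Numerical flux.* For $u_h\in\mathcal V_h^k$ let $\widehat{f\cdot\nu_{e,K}}(u_h)$ be a measurable function on $e$ such that, for all $u_h,v_h\in\mathcal V^k_h$: 1. (conservation) $\widehat{f\cdot\nu_{e,K^{\rm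 ext}}}(u_h)=-\widehat{f\cdot\nu_{e,K}}(u_h)$ on $e$; 2. (consistency) if the traces of $u_h$ from $K$ and $K^{\rm ext}$ agree on $e$, then $\widehat{f\cdot\nu_{e,K}}(u_h)=f(u_h)\cdot\nu_{e,K}$ on $e$; 3. (Lipschitz continuity) $|\widehat{f\cdot\nu_{e,K}}(u_h)-\widehat{f\cdot\nu_{e,K}}(v_h)|\le C\|u_h-v_h\|_{L^\infty(K\cup K^{\rm ext})}$ on $e$, where $C$ depends neither on the mesh nor on $e$, $K$. *Scheme.* For $\ell\in\{k-1,k\}$ define $\nabla^{\rm DG}_\ell\cdot f:\mathcal V_h^k\to\mathcal V_h^\ell$ by $$\int_K \nabla^{\rm DG}_\ell\cdot f(u_h)\,v_h\,dx=-\int_K f(u_h)\cdot\nabla v_h\,dx+\sum_{e\in\partial K}\int_e\widehat{f\cdot\nu_{e,K}}(u_h)\,v_h\,dl\qquad\forall K,\ \forall v_h\in\mathcal V_h^\ell .$$ Let $(a_{ij})_{s\times s}$, $(b_i)$ be the coefficients of an explicit Runge–Kutta method ($a_{ij}=0$ for $i\le j$) with $\sum_i b_i=1$, and let $d_{ij},e_i\in\{k-1,k\}$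 with $e_s=k$. The numerical solution $u_h^n\in\mathcal V_h^k$ with time step $\Delta t>0$ satisfies for all $n\ge0$ $$u_h^{(i)}=u_h^n-\Delta t\sum_{j=1}^{i-1}a_{ij}\nabla^{\rm DG}_{d_{ij}}\cdot f(u_h^{(j)}),\quad i=1,\dots,s,\qquad u_h^{n+1}=u_h^n-\Delta t\sum_{i=1}^s b_i\nabla^{\rm DG}_{e_i}\cdot f(u_h^{(i)}).$$ Assume $\Delta t/h\le\lambda_0$ with a fixed constant $\lambda_0$, and $u_h^0\to u_0$ in $L^1_{\rm loc}(\mathbb R^d)$. *Conclusion.* Suppose that, as $\Delta t,h\to0$ along the sequence, the numerical solutions converge boundedly almost everywhere to a function $u$: they are bounded uniformly in $x$, $n$ and the mesh, and the functions $u_h(x,t)=u_h^n(x)$ for $t\in[n\Delta t,(n+1)\Delta t)$ converge to $u(x,t)$ for almost every $(x,t)\in\mathbb R^d\times(0,\infty)$. Then $u$ is a weak solution: for every $\phi$ that is the restriction to $\mathbb R^d\times[0,\infty)$ of a function in $C_c^\infty(\mathbb R^d\times\mathbb R)$, the following integrals exist and $$\int_{\mathbb R^d}u_0(x)\,\phi(x,0)\,dx+\int_0^\infty\!\!\int_{\mathbb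 R^d}u\,\phi_t\,dx\,dt+\int_0^\infty\!\!\int_{\mathbb R^d}f(u)\cdot\nabla\phi\,dx\,dt=0 .$$ -/

import Mathlib

open MeasureTheory Filter Topology
open scoped ContDiff

namespace SdRKDG

/-- `ℝ^d` with its Euclidean norm. -/
abbrev Space (d : ℕ) := EuclideanSpace ℝ (Fin d)

/-- The value of a real polynomial in `d` variables at a point of `ℝ^d`. -/
noncomputable def pval {d : ℕ} (p : MvPolynomial (Fin d) ℝ) (x : Space d) : ℝ :=
  MvPolynomial.eval (fun a => x a) p

/-- The gradient of a polynomial at a point of `ℝ^d`. -/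
noncomputable def pgrad {d : ℕ} (p : MvPolynomial (Fin d) ℝ) (x : Space d) : Space d :=
  WithLp.toLp 2 (fun a => pval (MvPolynomial.pderiv a p) x)

/-- A partition of `ℝ^d` into convex polytopes with pairwise disjoint interiors: locally finite,
with uniformly bounded cell diameters. Simplicial, rectangular and general convex polytopal
partitions are covered; hanging nodes are allowed. -/
structure Mesh (d : ℕ) where
  Cell : Type
  carrier : Cell → Set (Space d)
  polytope : ∀ i, ∃ V : Finset (Space d), carrier i = convexHull ℝ (V : Set (Space d))
  nonempty_interior : ∀ i, (interior (carrier i)).Nonempty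
  disjoint_interior : ∀ i j, i ≠ j → Disjoint (interior (carrier i)) (interior (carrier j))
  cover : ∀ x : Space d, ∃ i, x ∈ carrier i
  locallyFinite : LocallyFinite carrier
  bddAbove_diam : BddAbove (Set.range fun i => Metric.diam (carrier i))

namespace Mesh

variable {d : ℕ} (M : Mesh d)

/-- The mesh size `h`, the supremum of the cell diameters. -/
noncomputable def size : ℝ := ⨆ i, Metric.diam (M.carrier i)

/-- The interface `K_i ∩ K_j` of two cells. -/
def face (i j : M.Cell) : Set (Space d) := M.carrier i ∩ M.carrier j

/-- `(d-1)`-dimensional surface measure, normalized as usual (length for `d = 2`, area for `d = 3`,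
counting measure for `d = 1`). -/
noncomputable def surface (d : ℕ) : Measure (Space d) :=
  Measure.euclideanHausdorffMeasure (d - 1)

/-- `K_j` is a neighbor of `K_i` if it is another cell that shares with `K_i` an interface of
positive surface measure. These interfaces are the edges `e ∈ ∂K_i`, and `K_j` is the exterior
cell belonging to `e`. -/
def Adj (i j : M.Cell) : Prop := i ≠ j ∧ 0 < surface d (M.face i j)

theorem convex_carrier (i : M.Cell) : Convex ℝ (M.carrier i) := by
  obtain ⟨V, hV⟩ := M.polytope i
  rw [hV]
  exact convex_convexHull ℝ _

theorem isCompact_carrier (i : M.Cell) : IsCompact (M.carrier i) := by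
  obtain ⟨V, hV⟩ := M.polytope i
  rw [hV]
  exact V.finite_toSet.isCompact_convexHull ℝ

theorem finite_neighbors (i : M.Cell) : {j | M.Adj i j}.Finite := by
  refine (M.locallyFinite.finite_nonempty_inter_compact (M.isCompact_carrier i)).subset ?_
  rintro j ⟨-, hj⟩
  obtain ⟨x, hx⟩ := nonempty_of_measure_ne_zero hj.ne'
  exact ⟨x, hx.2, hx.1⟩

/-- The neighbors of a cell; they index the edges `e ∈ ∂K_i`. -/
noncomputable def neighbors (i : M.Cell) : Finset M.Cell := (M.finite_neighbors i).toFinset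

/-- `ν` is a unit vector normal to the interface of `K_i` and `K_j` that points from `K_i` to `K_j`:
the two cells lie on the two sides of a hyperplane orthogonal to `ν`. -/
def IsNormal (i j : M.Cell) (ν : Space d) : Prop :=
  ‖ν‖ = 1 ∧ ∀ x ∈ M.carrier i, ∀ y ∈ M.carrier j, inner ℝ ν x ≤ inner ℝ ν y

theorem exists_isNormal {i j : M.Cell} (h : i ≠ j) : ∃ ν, M.IsNormal i j ν := by
  obtain ⟨g, c, hg, hc⟩ := geometric_hahn_banach_open (M.convex_carrier i).interior
    isOpen_interior (M.convex_carrier j).interior (M.disjoint_interior i j h)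
  have hg0 : g ≠ 0 := by
    rintro rfl
    obtain ⟨a, ha⟩ := M.nonempty_interior i
    obtain ⟨b, hb⟩ := M.nonempty_interior j
    have h1 := hg a ha
    have h2 := hc b hb
    simp at h1 h2
    linarith
  have hcl : ∀ l, M.carrier l ⊆ closure (interior (M.carrier l)) := fun l => by
    rw [(M.convex_carrier l).closure_interior_eq_closure_of_nonempty_interior
      (M.nonempty_interior l)]
    exact subset_closure
  have hi : ∀ x ∈ M.carrier i, g x ≤ c := fun x hx =>
    closure_minimal (s := interior (M.carrier i)) (t := {x | g x ≤ c})
      (fun y hy => (hg y hy).le) (isClosed_le g.continuous continuous_const) (hcl i hx)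
  have hj : ∀ x ∈ M.carrier j, c ≤ g x := fun x hx =>
    closure_minimal (s := interior (M.carrier j)) (t := {x | c ≤ g x})
      (fun y hy => hc y hy) (isClosed_le continuous_const g.continuous) (hcl j hx)
  set w := (InnerProductSpace.toDual ℝ (Space d)).symm g with hw
  have hw0 : w ≠ 0 := by simpa [hw] using hg0
  have hin : ∀ x, inner ℝ w x = g x := fun x => by
    simp [hw]
  refine ⟨‖w‖⁻¹ • w, ?_, fun x hx y hy => ?_⟩
  · rw [norm_smul, norm_inv, norm_norm, inv_mul_cancel₀ (norm_ne_zero_iff.2 hw0)]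
  · simp only [real_inner_smul_left, hin]
    exact mul_le_mul_of_nonneg_left ((hi x hx).trans (hj y hy)) (by positivity)

open Classical in
/-- The unit normal `ν_{e,K_i}` along the edge `e = K_i ∩ K_j`, outward with respect to `K_i`.
It is unique when `K_j` is a neighbor of `K_i`. -/
noncomputable def normal (i j : M.Cell) : Space d :=
  if h : i ≠ j then (M.exists_isNormal h).choose else 0

theorem isNormal_normal {i j : M.Cell} (h : i ≠ j) : M.IsNormal i j (M.normal i j) := by
  rw [normal, dif_pos h]
  exact (M.exists_isNormal h).choose_spec

/-- Every cell contains a ball of radius `σ h`. For fixed `σ > 0` and a family of meshes, this says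
that the family is shape regular and that all cells of a mesh have comparable diameters. -/
def IsQuasiUniform (σ : ℝ) : Prop :=
  ∀ i, ∃ x, Metric.closedBall x (σ * M.size) ⊆ M.carrier i

/-- A family of polynomials, one on each cell: a piecewise polynomial function that may be
discontinuous across the edges. -/
abbrev PiecewisePoly := M.Cell → MvPolynomial (Fin d) ℝ

/-- The space `V_h^ℓ` of piecewise polynomials of total degree at most `ℓ`. -/
noncomputable def dgSpace (ℓ : ℕ) : Submodule ℝ M.PiecewisePoly :=
  Submodule.pi Set.univ fun _ => MvPolynomial.restrictTotalDegree (Fin d) ℝ ℓ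

/-- A piecewise polynomial as a function on `ℝ^d`; on the null set of points in several cells one of
the cells is chosen. -/
noncomputable def toFun (u : M.PiecewisePoly) (x : Space d) : ℝ :=
  pval (u (M.cover x).choose) x

/-- `F i j u x` is the numerical flux through the edge `e = K_i ∩ K_j` in the direction outward from
`K_i`, at the point `x` of `e`, for the numerical solution `u`. The constant `C` is the Lipschitz
constant. -/
structure IsNumericalFlux (k : ℕ) (f : ℝ → Space d) (C : ℝ)
    (F : M.Cell → M.Cell → M.PiecewisePoly → Space d → ℝ) : Prop where
  measurable : ∀ u ∈ M.dgSpace k, ∀ i j, M.Adj i j →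
    AEStronglyMeasurable (F i j u) ((surface d).restrict (M.face i j))
  /-- Conservation: what leaves `K_i` through `e` enters `K_j`. -/
  conservative : ∀ u ∈ M.dgSpace k, ∀ i j, M.Adj i j → ∀ x ∈ M.face i j,
    F j i u x = -F i j u x
  /-- If the interior and exterior traces agree along `e`, the flux is the exact one. -/
  consistent : ∀ u ∈ M.dgSpace k, ∀ i j, M.Adj i j →
    (∀ x ∈ M.face i j, pval (u i) x = pval (u j) x) →
    ∀ x ∈ M.face i j, F i j u x = inner ℝ (f (pval (u i) x)) (M.normal i j)
  /-- `|F(u) - F(v)| ≤ C ‖u - v‖` with the `L^∞` norm over `K_i ∪ K_j`. -/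
  lipschitz : ∀ u ∈ M.dgSpace k, ∀ v ∈ M.dgSpace k, ∀ i j, M.Adj i j → ∀ δ : ℝ,
    (∀ y ∈ M.carrier i, |pval (u i) y - pval (v i) y| ≤ δ) →
    (∀ y ∈ M.carrier j, |pval (u j) y - pval (v j) y| ≤ δ) →
    ∀ x ∈ M.face i j, |F i j u x - F i j v x| ≤ C * δ

/-- `w` is the discrete divergence `∇^DG_ℓ · f(u)`: the element of `V_h^ℓ` with
`∫_K w v = -∫_K f(u) · ∇v + ∑_e ∫_e F v` for all cells `K` and all polynomials `v` of degree at
most `ℓ`. -/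
def IsDGDiv (f : ℝ → Space d) (F : M.Cell → M.Cell → M.PiecewisePoly → Space d → ℝ) (ℓ : ℕ)
    (u w : M.PiecewisePoly) : Prop :=
  w ∈ M.dgSpace ℓ ∧
    ∀ i, ∀ v ∈ MvPolynomial.restrictTotalDegree (Fin d) ℝ ℓ,
      ∫ x in M.carrier i, pval (w i) x * pval v x =
        -(∫ x in M.carrier i, inner ℝ (f (pval (u i) x)) (pgrad v x)) +
          ∑ j ∈ M.neighbors i, ∫ x in M.face i j, F i j u x * pval v x ∂(surface d)

end Mesh

/-- The enlarged tableau of an explicit, consistent `s`-stage Runge-Kutta method together with the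
polynomial degrees used at its stages. -/
structure Tableau (s k : ℕ) where
  A : Matrix (Fin s) (Fin s) ℝ
  b : Fin s → ℝ
  D : Matrix (Fin s) (Fin s) ℕ
  e : Fin s → ℕ
  explicit : ∀ i j, i ≤ j → A i j = 0
  sum_b : ∑ i, b i = 1
  mem_D : ∀ i j, D i j = k - 1 ∨ D i j = k
  mem_e : ∀ i, e i = k - 1 ∨ e i = k
  e_last : ∀ i : Fin s, (i : ℕ) + 1 = s → e i = k

/-- `u'` arises from `u` by one time step of length `τ` of the Runge-Kutta discontinuous Galerkin
scheme with stage-dependent polynomial spaces; `U i` are the stage values and `G j ℓ` is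
`∇^DG_ℓ · f(U j)`. -/
def IsStep {d s k : ℕ} (T : Tableau s k) (M : Mesh d) (f : ℝ → Space d)
    (F : M.Cell → M.Cell → M.PiecewisePoly → Space d → ℝ) (τ : ℝ) (u u' : M.PiecewisePoly) :
    Prop :=
  ∃ (U : Fin s → M.PiecewisePoly) (G : Fin s → ℕ → M.PiecewisePoly),
    (∀ j, ∀ ℓ ∈ ({k - 1, k} : Set ℕ), M.IsDGDiv f F ℓ (U j) (G j ℓ)) ∧
    (∀ i, U i = u - τ • ∑ j ∈ Finset.Iio i, T.A i j • G j (T.D i j)) ∧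
    u' = u - τ • ∑ i, T.b i • G i (T.e i)

/-- `u 0, u 1, …` is a numerical solution in `V_h^k` with time step `τ`. -/
def IsNumericalSolution {d s k : ℕ} (T : Tableau s k) (M : Mesh d) (f : ℝ → Space d)
    (F : M.Cell → M.Cell → M.PiecewisePoly → Space d → ℝ) (τ : ℝ) (u : ℕ → M.PiecewisePoly) :
    Prop :=
  (∀ n, u n ∈ M.dgSpace k) ∧ ∀ n, IsStep T M f F τ (u n) (u (n + 1))

/-- `u` is a weak solution of `∂_t u + ∇ · f(u) = 0` on `ℝ^d × (0,∞)`, `u(·,0) = u₀`. A test function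
is the restriction to `ℝ^d × [0,∞)` of a smooth function with compact support in `ℝ^d × ℝ`;
`fderiv ℝ φ p (0, 1)` is `φ_t` and `fderiv ℝ φ p (f (u p), 0)` is `f(u) · ∇φ`. The integrals are
required to exist. -/
def IsWeakSolution {d : ℕ} (f : ℝ → Space d) (u₀ : Space d → ℝ) (u : Space d × ℝ → ℝ) : Prop :=
  ∀ φ : Space d × ℝ → ℝ, ContDiff ℝ ∞ φ → HasCompactSupport φ →
    Integrable (fun x => u₀ x * φ (x, 0)) ∧
    IntegrableOn (fun p => u p * fderiv ℝ φ p (0, 1)) {p | 0 < p.2} ∧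
    IntegrableOn (fun p => fderiv ℝ φ p (f (u p), 0)) {p | 0 < p.2} ∧
    (∫ x, u₀ x * φ (x, 0)) + (∫ p in {p | 0 < p.2}, u p * fderiv ℝ φ p (0, 1)) +
      (∫ p in {p | 0 < p.2}, fderiv ℝ φ p (f (u p), 0)) = 0

end SdRKDG

namespace SdRKDG

variable {d : ℕ}

/-! This is a Lax–Wendroff argument that uses no bound on the variation of the numerical solutions.
The constant 1 lies in every `V_h^ℓ` and its gradient vanishes, so the cell averages obey a
conservative update whatever degrees the stages use (`integral_step_sub`). Multiply it by `φ(z_i,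
nτ)`, with a sample point `z_i` in each cell, and sum by parts in time: what remains are numerical
fluxes weighted by `φ(z_i, nτ)`. By conservation the same fluxes weighted by `φ(y, nτ)` sum to zero,
so the weight may be taken to be `φ(z_i, nτ) - φ(y, nτ)`, which is `O(h)`.

On one cell, replace all stage values by a constant `c`. Consistency turns the numerical flux into
`f(c) · ν`, and the divergence theorem turns the boundary sum into `-∫_K ∇φ · f(c)`, the term of the
weak form. The error is at most a multiple of the integral of `|u_h - c|` over a ball of radius `(s
+ 2) h` (`exists_fluxResidual_bound`). Two facts give this. Inverse inequalities bound the maximum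
of a polynomial by its mean. And a constant state has discrete divergence zero, so a state within
`δ` of a constant has discrete divergence `O(δ/h)` (`exists_dgDiv_bound`); under the CFL condition
every stage then stays within `O(δ)` of the same constant, on balls that lose `h` per stage
(`exists_stage_bound`).

Now let `c = g(z_i, nτ)` with `g` continuous of compact support. The balls overlap boundedly, so the
total defect is at most a constant times `∫ (|u_h - g| + ε)` over a fixed bounded region
(`exists_weak_form_defect_le`). Dominated convergence passes to the limit here and in the weak form.
The limiting defect `∫ (|v - g| + ε)` is as small as desired, since such `g` are dense in `L^1`.

The divergence theorem on a cell comes from integrating along lines in a fixed direction `v`: each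
face integral is an integral of `∂_v ψ` over the region swept out by the face
(`integral_fderiv_sweep`), and the swept regions, counted with signs, add up to minus the indicator
of the cell (`sum_sign_sweep`). -/

/-! ### Surface measure on hyperplanes and oblique Fubini. -/

/-- The hyperplane `⟨ν, x⟩ = c`. -/
def hyperplane (ν : Space d) (c : ℝ) : Set (Space d) := {x | inner ℝ ν x = c}

theorem measurableSet_hyperplane (ν : Space d) (c : ℝ) : MeasurableSet (hyperplane ν c) :=
  (isClosed_eq (by fun_prop) continuous_const).measurableSet

theorem finrank_orthogonal_span_unit {ν : Space d} (hν : ‖ν‖ = 1) :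
    Module.finrank ℝ (ℝ ∙ ν)ᗮ = d - 1 := by
  have h0 : ν ≠ 0 := by rintro rfl; simp at hν
  have h := (ℝ ∙ ν).finrank_add_finrank_orthogonal
  rw [finrank_span_singleton h0, finrank_euclideanSpace_fin] at h
  omega

/-- Euclidean Hausdorff measure is transported by isometries and equals Lebesgue measure on an inner
product space of the same dimension. All later surface integrals are reduced to Lebesgue measure
through this identity. -/
theorem surface_restrict_hyperplane {ν : Space d} (hν : ‖ν‖ = 1) (c : ℝ) :
    (Mesh.surface d).restrict (hyperplane ν c) =
      (volume : Measure (ℝ ∙ ν)ᗮ).map (fun w : (ℝ ∙ ν)ᗮ => (w : Space d) + c • ν) := by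
  have hi : Isometry (fun w : (ℝ ∙ ν)ᗮ => (w : Space d) + c • ν) :=
    (IsometryEquiv.addRight (c • ν)).isometry.comp isometry_subtype_coe
  have hr : Set.range (fun w : (ℝ ∙ ν)ᗮ => (w : Space d) + c • ν) = hyperplane ν c := by
    ext x
    simp only [Set.mem_range, hyperplane, Set.mem_ofPred_eq]
    constructor
    · rintro ⟨w, rfl⟩
      have hw := Submodule.mem_orthogonal_singleton_iff_inner_right.1 w.2
      simp [inner_add_right, hw, inner_smul_right, hν]
    · intro hx
      refine ⟨⟨x - c • ν, ?_⟩, by simp⟩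
      rw [Submodule.mem_orthogonal_singleton_iff_inner_right]
      simp [inner_sub_right, hx, inner_smul_right, hν]
  rw [← hr, Mesh.surface, ← hi.map_euclideanHausdorffMeasure,
    ← InnerProductSpace.euclideanHausdorffMeasure_eq_volume, finrank_orthogonal_span_unit hν]

/-- Product measures and Fubini require s-finiteness. The unit norm is a `Fact` so that instance
search can use it. -/
instance sfinite_surface_restrict_hyperplane {ν : Space d} [hν : Fact (‖ν‖ = 1)] (c : ℝ) :
    SFinite ((Mesh.surface d).restrict (hyperplane ν c)) := by
  rw [surface_restrict_hyperplane hν.out]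
  infer_instance

/-- Splitting of `ℝ^d` into a hyperplane through the origin and its unit normal. -/
theorem measurePreserving_add_smul_unit {ν : Space d} (hν : ‖ν‖ = 1) :
    MeasurePreserving (fun p : (ℝ ∙ ν)ᗮ × ℝ => (p.1 : Space d) + p.2 • ν) volume volume := by
  have h0 : ν ≠ 0 := by rintro rfl; simp at hν
  let L : WithLp 2 ((ℝ ∙ ν)ᗮ × ℝ) →ₗᵢ[ℝ] Space d :=
    { toFun := fun p => (p.fst : Space d) + p.snd • ν
      map_add' := fun p q => by simp only [WithLp.add_fst, WithLp.add_snd, Submodule.coe_add, add_smul]; abel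
      map_smul' := fun r p => by simp [smul_smul]
      norm_map' := fun p => by
        have hw := Submodule.mem_orthogonal_singleton_iff_inner_left.1 p.fst.2
        have : ‖(p.fst : Space d) + p.snd • ν‖ ^ 2 = ‖p‖ ^ 2 := by
          rw [WithLp.prod_norm_sq_eq_of_L2, norm_add_sq_real, inner_smul_right, hw, norm_smul, hν]
          simp
        exact (sq_eq_sq₀ (norm_nonneg _) (norm_nonneg _)).1 this }
  have hfin : Module.finrank ℝ (WithLp 2 ((ℝ ∙ ν)ᗮ × ℝ)) = Module.finrank ℝ (Space d) := by
    rw [(WithLp.linearEquiv 2 ℝ ((ℝ ∙ ν)ᗮ × ℝ)).finrank_eq, Module.finrank_prod,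
      ← (ℝ ∙ ν).finrank_add_finrank_orthogonal, finrank_span_singleton h0, Module.finrank_self, add_comm]
  exact (L.toLinearIsometryEquiv hfin).measurePreserving.comp
    (WithLp.volume_preserving_toLp (ℝ ∙ ν)ᗮ ℝ)

/-- The transvection that fixes `ν^⊥` and sends `ν` to `v` carries the orthogonal splitting into the
oblique one. Its determinant is `⟨ν, v⟩`, whence the Jacobian factor. -/
theorem map_surface_hyperplane_prod {ν v : Space d} [hν : Fact (‖ν‖ = 1)] (c : ℝ)
    (h : inner ℝ ν v ≠ 0) :
    (((Mesh.surface d).restrict (hyperplane ν c)).prod volume).map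
      (fun p : Space d × ℝ => p.1 + p.2 • v) = ENNReal.ofReal |(inner ℝ ν v)⁻¹| • volume := by
  let T : Space d →ₗ[ℝ] Space d :=
    LinearMap.transvection (innerSL ℝ ν : Space d →L[ℝ] ℝ).toLinearMap (v - ν)
  have hT : ∀ x, T x = x + inner ℝ ν x • (v - ν) := fun x => by
    simp [T, LinearMap.transvection.apply]
  have hdet : LinearMap.det T = inner ℝ ν v := by
    rw [LinearMap.transvection.det]
    simp [inner_sub_right, hν.out]
  have hTm : Measurable T := T.continuous_of_finiteDimensional.measurable
  have h1 : (fun p : Space d × ℝ => p.1 + p.2 • v) ∘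
      Prod.map (fun w : (ℝ ∙ ν)ᗮ => (w : Space d) + c • ν) id =
      (fun x => x + c • ν) ∘ T ∘ (fun p : (ℝ ∙ ν)ᗮ × ℝ => (p.1 : Space d) + p.2 • ν) := by
    funext p
    have hw := Submodule.mem_orthogonal_singleton_iff_inner_right.1 p.1.2
    simp only [Function.comp, Prod.map, id, hT, inner_add_right, hw, inner_smul_right,
      real_inner_self_eq_norm_sq, hν.out]
    module
  have hm : Measurable (fun p : (ℝ ∙ ν)ᗮ × ℝ => (p.1 : Space d) + p.2 • ν) := by fun_prop
  rw [surface_restrict_hyperplane hν.out]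
  nth_rewrite 1 [← Measure.map_id (μ := (volume : Measure ℝ))]
  rw [Measure.map_prod_map _ _ (by fun_prop) measurable_id, Measure.map_map (by fun_prop) (by fun_prop)]
  rw [h1, ← Measure.map_map (by fun_prop) (hTm.comp hm), ← Measure.map_map hTm hm,
    ← Measure.volume_eq_prod, (measurePreserving_add_smul_unit hν.out).map_eq,
    Measure.map_linearMap_addHaar_eq_smul_addHaar _ (by rwa [hdet]), hdet, Measure.map_smul,
    map_add_right_eq_self]

/-- The set swept out by `A`, a part of a hyperplane, under translation by `s • v`, `s ∈ J`. -/
def sweep (A : Set (Space d)) (v : Space d) (J : Set ℝ) : Set (Space d) :=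
  {x | ∃ s ∈ J, x - s • v ∈ A}

/-- A line transversal to the hyperplane meets it only once, so the base point and the parameter of
a swept point are unique. -/
theorem preimage_sweep {ν v : Space d} {c : ℝ} (h : inner ℝ ν v ≠ 0) {A : Set (Space d)}
    (hA : A ⊆ hyperplane ν c) (J : Set ℝ) :
    (fun p : Space d × ℝ => p.1 + p.2 • v) ⁻¹' sweep A v J ∩ hyperplane ν c ×ˢ Set.univ =
      A ×ˢ J := by
  ext ⟨y, s⟩
  simp only [sweep, Set.mem_inter_iff, Set.mem_preimage, Set.mem_ofPred_eq, Set.mem_prod,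
    Set.mem_univ, and_true]
  constructor
  · rintro ⟨⟨t, ht, hy⟩, hyH⟩
    have h1 : inner ℝ ν (y + s • v - t • v) = c := hA hy
    have h2 : inner ℝ ν y = c := hyH
    simp only [inner_sub_right, inner_add_right, inner_smul_right, h2] at h1
    have h3 : s = t := by
      have : (s - t) * inner ℝ ν v = 0 := by linarith
      rcases mul_eq_zero.1 this with h | h'
      · linarith
      · exact absurd h' h
    subst h3
    exact ⟨by simpa using hy, ht⟩
  · rintro ⟨hy, hs⟩
    exact ⟨⟨s, hs, by simpa using hy⟩, hA hy⟩

theorem measurableSet_sweep {ν v : Space d} {c : ℝ} (h : inner ℝ ν v ≠ 0) {A : Set (Space d)}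
    (hA : A ⊆ hyperplane ν c) (hAm : MeasurableSet A) {J : Set ℝ} (hJ : MeasurableSet J) :
    MeasurableSet (sweep A v J) := by
  -- Transversality makes the parameter an explicit affine function of the point, which avoids
  -- projecting a measurable set.
  have : sweep A v J = (fun x : Space d => (inner ℝ ν x - c) / inner ℝ ν v) ⁻¹' J ∩
      (fun x : Space d => x - ((inner ℝ ν x - c) / inner ℝ ν v) • v) ⁻¹' A := by
    ext x
    simp only [sweep, Set.mem_ofPred_eq, Set.mem_inter_iff, Set.mem_preimage]
    constructor
    · rintro ⟨s, hs, hx⟩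
      have h1 : inner ℝ ν (x - s • v) = c := hA hx
      have : (inner ℝ ν x - c) / inner ℝ ν v = s := by
        rw [inner_sub_right, inner_smul_right] at h1
        field_simp
        linarith
      rw [this]
      exact ⟨hs, hx⟩
    · rintro ⟨h1, h2⟩
      exact ⟨_, h1, h2⟩
  rw [this]
  exact (hJ.preimage (by fun_prop)).inter (hAm.preimage (by fun_prop))

theorem map_surface_restrict_prod {ν v : Space d} [hν : Fact (‖ν‖ = 1)] {c : ℝ}
    (h : inner ℝ ν v ≠ 0) {A : Set (Space d)} (hA : A ⊆ hyperplane ν c) (hAm : MeasurableSet A)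
    {J : Set ℝ} (hJ : MeasurableSet J) :
    (((Mesh.surface d).restrict A).prod (volume.restrict J)).map
      (fun p : Space d × ℝ => p.1 + p.2 • v) =
      ENNReal.ofReal |(inner ℝ ν v)⁻¹| • volume.restrict (sweep A v J) := by
  have hS := measurableSet_sweep h hA hAm hJ
  have hm : Measurable (fun p : Space d × ℝ => p.1 + p.2 • v) := by fun_prop
  rw [← Measure.restrict_smul, ← map_surface_hyperplane_prod c h, Measure.restrict_map hm hS]
  congr 1
  have h1 : (Mesh.surface d).restrict A =
      ((Mesh.surface d).restrict (hyperplane ν c)).restrict A := by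
    rw [Measure.restrict_restrict hAm, Set.inter_eq_self_of_subset_left hA]
  rw [h1, Measure.prod_restrict, ← preimage_sweep h hA J]
  refine Measure.restrict_congr_set ?_
  have h2 : ∀ᵐ p ∂(((Mesh.surface d).restrict (hyperplane ν c)).prod (volume : Measure ℝ)),
      p ∈ hyperplane ν c ×ˢ (Set.univ : Set ℝ) := by
    have := Measure.quasiMeasurePreserving_fst
      (μ := (Mesh.surface d).restrict (hyperplane ν c)) (ν := (volume : Measure ℝ))
    filter_upwards [this.ae (ae_restrict_mem (measurableSet_hyperplane ν c))] with p hp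
    exact ⟨hp, trivial⟩
  filter_upwards [h2] with p hp
  exact propext ⟨fun h => h.1, fun h => ⟨h, hp⟩⟩

theorem volume_hyperplane {w : Space d} (hw : w ≠ 0) (c : ℝ) :
    volume (hyperplane w c) = 0 := by
  let A : AffineSubspace ℝ (Space d) :=
    (AffineSubspace.mk' (c) (⊥ : Submodule ℝ ℝ)).comap
      (innerSL ℝ w : Space d →L[ℝ] ℝ).toLinearMap.toAffineMap
  have hA : (A : Set (Space d)) = hyperplane w c := by
    ext x
    simp [A, hyperplane, AffineSubspace.mem_mk', sub_eq_zero]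
  rw [← hA]
  refine Measure.addHaar_affineSubspace _ _ ?_
  intro h
  have h1 : ∀ x : Space d, inner ℝ w x = c := fun x => by
    have : x ∈ (A : Set (Space d)) := by rw [h]; trivial
    rwa [hA] at this
  have h2 := h1 0
  have h3 := h1 w
  rw [inner_zero_right] at h2
  rw [← h2] at h3
  exact hw (inner_self_eq_zero.1 h3)

/-- Two independent linear equations confine the union of all lines in a given direction through
their solution set to a hyperplane. -/
theorem exists_hyperplane_of_sweep {a b v : Space d} (ha : ‖a‖ = 1) (hb : ‖b‖ = 1) (hab : b ≠ a)
    (hab' : b ≠ -a) (c c' : ℝ) {Z : Set (Space d)} (hZ : Z ⊆ hyperplane a c ∩ hyperplane b c') :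
    ∃ w ≠ 0, ∃ e, sweep Z v Set.univ ⊆ hyperplane w e := by
  have ha0 : a ≠ 0 := by rintro rfl; simp at ha
  by_cases hav : inner ℝ a v = 0
  · refine ⟨a, ha0, c, ?_⟩
    rintro x ⟨s, -, hx⟩
    have := (hZ hx).1
    simpa [hyperplane, inner_sub_right, inner_smul_right, hav] using this
  -- This combination of the two normals is orthogonal to `v`, so the equation it satisfies on `Z`
  -- persists along every line. It is nonzero because `a` and `b` are unit vectors that are not
  -- parallel.
  · refine ⟨inner ℝ b v • a - inner ℝ a v • b, ?_, inner ℝ b v * c - inner ℝ a v * c', ?_⟩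
    · intro h
      have h1 : inner ℝ b v • a = inner ℝ a v • b := sub_eq_zero.1 h
      have h2 : |inner ℝ b v| = |inner ℝ a v| := by
        have := congrArg norm h1
        simpa [norm_smul, ha, hb] using this
      rcases abs_eq_abs.1 h2 with h3 | h3
      · rw [h3] at h1
        exact hab (smul_right_injective _ hav h1).symm
      · rw [h3, neg_smul, ← smul_neg] at h1
        exact hab' (smul_right_injective _ hav h1).symm
    · rintro x ⟨s, -, hx⟩
      have h1 : inner ℝ a (x - s • v) = c := (hZ hx).1
      have h2 : inner ℝ b (x - s • v) = c' := (hZ hx).2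
      simp only [inner_sub_right, inner_smul_right] at h1 h2
      simp only [hyperplane, Set.mem_ofPred_eq, inner_sub_left, real_inner_smul_left]
      linear_combination inner ℝ b v * h1 - inner ℝ a v * h2

/-! ### Cells, faces and lines in general position. -/

namespace Mesh

variable (M : Mesh d)

theorem isClosed_carrier (i : M.Cell) : IsClosed (M.carrier i) := (M.isCompact_carrier i).isClosed

theorem measurableSet_carrier (i : M.Cell) : MeasurableSet (M.carrier i) :=
  (M.isClosed_carrier i).measurableSet

theorem measurableSet_face (i j : M.Cell) : MeasurableSet (M.face i j) :=
  (M.measurableSet_carrier i).inter (M.measurableSet_carrier j)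

theorem isCompact_face (i j : M.Cell) : IsCompact (M.face i j) :=
  (M.isCompact_carrier i).inter_right (M.isClosed_carrier j)

theorem face_comm (i j : M.Cell) : M.face i j = M.face j i := Set.inter_comm _ _

theorem adj_comm {i j : M.Cell} : M.Adj i j ↔ M.Adj j i := by
  simp only [Adj, M.face_comm i j, ne_comm]

theorem mem_neighbors {i j : M.Cell} : j ∈ M.neighbors i ↔ M.Adj i j := by
  simp [neighbors]

instance countable_cell : Countable M.Cell := by
  rw [← Set.countable_univ_iff]
  exact M.locallyFinite.countable_univ fun i => (M.nonempty_interior i).mono interior_subset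

theorem volume_carrier_pos (i : M.Cell) : 0 < volume (M.carrier i) :=
  (isOpen_interior.measure_pos _ (M.nonempty_interior i)).trans_le (measure_mono interior_subset)

theorem not_subset_hyperplane (i : M.Cell) {w : Space d} (hw : w ≠ 0) (c : ℝ) :
    ¬ M.carrier i ⊆ hyperplane w c := fun h =>
  (M.volume_carrier_pos i).ne' (measure_mono_null h (volume_hyperplane hw c))

theorem volume_frontier (i : M.Cell) : volume (frontier (M.carrier i)) = 0 :=
  (M.convex_carrier i).addHaar_frontier _

theorem eq_of_mem_of_notMem_frontier {i j : M.Cell} {x : Space d} (hi : x ∈ M.carrier i)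
    (hj : x ∈ M.carrier j) (hfi : x ∉ frontier (M.carrier i)) (hfj : x ∉ frontier (M.carrier j)) :
    i = j := by
  by_contra h
  have h1 : ∀ l, x ∈ M.carrier l → x ∉ frontier (M.carrier l) → x ∈ interior (M.carrier l) :=
    fun l hl hf => by
      by_contra hx
      exact hf ⟨subset_closure hl, hx⟩
  exact Set.disjoint_left.1 (M.disjoint_interior i j h) (h1 i hi hfi) (h1 j hj hfj)

theorem ae_mem_unique : ∀ᵐ x : Space d, ∀ i j, x ∈ M.carrier i → x ∈ M.carrier j → i = j := by
  have h : ∀ᵐ x : Space d, ∀ i, x ∉ frontier (M.carrier i) :=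
    ae_all_iff.2 fun i => measure_eq_zero_iff_ae_notMem.1 (M.volume_frontier i)
  filter_upwards [h] with x hx i j hi hj
  exact M.eq_of_mem_of_notMem_frontier hi hj (hx i) (hx j)

theorem normal_spec {i j : M.Cell} (h : i ≠ j) {z : Space d} (hz : z ∈ M.face i j) :
    (∀ x ∈ M.carrier i, inner ℝ (M.normal i j) x ≤ inner ℝ (M.normal i j) z) ∧
      ∀ y ∈ M.carrier j, inner ℝ (M.normal i j) z ≤ inner ℝ (M.normal i j) y :=
  ⟨fun x hx => (M.isNormal_normal h).2 x hx z hz.2, fun y hy => (M.isNormal_normal h).2 z hz.1 y hy⟩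

theorem norm_normal {i j : M.Cell} (h : i ≠ j) : ‖M.normal i j‖ = 1 := (M.isNormal_normal h).1

theorem normal_ne_zero {i j : M.Cell} (h : i ≠ j) : M.normal i j ≠ 0 := fun h0 => by
  have := M.norm_normal h
  simp [h0] at this

/-- Points of both cells satisfy the separating inequality in both directions. -/
theorem face_subset_hyperplane {i j : M.Cell} (h : i ≠ j) :
    ∃ c, M.face i j ⊆ hyperplane (M.normal i j) c := by
  rcases (M.face i j).eq_empty_or_nonempty with h0 | ⟨z, hz⟩
  · exact ⟨0, by simp [h0]⟩
  · refine ⟨inner ℝ (M.normal i j) z, fun x hx => ?_⟩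
    exact le_antisymm ((M.normal_spec h hz).1 x hx.1) ((M.normal_spec h hz).2 x hx.2)

/-- A union of cells is closed. -/
theorem isClosed_biUnion_carrier (s : Set M.Cell) : IsClosed (⋃ i ∈ s, M.carrier i) := by
  rw [Set.biUnion_eq_iUnion]
  exact (M.locallyFinite.comp_injective Subtype.val_injective).isClosed_iUnion
    fun i => M.isClosed_carrier _

/-- The other cells cover the complement of the cell. Their union is closed by local finiteness, so
it also covers the closure of that complement. -/
theorem exists_ne_of_notMem_interior {i : M.Cell} {y : Space d} (hy : y ∉ interior (M.carrier i)) :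
    ∃ j, i ≠ j ∧ y ∈ M.carrier j := by
  have h1 : (M.carrier i)ᶜ ⊆ ⋃ j ∈ {j | i ≠ j}, M.carrier j := fun x hx => by
    obtain ⟨j, hj⟩ := M.cover x
    refine Set.mem_biUnion (x := j) ?_ hj
    rintro rfl
    exact hx hj
  have h2 := closure_minimal h1 (M.isClosed_biUnion_carrier _)
  rw [closure_compl] at h2
  simpa using h2 hy

/-- Near a point that belongs to exactly two cells, a cell is a half-space. -/
theorem eventually_mem_of_inner_neg {i j : M.Cell} (hij : i ≠ j) {y v : Space d}
    (hy : y ∈ M.face i j) (hu : ∀ l, y ∈ M.carrier l → l = i ∨ l = j)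
    (hv : inner ℝ (M.normal i j) v < 0) :
    ∀ᶠ s in 𝓝[>] (0 : ℝ), y + s • v ∈ M.carrier i := by
  -- The remaining cells form a closed set that misses `y`. Close to `y` only `i` and `j` are
  -- available, and the sign of the inner product excludes `j`.
  have h1 : y ∈ (⋃ l ∈ {l | l ≠ i ∧ l ≠ j}, M.carrier l)ᶜ := by
    simp only [Set.mem_compl_iff, Set.mem_iUnion, not_exists]
    intro l hl hyl
    rcases hu l hyl with h | h
    · exact hl.1 h
    · exact hl.2 h
  have h2 : Tendsto (fun s : ℝ => y + s • v) (𝓝[>] 0) (𝓝 y) := by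
    have : Continuous (fun s : ℝ => y + s • v) := by fun_prop
    simpa using (this.tendsto 0).mono_left nhdsWithin_le_nhds
  filter_upwards [h2.eventually ((M.isClosed_biUnion_carrier _).isOpen_compl.mem_nhds h1),
    self_mem_nhdsWithin] with s hs hs0
  obtain ⟨l, hl⟩ := M.cover (y + s • v)
  by_cases hli : l = i
  · rwa [← hli]
  by_cases hlj : l = j
  · exfalso
    subst hlj
    have := (M.normal_spec hij hy).2 _ hl
    rw [inner_add_right, inner_smul_right] at this
    have h3 : s * inner ℝ (M.normal i l) v < 0 := mul_neg_of_pos_of_neg hs0 hv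
    linarith
  · exact absurd (Set.mem_biUnion (show l ∈ {l | l ≠ i ∧ l ≠ j} from ⟨hli, hlj⟩) hl) hs

theorem notMem_of_inner_pos {i j : M.Cell} (hij : i ≠ j) {y v : Space d}
    (hy : y ∈ M.face i j) (hv : 0 < inner ℝ (M.normal i j) v) {s : ℝ} (hs : 0 < s) :
    y + s • v ∉ M.carrier i := fun h => by
  have := (M.normal_spec hij hy).1 _ h
  rw [inner_add_right, inner_smul_right] at this
  have h3 : 0 < s * inner ℝ (M.normal i j) v := mul_pos hs hv
  linarith

/-- The lines in a given direction through the points common to three cells form a null set. -/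
theorem volume_sweep_triple {i j l : M.Cell} (hij : i ≠ j) (hil : i ≠ l) (hjl : j ≠ l)
    (v : Space d) :
    volume (sweep (M.face i j ∩ M.face i l) v Set.univ) = 0 := by
  rcases (M.face i j ∩ M.face i l).eq_empty_or_nonempty with h0 | ⟨z, hz⟩
  · simp [h0, sweep]
  obtain ⟨ci, hci⟩ := M.face_subset_hyperplane hij
  obtain ⟨cl, hcl⟩ := M.face_subset_hyperplane hil
  obtain ⟨cj, hcj⟩ := M.face_subset_hyperplane hjl
  have key : ∀ b c', ‖b‖ = 1 → b ≠ M.normal i j → b ≠ -M.normal i j →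
      M.face i j ∩ M.face i l ⊆ hyperplane b c' →
      volume (sweep (M.face i j ∩ M.face i l) v Set.univ) = 0 := by
    intro b c' hb h1 h2 h3
    obtain ⟨w, hw, e, he⟩ := exists_hyperplane_of_sweep (v := v) (M.norm_normal hij) hb h1 h2 ci c'
      (fun x hx => ⟨hci hx.1, h3 hx⟩)
    exact measure_mono_null he (volume_hyperplane hw e)
  have hzjl : z ∈ M.face j l := ⟨hz.1.2, hz.2.2⟩
  have sub : ∀ m, (∀ x ∈ M.carrier m, inner ℝ (M.normal i j) x = inner ℝ (M.normal i j) z) → False :=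
    fun m hm => M.not_subset_hyperplane m (M.normal_ne_zero hij) _ hm
  have nij := M.normal_spec hij hz.1
  have nil := M.normal_spec hil hz.2
  have njl := M.normal_spec hjl hzjl
  -- If two of the three face normals are independent, `key` applies. Otherwise all are `±` the
  -- normal of the first face, and each combination of signs presses one of the three cells into a
  -- hyperplane, contradicting its nonempty interior.
  by_cases h1 : M.normal i l = -M.normal i j
  · exfalso
    simp only [h1, inner_neg_left, neg_le_neg_iff] at nil
    exact sub i fun x hx => le_antisymm (nij.1 x hx) (nil.1 x hx)
  by_cases h2 : M.normal i l = M.normal i j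
  · refine key (M.normal j l) cj (M.norm_normal hjl) (fun h3 => ?_) (fun h3 => ?_)
      fun x hx => hcj ⟨hx.1.2, hx.2.2⟩
    · rw [h3] at njl
      exact sub j fun x hx => le_antisymm (njl.1 x hx) (nij.2 x hx)
    · simp only [h3, inner_neg_left, neg_le_neg_iff] at njl
      rw [h2] at nil
      exact sub l fun x hx => le_antisymm (njl.2 x hx) (nil.2 x hx)
  · exact key _ cl (M.norm_normal hil) h2 h1 fun x hx => hcl hx.2

/-- The lines in a given direction through an interface that is a null set or parallel to that
direction form a null set. -/
theorem volume_sweep_face {i j : M.Cell} (hij : i ≠ j) {v : Space d}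
    (h : inner ℝ (M.normal i j) v = 0 ∨ ¬ M.Adj i j) :
    volume (sweep (M.face i j) v Set.univ) = 0 := by
  obtain ⟨c, hc⟩ := M.face_subset_hyperplane hij
  by_cases h0 : inner ℝ (M.normal i j) v = 0
  · refine measure_mono_null ?_ (volume_hyperplane (M.normal_ne_zero hij) c)
    rintro x ⟨s, -, hx⟩
    have := hc hx
    simpa [hyperplane, inner_sub_right, inner_smul_right, h0] using this
  · have h1 : surface d (M.face i j) = 0 := by
      have := h.resolve_left h0
      simpa [Adj, hij] using this
    have : Fact (‖M.normal i j‖ = 1) := ⟨M.norm_normal hij⟩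
    have h2 := map_surface_restrict_prod h0 hc (M.measurableSet_face i j) MeasurableSet.univ
    rw [Measure.restrict_eq_zero.2 h1, Measure.zero_prod, Measure.map_zero] at h2
    have h3 : (ENNReal.ofReal |(inner ℝ (M.normal i j) v)⁻¹| •
      volume.restrict (sweep (M.face i j) v Set.univ)) Set.univ = 0 := by
        rw [← h2]; simp
    rw [Measure.smul_apply, smul_eq_mul, mul_eq_zero] at h3
    rcases h3 with h3 | h3
    · exfalso
      rw [ENNReal.ofReal_eq_zero] at h3
      exact absurd h3 (not_le.2 (abs_pos.2 (inv_ne_zero h0)))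
    · simpa using h3

/-- A line meets the boundary of the cell `i` in general position. -/
structure IsGeneric (i : M.Cell) (v x : Space d) : Prop where
  notMem_frontier : x ∉ frontier (M.carrier i)
  unique : ∀ t : ℝ, ∀ j l, i ≠ j → i ≠ l → x - t • v ∈ M.face i j → x - t • v ∈ M.face i l → j = l
  adj : ∀ t : ℝ, ∀ j, i ≠ j → x - t • v ∈ M.face i j →
    M.Adj i j ∧ inner ℝ (M.normal i j) v ≠ 0

theorem ae_isGeneric (i : M.Cell) (v : Space d) : ∀ᵐ x, M.IsGeneric i v x := by
  have h1 := measure_eq_zero_iff_ae_notMem.1 (M.volume_frontier i)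
  have h2 : ∀ᵐ x : Space d, ∀ j l, i ≠ j → i ≠ l → j ≠ l →
      x ∉ sweep (M.face i j ∩ M.face i l) v Set.univ := by
    simp only [ae_all_iff]
    exact fun j l hij hil hjl => measure_eq_zero_iff_ae_notMem.1 (M.volume_sweep_triple hij hil hjl v)
  have h3 : ∀ᵐ x : Space d, ∀ j, i ≠ j → (inner ℝ (M.normal i j) v = 0 ∨ ¬ M.Adj i j) →
      x ∉ sweep (M.face i j) v Set.univ := by
    simp only [ae_all_iff]
    exact fun j hij h => measure_eq_zero_iff_ae_notMem.1 (M.volume_sweep_face hij h)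
  filter_upwards [h1, h2, h3] with x hx1 hx2 hx3
  refine ⟨hx1, fun t j l hj hl htj htl => ?_, fun t j hj ht => ?_⟩
  · by_contra h
    exact hx2 j l hj hl h ⟨t, trivial, htj, htl⟩
  · by_contra h
    exact hx3 j hj (by tauto) ⟨t, trivial, ht⟩

open Classical in
-- Follow the ray `x - t • v`, `t > 0`, and record its crossings with the boundary of the cell: `+1`
-- on entering, `-1` on leaving. A ray that starts inside only leaves. A ray that starts outside
-- either misses the cell or enters and leaves once each, by convexity.
theorem sum_sign_sweep {i : M.Cell} {v x : Space d} (hv : v ≠ 0) (hx : M.IsGeneric i v x) :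
    ∑ j ∈ M.neighbors i, (if x ∈ sweep (M.face i j) v (Set.Ioi 0) then
      Real.sign (inner ℝ (M.normal i j) v) else 0) = if x ∈ M.carrier i then -1 else 0 := by
  -- By genericity a boundary point on the line belongs to exactly two cells, so the local
  -- half-space description of the cell applies there.
  have hcell : ∀ {t : ℝ} {j}, i ≠ j → x - t • v ∈ M.face i j →
      ∀ l, x - t • v ∈ M.carrier l → l = i ∨ l = j := by
    intro t j hij ht l hl
    by_cases hil : i = l
    · exact Or.inl hil.symm
    · exact Or.inr (hx.unique t l j hil hij ⟨ht.1, hl⟩ ht)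
  have hshift : ∀ t s : ℝ, x - t • v + s • v = x - (t - s) • v := fun t s => by module
  have hshift' : ∀ t s : ℝ, x - t • v + s • (-v) = x - (t + s) • v := fun t s => by module
  -- entry points
  have pos_lt : ∀ {t t' : ℝ} {j}, i ≠ j → x - t • v ∈ M.face i j →
      0 < inner ℝ (M.normal i j) v → x - t' • v ∈ M.carrier i → t ≤ t' := by
    intro t t' j hij ht hp ht'
    by_contra hlt
    have := M.notMem_of_inner_pos hij ht hp (s := t - t') (by linarith)
    rw [hshift] at this
    simp only [sub_sub_cancel] at this
    exact this ht'
  have neg_lt : ∀ {t t' : ℝ} {j}, i ≠ j → x - t • v ∈ M.face i j →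
      inner ℝ (M.normal i j) v < 0 → x - t' • v ∈ M.carrier i → t' ≤ t := by
    intro t t' j hij ht hp ht'
    by_contra hlt
    have := M.notMem_of_inner_pos hij ht (v := -v) (by rw [inner_neg_right]; linarith)
      (s := t' - t) (by linarith)
    rw [hshift'] at this
    simp only [add_sub_cancel] at this
    exact this ht'
  have pos_ex : ∀ {t t₀ : ℝ} {j}, i ≠ j → x - t • v ∈ M.face i j →
      0 < inner ℝ (M.normal i j) v → t < t₀ → ∃ t', t < t' ∧ t' < t₀ ∧ x - t' • v ∈ M.carrier i := by
    intro t t₀ j hij ht hp h0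
    have h1 := M.eventually_mem_of_inner_neg hij (v := -v) ht (hcell hij ht)
      (by rw [inner_neg_right]; linarith)
    have h2 : ∀ᶠ s in 𝓝[>] (0 : ℝ), s < t₀ - t :=
      (eventually_lt_nhds (by linarith)).filter_mono nhdsWithin_le_nhds
    obtain ⟨s, hs, hs', hs0⟩ := (h1.and (h2.and self_mem_nhdsWithin)).exists
    rw [hshift'] at hs
    have : 0 < s := hs0
    exact ⟨t + s, by linarith, by linarith, hs⟩
  have neg_ex : ∀ {t t₀ : ℝ} {j}, i ≠ j → x - t • v ∈ M.face i j →
      inner ℝ (M.normal i j) v < 0 → t₀ < t → ∃ t', t₀ < t' ∧ t' < t ∧ x - t' • v ∈ M.carrier i := by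
    intro t t₀ j hij ht hp h0
    have h1 := M.eventually_mem_of_inner_neg hij (v := v) ht (hcell hij ht) hp
    have h2 : ∀ᶠ s in 𝓝[>] (0 : ℝ), s < t - t₀ :=
      (eventually_lt_nhds (by linarith)).filter_mono nhdsWithin_le_nhds
    obtain ⟨s, hs, hs', hs0⟩ := (h1.and (h2.and self_mem_nhdsWithin)).exists
    rw [hshift] at hs
    have : 0 < s := hs0
    exact ⟨t - s, by linarith, by linarith, hs⟩
  -- The times at which the ray is in the cell. The set is compact because `v ≠ 0`; its greatest
  -- element is the exit time, and its least element, if `x` is outside, is the entry time.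
  set S : Set ℝ := {t | 0 ≤ t ∧ x - t • v ∈ M.carrier i} with hS
  have hcont : Continuous (fun t : ℝ => x - t • v) := by fun_prop
  have hScomp : IsCompact S := by
    refine Metric.isCompact_of_isClosed_isBounded
      (isClosed_Ici.inter ((M.isClosed_carrier i).preimage hcont)) ?_
    obtain ⟨R, hR⟩ := (M.isCompact_carrier i).isBounded.exists_norm_le
    refine (Metric.isBounded_Icc 0 ((‖x‖ + R) / ‖v‖)).subset ?_
    rintro t ⟨ht0, ht⟩
    refine ⟨ht0, ?_⟩
    rw [le_div_iff₀ (norm_pos_iff.2 hv)]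
    have h1 := hR _ ht
    have h2 : ‖t • v‖ ≤ ‖x‖ + ‖x - t • v‖ := by
      have := norm_sub_le x (x - t • v)
      rwa [sub_sub_cancel] at this
    rw [norm_smul, Real.norm_of_nonneg ht0] at h2
    linarith
  -- the last point of the line in the cell lies on a face with a negative normal component
  have last : S.Nonempty → ∃ t ∈ S, ∃ j, i ≠ j ∧ x - t • v ∈ M.face i j ∧
      inner ℝ (M.normal i j) v < 0 := by
    intro hne
    obtain ⟨t, ht, hmax⟩ := hScomp.exists_isGreatest hne
    have hint : x - t • v ∉ interior (M.carrier i) := by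
      intro hint
      have h1 : ∀ᶠ s in 𝓝[>] t, x - s • v ∈ interior (M.carrier i) :=
        (hcont.continuousAt.eventually (isOpen_interior.mem_nhds hint)).filter_mono
          nhdsWithin_le_nhds
      obtain ⟨s, hs, hts⟩ := (h1.and self_mem_nhdsWithin).exists
      have hts' : t < s := hts
      exact absurd (hmax ⟨ht.1.trans hts'.le, interior_subset hs⟩) (not_le.2 hts')
    obtain ⟨j, hij, hj⟩ := M.exists_ne_of_notMem_interior hint
    have hf : x - t • v ∈ M.face i j := ⟨ht.2, hj⟩
    refine ⟨t, ht, j, hij, hf, lt_of_le_of_ne (not_lt.1 fun hp => ?_) (hx.adj t j hij hf).2⟩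
    obtain ⟨t', h1, -, h2⟩ := pos_ex hij hf hp (lt_add_one t)
    exact absurd (hmax ⟨ht.1.trans h1.le, h2⟩) (not_le.2 h1)
  by_cases hxi : x ∈ M.carrier i
  · rw [if_pos hxi]
    obtain ⟨t, ht, j, hij, hf, hneg⟩ := last ⟨0, le_rfl, by simpa using hxi⟩
    -- The swept region uses only `t > 0`. The time `0` is excluded because `x` avoids the frontier
    -- and is therefore an interior point.
    have ht0 : 0 < t := by
      refine lt_of_le_of_ne ht.1 ?_
      rintro rfl
      rw [zero_smul, sub_zero] at hf
      refine hx.notMem_frontier ⟨subset_closure hxi, fun hint => ?_⟩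
      have h1' : ∀ᶠ s in 𝓝[>] (0 : ℝ), x - s • v ∈ interior (M.carrier i) := by
        have : Tendsto (fun t : ℝ => x - t • v) (𝓝[>] 0) (𝓝 x) := by
          simpa using (hcont.tendsto 0).mono_left nhdsWithin_le_nhds
        exact this.eventually (isOpen_interior.mem_nhds hint)
      obtain ⟨s, hs, hs0⟩ := (h1'.and self_mem_nhdsWithin).exists
      have h3 : s ≤ 0 := neg_lt (t := 0) hij (by simpa using hf) hneg (interior_subset hs)
      exact absurd h3 (not_le.2 hs0)
    rw [Finset.sum_eq_single j]
    · rw [if_pos ⟨t, ht0, hf⟩, Real.sign_of_neg hneg]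
    · intro j' hj' hne
      rw [if_neg]
      rintro ⟨t', ht', hf'⟩
      have ht'0 : 0 < t' := ht'
      have hij' := (M.mem_neighbors.1 hj').1
      rcases lt_or_gt_of_ne (hx.adj t' j' hij' hf').2 with h | h
      · have h1 := neg_lt hij' hf' h ht.2
        have h2 := neg_lt hij hf hneg hf'.1
        obtain rfl : t = t' := le_antisymm h1 h2
        exact hne (hx.unique t j' j hij' hij hf' hf)
      · have := pos_lt (t' := 0) hij' hf' h (by simpa using hxi)
        linarith
    · intro hj
      exact absurd (M.mem_neighbors.2 (hx.adj t j hij hf).1) hj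
  · rw [if_neg hxi]
    rcases S.eq_empty_or_nonempty with hSe | hSne
    · refine Finset.sum_eq_zero fun j hj => if_neg ?_
      rintro ⟨t, ht, hf⟩
      have : t ∈ S := ⟨le_of_lt ht, hf.1⟩
      simp [hSe] at this
    · have hS0 : ∀ t ∈ S, 0 < t := by
        rintro t ⟨ht0, ht⟩
        refine lt_of_le_of_ne ht0 ?_
        rintro rfl
        exact hxi (by simpa using ht)
      obtain ⟨t₂, ht₂, j₂, hij₂, hf₂, hneg⟩ := last hSne
      obtain ⟨t₁, ht₁, hmin⟩ := hScomp.exists_isLeast hSne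
      have hint : x - t₁ • v ∉ interior (M.carrier i) := by
        intro hint
        have h1 : ∀ᶠ s in 𝓝[<] t₁, x - s • v ∈ interior (M.carrier i) :=
          (hcont.continuousAt.eventually (isOpen_interior.mem_nhds hint)).filter_mono
            nhdsWithin_le_nhds
        have h2 : ∀ᶠ s in 𝓝[<] t₁, 0 < s :=
          (eventually_gt_nhds (hS0 _ ht₁)).filter_mono nhdsWithin_le_nhds
        obtain ⟨s, hs, hs0, hts⟩ := (h1.and (h2.and self_mem_nhdsWithin)).exists
        have hts' : s < t₁ := hts
        exact absurd (hmin ⟨hs0.le, interior_subset hs⟩) (not_le.2 hts')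
      obtain ⟨j₁, hij₁, hj₁⟩ := M.exists_ne_of_notMem_interior hint
      have hf₁ : x - t₁ • v ∈ M.face i j₁ := ⟨ht₁.2, hj₁⟩
      have hpos : 0 < inner ℝ (M.normal i j₁) v := by
        refine lt_of_le_of_ne (not_lt.1 fun hp => ?_) (hx.adj t₁ j₁ hij₁ hf₁).2.symm
        -- A negative face at the first time would have points of the cell just before it on the
        -- ray, against minimality.
        obtain ⟨t', h1, h2, h3⟩ := neg_ex hij₁ hf₁ hp (hS0 _ ht₁)
        exact absurd (hmin ⟨h1.le, h3⟩) (not_le.2 h2)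
      have hne : j₁ ≠ j₂ := by
        rintro rfl
        linarith
      rw [Finset.sum_eq_add_of_mem j₁ j₂ (M.mem_neighbors.2 (hx.adj t₁ j₁ hij₁ hf₁).1)
        (M.mem_neighbors.2 (hx.adj t₂ j₂ hij₂ hf₂).1) hne]
      · rw [if_pos ⟨t₁, hS0 _ ht₁, hf₁⟩, if_pos ⟨t₂, hS0 _ ht₂, hf₂⟩, Real.sign_of_neg hneg,
          Real.sign_of_pos hpos]
        norm_num
      · rintro j' hj' ⟨hne1, hne2⟩
        rw [if_neg]
        rintro ⟨t', ht', hf'⟩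
        have ht'0 : 0 < t' := ht'
        have hij' := (M.mem_neighbors.1 hj').1
        have ht'S : t' ∈ S := ⟨ht'0.le, hf'.1⟩
        rcases lt_or_gt_of_ne (hx.adj t' j' hij' hf').2 with h | h
        · obtain rfl : t₂ = t' :=
            le_antisymm (neg_lt hij' hf' h ht₂.2) (neg_lt hij₂ hf₂ hneg hf'.1)
          exact hne2 (hx.unique _ j' j₂ hij' hij₂ hf' hf₂)
        · obtain rfl : t₁ = t' :=
            le_antisymm (hmin ht'S) (pos_lt hij' hf' h ht₁.2)
          exact hne1 (hx.unique _ j' j₁ hij' hij₁ hf' hf₁)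

end Mesh

/-! ### The divergence theorem on a cell. -/

/-- Thickening `A` by `h` along its normal gives a set of volume area times `h`, which still lies in
a ball. This gives both the finiteness of the area of a face and its `h^(d-1)` bound. -/
theorem ofReal_mul_surface_le {ν : Space d} (hν : ‖ν‖ = 1) {c : ℝ} {A : Set (Space d)}
    (hA : A ⊆ hyperplane ν c) (hAm : MeasurableSet A) {x : Space d} {ρ h : ℝ}
    (hx : A ⊆ Metric.closedBall x ρ) :
    Mesh.surface d A * ENNReal.ofReal h ≤ volume (Metric.closedBall x (ρ + h)) := by
  have : Fact (‖ν‖ = 1) := ⟨hν⟩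
  have hνν : inner ℝ ν ν = (1 : ℝ) := by rw [real_inner_self_eq_norm_sq, hν]; norm_num
  have h1 := map_surface_restrict_prod (v := ν) (by rw [hνν]; norm_num) hA hAm
    (measurableSet_Ioc (a := (0 : ℝ)) (b := h))
  have h2 := congrArg (fun m : Measure (Space d) => m Set.univ) h1
  simp only [hνν] at h2
  rw [Measure.map_apply (by fun_prop) MeasurableSet.univ, Set.preimage_univ,
    ← Set.univ_prod_univ, Measure.prod_prod] at h2
  simp only [Measure.restrict_apply_univ, Real.volume_Ioc, sub_zero, inv_one, abs_one,
    ENNReal.ofReal_one, one_smul] at h2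
  rw [h2]
  refine measure_mono ?_
  rintro y ⟨s, hs, hy⟩
  have h3 := hx hy
  rw [Metric.mem_closedBall, dist_eq_norm] at h3 ⊢
  calc ‖y - x‖ = ‖(y - s • ν - x) + s • ν‖ := by congr 1; module
    _ ≤ ‖y - s • ν - x‖ + ‖s • ν‖ := norm_add_le _ _
    _ ≤ ρ + h := by
      rw [norm_smul, hν, mul_one, Real.norm_of_nonneg hs.1.le]
      exact add_le_add h3 hs.2

theorem surface_lt_top {ν : Space d} (hν : ‖ν‖ = 1) {c : ℝ} {A : Set (Space d)}
    (hA : A ⊆ hyperplane ν c) (hAc : IsCompact A) : Mesh.surface d A < ⊤ := by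
  obtain ⟨ρ, hρ⟩ := hAc.isBounded.subset_closedBall 0
  have h1 := ofReal_mul_surface_le hν hA hAc.measurableSet (h := 1) hρ
  rw [ENNReal.ofReal_one, mul_one] at h1
  exact h1.trans_lt measure_closedBall_lt_top

/-- Along each half-line `∫_0^∞ (d/ds) ψ(y + s v) ds = -ψ(y)`. Integrate over `A` and apply the
oblique change of variables; the factor `⟨ν, v⟩` cancels the Jacobian up to sign. -/
theorem integral_fderiv_sweep {ν v : Space d} (hν : ‖ν‖ = 1) {c : ℝ} {A : Set (Space d)}
    (hA : A ⊆ hyperplane ν c) (hAc : IsCompact A) {ψ : Space d → ℝ} (hψ : ContDiff ℝ 1 ψ)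
    (hψc : HasCompactSupport ψ) :
    inner ℝ ν v * ∫ y in A, ψ y ∂(Mesh.surface d) =
      -(Real.sign (inner ℝ ν v) * ∫ x in sweep A v (Set.Ioi 0), fderiv ℝ ψ x v) := by
  have : Fact (‖ν‖ = 1) := ⟨hν⟩
  by_cases h0 : inner ℝ ν v = 0
  · simp [h0, Real.sign_zero]
  have hsupp : ∀ y, v ≠ 0 → HasCompactSupport (fun s : ℝ => ψ (y + s • v)) := fun y hv =>
    hψc.comp_isClosedEmbedding
      ((Homeomorph.addLeft y).isClosedEmbedding.comp (isClosedEmbedding_smul_left hv))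
  have hv : v ≠ 0 := by rintro rfl; simp at h0
  have hg : Continuous (fun x => fderiv ℝ ψ x v) :=
    (hψ.continuous_fderiv (by norm_num)).clm_apply continuous_const
  have hgi : Integrable (fun x => fderiv ℝ ψ x v) :=
    hg.integrable_of_hasCompactSupport (hψc.fderiv_apply (𝕜 := ℝ) v)
  have hmap := map_surface_restrict_prod h0 hA hAc.measurableSet (measurableSet_Ioi (a := (0 : ℝ)))
  have hfin : IsFiniteMeasure ((Mesh.surface d).restrict A) :=
    ⟨by rw [Measure.restrict_apply_univ]; exact surface_lt_top hν hA hAc⟩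
  set μ := ((Mesh.surface d).restrict A).prod ((volume : Measure ℝ).restrict (Set.Ioi 0)) with hμ
  have hi : Integrable (fun p : Space d × ℝ => fderiv ℝ ψ (p.1 + p.2 • v) v) μ := by
    have h1 : Integrable (fun x => fderiv ℝ ψ x v)
        (μ.map (fun p : Space d × ℝ => p.1 + p.2 • v)) := by
      rw [hmap]
      exact (hgi.restrict).smul_measure ENNReal.ofReal_ne_top
    exact h1.comp_measurable (by fun_prop)
  have h2 : ∫ p, fderiv ℝ ψ (p.1 + p.2 • v) v ∂μ =
      |(inner ℝ ν v)⁻¹| * ∫ x in sweep A v (Set.Ioi 0), fderiv ℝ ψ x v := by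
    rw [← integral_map (φ := fun p : Space d × ℝ => p.1 + p.2 • v) (by fun_prop)
      hg.aestronglyMeasurable, hmap, integral_smul_measure,
      ENNReal.toReal_ofReal (abs_nonneg _), smul_eq_mul]
  have h3 : ∀ y, ∫ s in Set.Ioi (0 : ℝ), fderiv ℝ ψ (y + s • v) v = -ψ y := fun y => by
    have hd : ∀ s : ℝ, HasDerivAt (fun s : ℝ => ψ (y + s • v)) (fderiv ℝ ψ (y + s • v) v) s :=
      fun s => by
        have h4 : HasDerivAt (fun s : ℝ => y + s • v) v s := by
          simpa using ((hasDerivAt_id s).smul_const v).const_add y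
        exact ((hψ.differentiable (by norm_num)) _).hasFDerivAt.comp_hasDerivAt s h4
    have h5 : deriv (fun s : ℝ => ψ (y + s • v)) = fun s => fderiv ℝ ψ (y + s • v) v :=
      funext fun s => (hd s).deriv
    have h6 := HasCompactSupport.integral_Ioi_deriv_eq (f := fun s : ℝ => ψ (y + s • v))
      (hψ.comp (by fun_prop)) (hsupp y hv) 0
    rw [h5] at h6
    simpa using h6
  rw [hμ, integral_prod _ hi] at h2
  simp only [h3, integral_neg] at h2
  have h4 : ∫ y in A, ψ y ∂(Mesh.surface d) =
      -(|(inner ℝ ν v)⁻¹| * ∫ x in sweep A v (Set.Ioi 0), fderiv ℝ ψ x v) := by linarith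
  have h5 : inner ℝ ν v * |(inner ℝ ν v)⁻¹| = Real.sign (inner ℝ ν v) := by
    rcases lt_or_gt_of_ne h0 with h | h
    · rw [Real.sign_of_neg h, abs_of_neg (inv_lt_zero.2 h)]
      field_simp
    · rw [Real.sign_of_pos h, abs_of_pos (inv_pos.2 h)]
      field_simp
  rw [h4, ← h5]
  ring

namespace Mesh

variable (M : Mesh d)

theorem surface_face_lt_top {i j : M.Cell} (h : i ≠ j) : surface d (M.face i j) < ⊤ := by
  obtain ⟨c, hc⟩ := M.face_subset_hyperplane h
  exact surface_lt_top (M.norm_normal h) hc (M.isCompact_face i j)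

/-- Each face contributes a signed integral of the same function `∂_v ψ` over its swept region. The
signed indicators sum to minus that of the cell for almost every point. -/
theorem integral_fderiv_carrier_of_hasCompactSupport (i : M.Cell) {ψ : Space d → ℝ}
    (hψ : ContDiff ℝ 1 ψ) (hψc : HasCompactSupport ψ) (v : Space d) :
    ∫ x in M.carrier i, fderiv ℝ ψ x v =
      ∑ j ∈ M.neighbors i, inner ℝ (M.normal i j) v * ∫ y in M.face i j, ψ y ∂(surface d) := by
  classical
  by_cases hv : v = 0
  · simp [hv]
  have hg : Continuous (fun x => fderiv ℝ ψ x v) :=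
    (hψ.continuous_fderiv (by norm_num)).clm_apply continuous_const
  have hgi : Integrable (fun x => fderiv ℝ ψ x v) :=
    hg.integrable_of_hasCompactSupport (hψc.fderiv_apply (𝕜 := ℝ) v)
  let P : M.Cell → Set (Space d) := fun j => sweep (M.face i j) v (Set.Ioi 0)
  let ε : M.Cell → ℝ := fun j => Real.sign (inner ℝ (M.normal i j) v)
  have h1 : ∀ j ∈ M.neighbors i, inner ℝ (M.normal i j) v * ∫ y in M.face i j, ψ y ∂(surface d) =
      -∫ x, (if x ∈ P j then ε j else 0) * fderiv ℝ ψ x v := by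
    intro j hj
    have hij := (M.mem_neighbors.1 hj).1
    obtain ⟨c, hc⟩ := M.face_subset_hyperplane hij
    rw [integral_fderiv_sweep (M.norm_normal hij) hc (M.isCompact_face i j) hψ hψc]
    by_cases h0 : inner ℝ (M.normal i j) v = 0
    · simp [ε, h0, Real.sign_zero]
    · rw [← integral_const_mul, ← integral_indicator
        (measurableSet_sweep h0 hc (M.measurableSet_face i j) measurableSet_Ioi)]
      congr 2
      funext x
      by_cases hx : x ∈ P j
      · rw [if_pos hx, Set.indicator_of_mem hx]
      · rw [if_neg hx, Set.indicator_of_notMem hx, zero_mul]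
  have h2 : ∀ j ∈ M.neighbors i,
      Integrable (fun x => (if x ∈ P j then ε j else 0) * fderiv ℝ ψ x v) := by
    intro j hj
    have hij := (M.mem_neighbors.1 hj).1
    obtain ⟨c, hc⟩ := M.face_subset_hyperplane hij
    by_cases h0 : inner ℝ (M.normal i j) v = 0
    · simp [ε, h0, Real.sign_zero]
    · have h3 := ((hgi.const_mul (ε j)).indicator
        (measurableSet_sweep h0 hc (M.measurableSet_face i j) (measurableSet_Ioi (a := (0 : ℝ)))))
      refine h3.congr (Eventually.of_forall fun x => ?_)
      by_cases hx : x ∈ P j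
      · simp only [if_pos hx]; rw [Set.indicator_of_mem hx]
      · simp only [if_neg hx]; rw [Set.indicator_of_notMem hx, zero_mul]
  rw [Finset.sum_congr rfl h1, Finset.sum_neg_distrib, ← integral_finsetSum _ h2, ← integral_neg,
    ← integral_indicator (M.measurableSet_carrier i)]
  refine integral_congr_ae ?_
  filter_upwards [M.ae_isGeneric i v] with x hx
  rw [← Finset.sum_mul, M.sum_sign_sweep hv hx]
  by_cases hxi : x ∈ M.carrier i
  · simp [hxi]
  · simp [hxi]

/-- The divergence theorem on a cell, with the boundary integral written as a sum over edges. -/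
theorem integral_fderiv_carrier (i : M.Cell) {ψ : Space d → ℝ} (hψ : ContDiff ℝ 1 ψ)
    (v : Space d) :
    ∫ x in M.carrier i, fderiv ℝ ψ x v =
      ∑ j ∈ M.neighbors i, inner ℝ (M.normal i j) v * ∫ y in M.face i j, ψ y ∂(surface d) := by
  obtain ⟨R, hR⟩ := (M.isCompact_carrier i).isBounded.subset_ball_lt 0 0
  -- A cut-off equal to 1 near the cell removes the assumption of compact support, which polynomials
  -- do not satisfy.
  let b : ContDiffBump (0 : Space d) := ⟨R, R + 1, hR.1, by linarith⟩
  have hb : ∀ x ∈ M.carrier i, (fun y => b y * ψ y) =ᶠ[𝓝 x] ψ := fun x hx => by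
    filter_upwards [Metric.isOpen_ball.mem_nhds (hR.2 hx)] with y hy
    rw [b.one_of_mem_closedBall (Metric.ball_subset_closedBall hy), one_mul]
  have h := M.integral_fderiv_carrier_of_hasCompactSupport i (ψ := fun y => b y * ψ y)
    (b.contDiff.mul hψ) b.hasCompactSupport.mul_right v
  rw [setIntegral_congr_fun (M.measurableSet_carrier i)
    (g := fun x => fderiv ℝ ψ x v) fun x hx => by simp only [(hb x hx).fderiv_eq]] at h
  rw [h]
  refine Finset.sum_congr rfl fun j _ => ?_
  rw [setIntegral_congr_fun (M.measurableSet_face i j) (g := ψ)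
    fun x hx => (hb x hx.1).self_of_nhds]

end Mesh

/-! ### Counting and measure bounds on quasi-uniform meshes. -/

/-- The volume of the unit ball. -/
noncomputable def unitBallVolume (d : ℕ) : ℝ := volume.real (Metric.ball (0 : Space d) 1)

theorem unitBallVolume_pos : 0 < unitBallVolume d :=
  ENNReal.toReal_pos (Metric.measure_ball_pos _ _ one_pos).ne' measure_ball_lt_top.ne

theorem volume_real_ball (x : Space d) {r : ℝ} (hr : 0 < r) :
    volume.real (Metric.ball x r) = r ^ d * unitBallVolume d := by
  rw [Measure.real, Measure.addHaar_ball_of_pos _ _ hr, ENNReal.toReal_mul,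
    ENNReal.toReal_ofReal (by positivity), finrank_euclideanSpace_fin, unitBallVolume, Measure.real]

theorem volume_real_closedBall (x : Space d) {r : ℝ} (hr : 0 ≤ r) :
    volume.real (Metric.closedBall x r) = r ^ d * unitBallVolume d := by
  rw [Measure.real, Measure.addHaar_closedBall _ _ hr, ENNReal.toReal_mul,
    ENNReal.toReal_ofReal (by positivity), finrank_euclideanSpace_fin, unitBallVolume, Measure.real]

namespace Mesh

variable (M : Mesh d)

theorem dist_le_size {i : M.Cell} {x y : Space d} (hx : x ∈ M.carrier i) (hy : y ∈ M.carrier i) :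
    dist x y ≤ M.size :=
  (Metric.dist_le_diam_of_mem (M.isCompact_carrier i).isBounded hx hy).trans
    (le_ciSup M.bddAbove_diam i)

theorem carrier_subset_closedBall {i : M.Cell} {x : Space d} (hx : x ∈ M.carrier i) :
    M.carrier i ⊆ Metric.closedBall x M.size := fun _ hy => M.dist_le_size hy hx

theorem size_pos (hd : 1 ≤ d) : 0 < M.size := by
  obtain ⟨i, hi⟩ := M.cover 0
  have : Nonempty (Fin d) := ⟨⟨0, hd⟩⟩
  by_contra h
  have h1 : (M.carrier i).Subsingleton := fun x hx y hy =>
    dist_le_zero.1 ((M.dist_le_size hx hy).trans (not_lt.1 h))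
  exact (M.volume_carrier_pos i).ne' (h1.measure_zero _)

variable {M} {σ : ℝ}

/-- A packing argument: the inscribed balls of radius `σ h` are disjoint and all lie in the given
ball. -/
theorem IsQuasiUniform.card_mul_le (hM : M.IsQuasiUniform σ) (hσ : 0 < σ) (hh : 0 < M.size)
    {y : Space d} {ρ : ℝ} (hρ : 0 ≤ ρ) (J : Finset M.Cell)
    (hJ : ∀ i ∈ J, M.carrier i ⊆ Metric.closedBall y ρ) :
    (J.card : ℝ) * (σ * M.size) ^ d ≤ ρ ^ d := by
  choose x hx using hM
  have hr : 0 < σ * M.size := mul_pos hσ hh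
  have hsub : ∀ i, Metric.ball (x i) (σ * M.size) ⊆ interior (M.carrier i) := fun i =>
    interior_maximal (Metric.ball_subset_closedBall.trans (hx i)) Metric.isOpen_ball
  have h1 : volume.real (⋃ i ∈ J, Metric.ball (x i) (σ * M.size)) =
      ∑ i ∈ J, volume.real (Metric.ball (x i) (σ * M.size)) :=
    measureReal_biUnion_finset (fun i _ j _ hij =>
      (M.disjoint_interior i j hij).mono (hsub i) (hsub j)) (fun i _ => measurableSet_ball)
      (fun i _ => measure_ball_lt_top.ne)
  have h2 : volume.real (⋃ i ∈ J, Metric.ball (x i) (σ * M.size)) ≤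
      volume.real (Metric.closedBall y ρ) :=
    measureReal_mono (Set.iUnion₂_subset fun i hi =>
      ((hsub i).trans interior_subset).trans (hJ i hi)) measure_closedBall_lt_top.ne
  simp only [h1, volume_real_ball _ hr, volume_real_closedBall _ hρ, Finset.sum_const,
    nsmul_eq_mul, ← mul_assoc] at h2
  exact le_of_mul_le_mul_right h2 unitBallVolume_pos

theorem IsQuasiUniform.card_le (hM : M.IsQuasiUniform σ) (hσ : 0 < σ) (hh : 0 < M.size)
    {y : Space d} {r : ℝ} (hr : 0 ≤ r) (J : Finset M.Cell)
    (hJ : ∀ i ∈ J, M.carrier i ⊆ Metric.closedBall y (r * M.size)) :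
    (J.card : ℝ) ≤ (r / σ) ^ d := by
  have h := hM.card_mul_le hσ hh (by positivity) J hJ
  rw [mul_pow, mul_pow, ← mul_assoc] at h
  have h2 := le_of_mul_le_mul_right h (by positivity)
  rwa [div_pow, le_div_iff₀ (by positivity)]

theorem IsQuasiUniform.card_neighbors_le (hM : M.IsQuasiUniform σ) (hσ : 0 < σ)
    (hh : 0 < M.size) (i : M.Cell) : ((M.neighbors i).card : ℝ) ≤ (2 / σ) ^ d := by
  obtain ⟨x, hx⟩ := M.nonempty_interior i
  refine hM.card_le hσ hh (y := x) zero_le_two _ fun j hj => ?_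
  obtain ⟨z, hzi, hzj⟩ := nonempty_of_measure_ne_zero (M.mem_neighbors.1 hj).2.ne'
  intro y hy
  rw [Metric.mem_closedBall]
  linarith [dist_triangle y z x, M.dist_le_size hy hzj, M.dist_le_size hzi (interior_subset hx)]

/-- The face area is `O(h^(d-1))`. Multiplying by `h` on the left avoids the exponent `d - 1`. -/
theorem surface_real_face_le (hh : 0 < M.size) {i j : M.Cell} (h : i ≠ j) :
    (surface d).real (M.face i j) * M.size ≤ (2 * M.size) ^ d * unitBallVolume d := by
  obtain ⟨c, hc⟩ := M.face_subset_hyperplane h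
  obtain ⟨x, hx⟩ := M.nonempty_interior i
  have h1 := ofReal_mul_surface_le (M.norm_normal h) hc (M.measurableSet_face i j) (h := M.size)
    (fun y hy => M.carrier_subset_closedBall (interior_subset hx) hy.1)
  rw [← two_mul] at h1
  have h2 := ENNReal.toReal_mono measure_closedBall_lt_top.ne h1
  rw [ENNReal.toReal_mul, ENNReal.toReal_ofReal hh.le] at h2
  exact h2.trans_eq (volume_real_closedBall x (by positivity))

theorem volume_real_carrier_le (hh : 0 < M.size) (i : M.Cell) :
    volume.real (M.carrier i) ≤ M.size ^ d * unitBallVolume d := by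
  obtain ⟨x, hx⟩ := M.nonempty_interior i
  rw [← volume_real_closedBall x hh.le]
  exact measureReal_mono (M.carrier_subset_closedBall (interior_subset hx))
    measure_closedBall_lt_top.ne

end Mesh

/-! ### Calculus of polynomials and affine rescaling. -/

section polynomials

open MvPolynomial

theorem pval_C (c : ℝ) (x : Space d) : pval (C c) x = c := by simp [pval]

theorem pval_X (a : Fin d) (x : Space d) : pval (X a) x = x a := by simp [pval]

theorem pval_add (p q : MvPolynomial (Fin d) ℝ) (x : Space d) :
    pval (p + q) x = pval p x + pval q x := by simp [pval]

theorem pval_sub (p q : MvPolynomial (Fin d) ℝ) (x : Space d) :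
    pval (p - q) x = pval p x - pval q x := by simp [pval]

theorem pval_mul (p q : MvPolynomial (Fin d) ℝ) (x : Space d) :
    pval (p * q) x = pval p x * pval q x := by simp [pval]

theorem pval_smul (r : ℝ) (p : MvPolynomial (Fin d) ℝ) (x : Space d) :
    pval (r • p) x = r * pval p x := by simp [pval, smul_eval]

theorem pval_sum {ι : Type*} (s : Finset ι) (p : ι → MvPolynomial (Fin d) ℝ) (x : Space d) :
    pval (∑ i ∈ s, p i) x = ∑ i ∈ s, pval (p i) x := by simp [pval]

theorem pgrad_C (c : ℝ) (x : Space d) : pgrad (C c) x = 0 := by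
  ext a; simp [pgrad, pval]

theorem pgrad_X (a : Fin d) (x : Space d) :
    pgrad (X a) x = EuclideanSpace.single a 1 := by
  ext b
  rw [PiLp.single_apply]
  by_cases h : b = a
  · subst h; simp [pgrad, pval]
  · simp [pgrad, pval, h]

theorem pgrad_add (p q : MvPolynomial (Fin d) ℝ) (x : Space d) :
    pgrad (p + q) x = pgrad p x + pgrad q x := by
  ext a; simp [pgrad, pval]

theorem pgrad_smul (r : ℝ) (p : MvPolynomial (Fin d) ℝ) (x : Space d) :
    pgrad (r • p) x = r • pgrad p x := by
  ext a; simp [pgrad, pval, smul_eval]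

theorem pgrad_mul (p q : MvPolynomial (Fin d) ℝ) (x : Space d) :
    pgrad (p * q) x = pval p x • pgrad q x + pval q x • pgrad p x := by
  ext a; simp [pgrad, pval]

theorem pgrad_sum {ι : Type*} (s : Finset ι) (p : ι → MvPolynomial (Fin d) ℝ) (x : Space d) :
    pgrad (∑ i ∈ s, p i) x = ∑ i ∈ s, pgrad (p i) x := by
  classical
  induction s using Finset.induction_on with
  | empty => simpa using pgrad_C 0 x
  | insert a s ha ih => rw [Finset.sum_insert ha, Finset.sum_insert ha, pgrad_add, ih]

theorem contDiff_pval (p : MvPolynomial (Fin d) ℝ) {n : WithTop ℕ∞} : ContDiff ℝ n (pval p) := by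
  induction p using MvPolynomial.induction_on with
  | C c =>
    rw [show pval (C c : MvPolynomial (Fin d) ℝ) = fun _ => c by funext x; exact pval_C c x]
    exact contDiff_const
  | add p q hp hq =>
    rw [show pval (p + q) = fun x => pval p x + pval q x by funext x; exact pval_add p q x]
    exact hp.add hq
  | mul_X p a hp =>
    rw [show pval (p * X a) = fun x => pval p x * x a by
      funext x; rw [pval_mul, pval_X]]
    exact hp.mul (EuclideanSpace.proj a : Space d →L[ℝ] ℝ).contDiff

theorem continuous_pval (p : MvPolynomial (Fin d) ℝ) : Continuous (pval p) :=
  (contDiff_pval p (n := 0)).continuous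

theorem continuous_pgrad (p : MvPolynomial (Fin d) ℝ) : Continuous (pgrad p) :=
  (PiLp.continuous_toLp 2 _).comp (continuous_pi fun _ => continuous_pval _)

theorem fderiv_pval (p : MvPolynomial (Fin d) ℝ) (x v : Space d) :
    fderiv ℝ (pval p) x v = inner ℝ (pgrad p x) v := by
  have hd : ∀ q : MvPolynomial (Fin d) ℝ, DifferentiableAt ℝ (pval q) x := fun q =>
    (contDiff_pval q (n := 1)).differentiable (by norm_num) x
  induction p using MvPolynomial.induction_on with
  | C c =>
    rw [show pval (C c : MvPolynomial (Fin d) ℝ) = fun _ => c by funext x; exact pval_C c x,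
      pgrad_C, inner_zero_left, fderiv_fun_const]
    rfl
  | add p q hp hq =>
    rw [show pval (p + q) = fun x => pval p x + pval q x by funext x; exact pval_add p q x,
      pgrad_add, inner_add_left, fderiv_fun_add (hd p) (hd q), ← hp, ← hq]
    rfl
  | mul_X p a hp =>
    have h2 : HasFDerivAt (fun x : Space d => x a) (EuclideanSpace.proj a : Space d →L[ℝ] ℝ) x :=
      (EuclideanSpace.proj a : Space d →L[ℝ] ℝ).hasFDerivAt
    rw [show pval (p * X a) = fun x => pval p x * x a by
      funext x; rw [pval_mul, pval_X], pgrad_mul, inner_add_left, real_inner_smul_left,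
      real_inner_smul_left, ← hp, fderiv_fun_mul (hd p) h2.differentiableAt, h2.fderiv, pgrad_X,
      pval_X, EuclideanSpace.inner_single_left]
    simp

/-- The polynomial `y ↦ p (x₀ + h y)`. -/
noncomputable def affineSubst (x₀ : Space d) (h : ℝ) (p : MvPolynomial (Fin d) ℝ) :
    MvPolynomial (Fin d) ℝ :=
  aeval (fun a => C (x₀ a) + C h * X a) p

theorem pval_affineSubst (x₀ : Space d) (h : ℝ) (p : MvPolynomial (Fin d) ℝ) (y : Space d) :
    pval (affineSubst x₀ h p) y = pval p (x₀ + h • y) := by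
  induction p using MvPolynomial.induction_on with
  | C c => simp [affineSubst, pval]
  | add p q hp hq =>
    rw [pval_add, ← hp, ← hq, ← pval_add, affineSubst, map_add]
    rfl
  | mul_X p a hp =>
    rw [pval_mul, ← hp, pval_X, affineSubst, map_mul, pval_mul, aeval_X]
    simp only [pval_add, pval_mul, pval_C, pval_X, PiLp.add_apply, PiLp.smul_apply, smul_eq_mul]
    rfl

theorem pgrad_affineSubst (x₀ : Space d) (h : ℝ) (p : MvPolynomial (Fin d) ℝ) (y : Space d) :
    pgrad (affineSubst x₀ h p) y = h • pgrad p (x₀ + h • y) := by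
  refine ext_inner_right ℝ fun v => ?_
  have h1 : HasFDerivAt (fun y : Space d => x₀ + h • y)
      (h • ContinuousLinearMap.id ℝ (Space d)) y :=
    ((hasFDerivAt_id y).const_smul h).const_add x₀
  have h2 : DifferentiableAt ℝ (pval p) (x₀ + h • y) :=
    (contDiff_pval p (n := 1)).differentiable (by norm_num) _
  have h3 : HasFDerivAt (fun y => pval p (x₀ + h • y)) _ y :=
    HasFDerivAt.comp (g := pval p) y h2.hasFDerivAt h1
  rw [real_inner_smul_left, ← fderiv_pval, ← fderiv_pval,
    show pval (affineSubst x₀ h p) = fun y => pval p (x₀ + h • y) by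
      funext y; exact pval_affineSubst x₀ h p y, h3.fderiv]
  simp

theorem totalDegree_affineSubst_le (x₀ : Space d) (h : ℝ) (p : MvPolynomial (Fin d) ℝ) :
    (affineSubst x₀ h p).totalDegree ≤ p.totalDegree := by
  rw [affineSubst, aeval_def, eval₂_eq']
  refine totalDegree_finsetSum_le fun m hm => ?_
  refine (totalDegree_mul _ _).trans ?_
  rw [algebraMap_eq, totalDegree_C, zero_add]
  refine (totalDegree_finsetProd _ _).trans ?_
  have h1 := le_totalDegree hm
  rw [Finsupp.sum_fintype _ _ fun _ => rfl] at h1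
  refine (Finset.sum_le_sum fun a _ => ?_).trans h1
  refine (totalDegree_pow _ _).trans ((Nat.mul_le_mul_left _ ?_).trans_eq (mul_one _))
  refine (totalDegree_add _ _).trans (max_le (by simp) ((totalDegree_mul _ _).trans ?_))
  simp

end polynomials

/-! ### Inverse estimates. -/

section inverse_estimates

open MvPolynomial

theorem integrableOn_closedBall {g : Space d → ℝ} (hg : Continuous g) (x : Space d) (r : ℝ) :
    IntegrableOn g (Metric.closedBall x r) :=
  hg.continuousOn.integrableOn_compact (isCompact_closedBall _ _)

/-- A polynomial is determined by its values on a ball. -/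
theorem eq_zero_of_integral_sq_eq_zero {σ : ℝ} (hσ : 0 < σ) {p : MvPolynomial (Fin d) ℝ}
    (h : ∫ x in Metric.closedBall (0 : Space d) σ, pval p x * pval p x = 0) : p = 0 := by
  have hc : Continuous fun x : Space d => pval p x * pval p x :=
    (continuous_pval p).mul (continuous_pval p)
  have h1 : ∀ x ∈ Metric.ball (0 : Space d) σ, pval p x * pval p x = 0 := by
    have h2 := (setIntegral_eq_zero_iff_of_nonneg_ae
      (Eventually.of_forall fun x => mul_self_nonneg _) (integrableOn_closedBall hc 0 σ)).1 h
    have h3 : (fun x : Space d => pval p x * pval p x)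
        =ᵐ[volume.restrict (Metric.ball (0 : Space d) σ)] fun _ => 0 :=
      ae_mono (Measure.restrict_mono Metric.ball_subset_closedBall le_rfl) h2
    exact Measure.eqOn_open_of_ae_eq h3 Metric.isOpen_ball hc.continuousOn continuousOn_const
  -- The Euclidean ball contains a cube around the origin, and a polynomial that vanishes on a
  -- product of infinite sets is zero.
  obtain ⟨ε, hε, hball⟩ := Metric.isOpen_iff.1
    ((Metric.isOpen_ball (x := (0 : Space d)) (ε := σ)).preimage (PiLp.continuous_toLp 2 _))
    (0 : Fin d → ℝ) (by simpa using hσ)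
  refine MvPolynomial.funext_set (fun _ => Metric.ball (0 : ℝ) ε)
    (fun _ => by rw [Real.ball_eq_Ioo]; exact Set.Ioo_infinite (by linarith)) fun x hx => ?_
  have hx' : x ∈ Metric.ball (0 : Fin d → ℝ) ε := by
    rw [ball_pi _ hε]; exact hx
  have := mul_self_eq_zero.1 (h1 _ (hball hx'))
  simpa [pval] using this

/-- The `L^2` pairing on a ball is nondegenerate on the finite-dimensional polynomial space, so
every functional is a pairing. Boundedness of the representing polynomial then bounds the functional
by the `L^1` norm. -/
theorem exists_polynomial_representation (k : ℕ) {σ : ℝ} (hσ : 0 < σ)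
    (L : restrictTotalDegree (Fin d) ℝ k →ₗ[ℝ] ℝ) :
    ∃ g : MvPolynomial (Fin d) ℝ, ∀ p : restrictTotalDegree (Fin d) ℝ k,
      L p = ∫ x in Metric.closedBall (0 : Space d) σ, pval g x * pval p x := by
  have hi : ∀ p q : MvPolynomial (Fin d) ℝ,
      IntegrableOn (fun x => pval p x * pval q x) (Metric.closedBall (0 : Space d) σ) :=
    fun p q => integrableOn_closedBall ((continuous_pval p).mul (continuous_pval q)) 0 σ
  let B : LinearMap.BilinForm ℝ (restrictTotalDegree (Fin d) ℝ k) :=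
    LinearMap.mk₂ ℝ (fun p q => ∫ x in Metric.closedBall (0 : Space d) σ,
      pval (p : MvPolynomial (Fin d) ℝ) x * pval (q : MvPolynomial (Fin d) ℝ) x)
      (fun p q r => by
        simp only [Submodule.coe_add, pval_add, add_mul]
        exact integral_add (hi _ _) (hi _ _))
      (fun c p q => by
        simp only [Submodule.coe_smul, pval_smul, mul_assoc, smul_eq_mul]
        exact integral_const_mul _ _)
      (fun p q r => by
        simp only [Submodule.coe_add, pval_add, mul_add]
        exact integral_add (hi _ _) (hi _ _))
      (fun c p q => by
        simp only [Submodule.coe_smul, pval_smul, mul_left_comm _ c, smul_eq_mul]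
        exact integral_const_mul _ _)
  have hB : B.Nondegenerate := by
    constructor
    · intro p hp
      exact Subtype.ext (eq_zero_of_integral_sq_eq_zero hσ (hp p))
    · intro p hp
      exact Subtype.ext (eq_zero_of_integral_sq_eq_zero hσ (hp p))
  exact ⟨((B.toDual hB).symm L : restrictTotalDegree (Fin d) ℝ k), fun p =>
    (LinearMap.BilinForm.apply_toDual_symm_apply (hB := hB) L p).symm⟩

/-- Equivalence of norms in finite dimension, made concrete: expand in a basis. Each coordinate is a
pairing with a polynomial bounded on the small ball, and the basis and its gradients are bounded on
the unit ball. -/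
theorem inverse_estimate_unit (d k : ℕ) {σ : ℝ} (hσ : 0 < σ) :
    ∃ C : ℝ, 0 ≤ C ∧ ∀ p ∈ restrictTotalDegree (Fin d) ℝ k, ∀ x ∈ Metric.closedBall (0 : Space d) 1,
      |pval p x| ≤ C * ∫ y in Metric.closedBall (0 : Space d) σ, |pval p y| ∧
      ‖pgrad p x‖ ≤ C * ∫ y in Metric.closedBall (0 : Space d) σ, |pval p y| := by
  let b := Module.finBasis ℝ (restrictTotalDegree (Fin d) ℝ k)
  have hbd : ∀ {G : Type} [NormedAddCommGroup G] (g : Space d → G), Continuous g → ∀ r : ℝ,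
      ∃ S : ℝ, 0 ≤ S ∧ ∀ x ∈ Metric.closedBall (0 : Space d) r, ‖g x‖ ≤ S := by
    intro G _ g hg r
    obtain ⟨S, hS⟩ := (isCompact_closedBall (0 : Space d) r).exists_bound_of_continuousOn
      hg.continuousOn
    exact ⟨max S 0, le_max_right _ _, fun x hx => (hS x hx).trans (le_max_left _ _)⟩
  choose g hg using fun i => exists_polynomial_representation k hσ (b.coord i)
  choose S hS0 hS using fun i => hbd (pval (g i)) (continuous_pval _) σ
  choose V hV0 hV using fun i => hbd (pval (b i : MvPolynomial (Fin d) ℝ)) (continuous_pval _) 1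
  choose W hW0 hW using fun i => hbd (pgrad (b i : MvPolynomial (Fin d) ℝ)) (continuous_pgrad _) 1
  refine ⟨∑ i, S i * (V i + W i),
    Finset.sum_nonneg fun i _ => mul_nonneg (hS0 i) (add_nonneg (hV0 i) (hW0 i)), ?_⟩
  intro p hp x hx
  set I := ∫ y in Metric.closedBall (0 : Space d) σ, |pval p y| with hI
  have hI0 : 0 ≤ I := integral_nonneg fun _ => abs_nonneg _
  have hcoord : ∀ i, |b.coord i ⟨p, hp⟩| ≤ S i * I := fun i => by
    rw [hg i, hI, ← integral_const_mul]
    refine (abs_integral_le_integral_abs).trans ?_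
    refine setIntegral_mono_on
      (integrableOn_closedBall ((continuous_pval _).mul (continuous_pval _)).abs _ _)
      (integrableOn_closedBall (continuous_const.mul (continuous_pval _).abs) _ _)
      measurableSet_closedBall fun y hy => ?_
    rw [abs_mul]
    exact mul_le_mul_of_nonneg_right (hS i y hy) (abs_nonneg _)
  have hsum : p = ∑ i, b.coord i ⟨p, hp⟩ • (b i : MvPolynomial (Fin d) ℝ) := by
    have h1 := congrArg (Submodule.subtype _) (b.sum_repr ⟨p, hp⟩)
    rw [map_sum] at h1
    exact h1.symm
  constructor
  · conv_lhs => rw [hsum]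
    rw [pval_sum, Finset.sum_mul]
    refine (Finset.abs_sum_le_sum_abs _ _).trans (Finset.sum_le_sum fun i _ => ?_)
    rw [pval_smul, abs_mul]
    calc _ ≤ (S i * I) * V i := mul_le_mul (hcoord i) (hV i x hx) (abs_nonneg _)
          (mul_nonneg (hS0 i) hI0)
      _ ≤ S i * (V i + W i) * I := by
          nlinarith [mul_nonneg (mul_nonneg (hS0 i) hI0) (hW0 i)]
  · conv_lhs => rw [hsum]
    rw [pgrad_sum, Finset.sum_mul]
    refine (norm_sum_le _ _).trans (Finset.sum_le_sum fun i _ => ?_)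
    rw [pgrad_smul, norm_smul, Real.norm_eq_abs]
    calc _ ≤ (S i * I) * W i := mul_le_mul (hcoord i) (hW i x hx) (norm_nonneg _)
          (mul_nonneg (hS0 i) hI0)
      _ ≤ S i * (V i + W i) * I := by
          nlinarith [mul_nonneg (mul_nonneg (hS0 i) hI0) (hV0 i)]

theorem setIntegral_closedBall_affine (g : Space d → ℝ) (x₀ : Space d) {h : ℝ} (hh : 0 < h)
    (σ : ℝ) :
    ∫ y in Metric.closedBall (0 : Space d) σ, g (x₀ + h • y) =
      (h ^ d)⁻¹ * ∫ y in Metric.closedBall x₀ (σ * h), g y := by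
  have h1 := Measure.setIntegral_comp_smul_of_pos (volume : Measure (Space d))
    (fun y => g (x₀ + y)) (Metric.closedBall (0 : Space d) σ) hh
  rw [h1, finrank_euclideanSpace_fin, smul_eq_mul, smul_closedBall' hh.ne', smul_zero,
    Real.norm_of_nonneg hh.le, mul_comm h σ]
  congr 1
  have h2 := (measurePreserving_add_left (volume : Measure (Space d)) x₀).setIntegral_preimage_emb
    (measurableEmbedding_addLeft x₀) g (Metric.closedBall x₀ (σ * h))
  rw [← h2]
  congr 2
  ext y
  simp

/-- The inverse estimates on a set of size `h` that contains a ball of radius `σ h`: a polynomial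
and its gradient are controlled by the `L^1` norm. -/
theorem inverse_estimate (d k : ℕ) {σ : ℝ} (hσ : 0 < σ) :
    ∃ C : ℝ, 0 ≤ C ∧ ∀ p ∈ restrictTotalDegree (Fin d) ℝ k, ∀ (x₀ : Space d) (h : ℝ), 0 < h →
      ∀ y ∈ Metric.closedBall x₀ h,
        h ^ d * |pval p y| ≤ C * ∫ z in Metric.closedBall x₀ (σ * h), |pval p z| ∧
        h ^ d * (h * ‖pgrad p y‖) ≤ C * ∫ z in Metric.closedBall x₀ (σ * h), |pval p z| := by
  obtain ⟨C, hC, H⟩ := inverse_estimate_unit d k hσ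
  refine ⟨C, hC, fun p hp x₀ h hh y hy => ?_⟩
  have hmem : affineSubst x₀ h p ∈ restrictTotalDegree (Fin d) ℝ k := by
    rw [mem_restrictTotalDegree] at hp ⊢
    exact (totalDegree_affineSubst_le _ _ _).trans hp
  have hz : h⁻¹ • (y - x₀) ∈ Metric.closedBall (0 : Space d) 1 := by
    rw [mem_closedBall_zero_iff, norm_smul, norm_inv, Real.norm_of_nonneg hh.le,
      inv_mul_le_iff₀ hh, mul_one, ← dist_eq_norm]
    exact hy
  have hxy : x₀ + h • h⁻¹ • (y - x₀) = y := by
    rw [smul_smul, mul_inv_cancel₀ hh.ne', one_smul, add_sub_cancel]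
  have h1 := H _ hmem _ hz
  simp only [pval_affineSubst, pgrad_affineSubst, hxy, norm_smul, Real.norm_of_nonneg hh.le,
    setIntegral_closedBall_affine (fun y => |pval p y|) x₀ hh σ] at h1
  have hd : 0 < h ^ d := pow_pos hh d
  have key : ∀ a I : ℝ, a ≤ C * ((h ^ d)⁻¹ * I) → h ^ d * a ≤ C * I := fun a I ha => by
    calc h ^ d * a ≤ h ^ d * (C * ((h ^ d)⁻¹ * I)) := mul_le_mul_of_nonneg_left ha hd.le
      _ = C * I := by field_simp
  exact ⟨key _ _ h1.1, key _ _ h1.2⟩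

end inverse_estimates

/-! ### Perturbation of constant states and the discrete divergence. -/

open MvPolynomial in
theorem C_mem_restrictTotalDegree (k : ℕ) (c : ℝ) :
    (C c : MvPolynomial (Fin d) ℝ) ∈ restrictTotalDegree (Fin d) ℝ k := by
  rw [mem_restrictTotalDegree, totalDegree_C]
  exact Nat.zero_le _

open MvPolynomial in
theorem restrictTotalDegree_mono {k l : ℕ} (h : k ≤ l) :
    restrictTotalDegree (Fin d) ℝ k ≤ restrictTotalDegree (Fin d) ℝ l := fun p hp => by
  rw [mem_restrictTotalDegree] at hp ⊢
  exact hp.trans h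

namespace Mesh

variable {M : Mesh d} {k : ℕ} {f : ℝ → Space d} {C : ℝ}
  {F : M.Cell → M.Cell → M.PiecewisePoly → Space d → ℝ}

theorem mem_dgSpace {u : M.PiecewisePoly} :
    u ∈ M.dgSpace k ↔ ∀ i, u i ∈ MvPolynomial.restrictTotalDegree (Fin d) ℝ k := by
  simp [dgSpace]

theorem dgSpace_mono {l : ℕ} (h : k ≤ l) : M.dgSpace k ≤ M.dgSpace l := fun _ hu =>
  mem_dgSpace.2 fun i => restrictTotalDegree_mono h (mem_dgSpace.1 hu i)

/-- Compare with the globally constant state `c`, whose numerical flux is exact by consistency.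
`|C|` appears because no sign of `C` is given. -/
theorem IsNumericalFlux.abs_sub_le (hF : M.IsNumericalFlux k f C F) {u : M.PiecewisePoly}
    (hu : u ∈ M.dgSpace k) {i j : M.Cell} (hij : M.Adj i j) {c δ : ℝ}
    (hi : ∀ y ∈ M.carrier i, |pval (u i) y - c| ≤ δ)
    (hj : ∀ y ∈ M.carrier j, |pval (u j) y - c| ≤ δ) {x : Space d} (hx : x ∈ M.face i j) :
    |F i j u x - inner ℝ (M.normal i j) (f c)| ≤ |C| * δ := by
  have hc : (fun _ => MvPolynomial.C c : M.PiecewisePoly) ∈ M.dgSpace k :=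
    mem_dgSpace.2 fun _ => C_mem_restrictTotalDegree k c
  have h1 := hF.consistent _ hc i j hij (fun x _ => rfl) x hx
  rw [pval_C, real_inner_comm] at h1
  rw [← h1]
  refine (hF.lipschitz u hu _ hc i j hij δ (by simpa only [pval_C] using hi)
    (by simpa only [pval_C] using hj) x hx).trans ?_
  exact mul_le_mul_of_nonneg_right (le_abs_self C) ((abs_nonneg _).trans (hi x hx.1))

theorem exists_pval_bound (u : M.PiecewisePoly) (i : M.Cell) :
    ∃ δ, ∀ y ∈ M.carrier i, |pval (u i) y| ≤ δ :=
  (M.isCompact_carrier i).exists_bound_of_continuousOn (continuous_pval _).continuousOn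

theorem IsNumericalFlux.integrableOn (hF : M.IsNumericalFlux k f C F) {u : M.PiecewisePoly}
    (hu : u ∈ M.dgSpace k) {i j : M.Cell} (hij : M.Adj i j) :
    IntegrableOn (F i j u) (M.face i j) (surface d) := by
  obtain ⟨δ₁, h1⟩ := exists_pval_bound u i
  obtain ⟨δ₂, h2⟩ := exists_pval_bound u j
  refine IntegrableOn.of_bound (M.surface_face_lt_top hij.1) (hF.measurable u hu i j hij)
    (|inner ℝ (M.normal i j) (f 0)| + |C| * max δ₁ δ₂) ?_
  filter_upwards [ae_restrict_mem (M.measurableSet_face i j)] with x hx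
  have h3 := hF.abs_sub_le hu hij (c := 0) (δ := max δ₁ δ₂)
    (fun y hy => by rw [sub_zero]; exact (h1 y hy).trans (le_max_left _ _))
    (fun y hy => by rw [sub_zero]; exact (h2 y hy).trans (le_max_right _ _)) hx
  have h4 := abs_sub_abs_le_abs_sub (F i j u x) (inner ℝ (M.normal i j) (f 0))
  rw [Real.norm_eq_abs]
  linarith

theorem IsNumericalFlux.integrableOn_mul (hF : M.IsNumericalFlux k f C F) {u : M.PiecewisePoly}
    (hu : u ∈ M.dgSpace k) {i j : M.Cell} (hij : M.Adj i j) {g : Space d → ℝ}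
    (hg : Continuous g) :
    IntegrableOn (fun x => F i j u x * g x) (M.face i j) (surface d) :=
  (hF.integrableOn hu hij).mul_continuousOn hg.continuousOn (M.isCompact_face i j)

theorem integrableOn_face {i j : M.Cell} (hij : i ≠ j) {g : Space d → ℝ} (hg : Continuous g) :
    IntegrableOn g (M.face i j) (surface d) := by
  obtain ⟨δ, hδ⟩ := (M.isCompact_face i j).exists_bound_of_continuousOn hg.continuousOn
  refine Measure.integrableOn_of_bounded (M := δ) (M.surface_face_lt_top hij).ne
    hg.aestronglyMeasurable ?_
  filter_upwards [ae_restrict_mem (M.measurableSet_face i j)] with x hx using hδ x hx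

theorem integrableOn_carrier {i : M.Cell} {g : Space d → ℝ} (hg : Continuous g) :
    IntegrableOn g (M.carrier i) :=
  hg.continuousOn.integrableOn_compact (M.isCompact_carrier i)

/-- The error of replacing the numerical flux by the exact flux of a constant state, weighted by a
function on the edges of a cell. -/
theorem IsNumericalFlux.abs_sum_integral_sub_le {σ : ℝ} (hM : M.IsQuasiUniform σ) (hσ : 0 < σ)
    (hh : 0 < M.size) (hF : M.IsNumericalFlux k f C F) {u : M.PiecewisePoly}
    (hu : u ∈ M.dgSpace k) {i : M.Cell} {c δ P : ℝ} (hP : 0 ≤ P)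
    (hi : ∀ y ∈ M.carrier i, |pval (u i) y - c| ≤ δ)
    (hj : ∀ j, M.Adj i j → ∀ y ∈ M.carrier j, |pval (u j) y - c| ≤ δ) {g : Space d → ℝ}
    (hg : Continuous g) (hgP : ∀ x ∈ M.carrier i, |g x| ≤ P) :
    |∑ j ∈ M.neighbors i, (∫ x in M.face i j, F i j u x * g x ∂(surface d)) -
      ∑ j ∈ M.neighbors i, inner ℝ (M.normal i j) (f c) * ∫ x in M.face i j, g x ∂(surface d)| *
        M.size ≤ (2 / σ) ^ d * (2 ^ d * unitBallVolume d) * |C| * (M.size ^ d * (δ * P)) := by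
  have hδ : 0 ≤ δ := by
    obtain ⟨y, hy⟩ := M.nonempty_interior i
    exact (abs_nonneg _).trans (hi y (interior_subset hy))
  have h1 : ∀ j ∈ M.neighbors i, |(∫ x in M.face i j, F i j u x * g x ∂(surface d)) -
      inner ℝ (M.normal i j) (f c) * ∫ x in M.face i j, g x ∂(surface d)| * M.size ≤
        (|C| * δ * P) * ((2 * M.size) ^ d * unitBallVolume d) := by
    intro j hj'
    have hij := M.mem_neighbors.1 hj'
    rw [← integral_const_mul, ← integral_sub (hF.integrableOn_mul hu hij hg)
      ((integrableOn_face hij.1 hg).const_mul _)]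
    have h2 : |∫ x in M.face i j, (F i j u x * g x - inner ℝ (M.normal i j) (f c) * g x)
        ∂(surface d)| ≤ (|C| * δ * P) * (surface d).real (M.face i j) := by
      rw [← Real.norm_eq_abs]
      refine norm_setIntegral_le_of_norm_le_const (M.surface_face_lt_top hij.1) fun x hx => ?_
      rw [← sub_mul, norm_mul]
      exact mul_le_mul (hF.abs_sub_le hu hij hi (hj j hij) hx) (hgP x hx.1) (norm_nonneg _)
        (by positivity)
    calc _ ≤ (|C| * δ * P) * (surface d).real (M.face i j) * M.size :=
          mul_le_mul_of_nonneg_right h2 hh.le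
      _ = (|C| * δ * P) * ((surface d).real (M.face i j) * M.size) := mul_assoc _ _ _
      _ ≤ _ := mul_le_mul_of_nonneg_left (surface_real_face_le hh hij.1) (by positivity)
  rw [← Finset.sum_sub_distrib]
  calc _ ≤ (∑ j ∈ M.neighbors i, |(∫ x in M.face i j, F i j u x * g x ∂(surface d)) -
      inner ℝ (M.normal i j) (f c) * ∫ x in M.face i j, g x ∂(surface d)|) * M.size :=
        mul_le_mul_of_nonneg_right (Finset.abs_sum_le_sum_abs _ _) hh.le
    _ ≤ (M.neighbors i).card * ((|C| * δ * P) * ((2 * M.size) ^ d * unitBallVolume d)) := by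
        rw [Finset.sum_mul, ← nsmul_eq_mul]
        exact Finset.sum_le_card_nsmul _ _ _ h1
    _ ≤ (2 / σ) ^ d * ((|C| * δ * P) * ((2 * M.size) ^ d * unitBallVolume d)) :=
        mul_le_mul_of_nonneg_right (hM.card_neighbors_le hσ hh i)
          (mul_nonneg (by positivity) (mul_nonneg (by positivity) unitBallVolume_pos.le))
    _ = _ := by rw [mul_pow]; ring

theorem abs_integral_inner_sub_le {Lf : NNReal} (hf : LipschitzWith Lf f) (hh : 0 < M.size)
    (u : M.PiecewisePoly) {i : M.Cell} {c δ D : ℝ} (hD : 0 ≤ D)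
    (hi : ∀ y ∈ M.carrier i, |pval (u i) y - c| ≤ δ) {g : Space d → Space d}
    (hg : Continuous g) (hgD : ∀ x ∈ M.carrier i, ‖g x‖ ≤ D) :
    |(∫ x in M.carrier i, inner ℝ (f (pval (u i) x)) (g x)) -
      ∫ x in M.carrier i, inner ℝ (f c) (g x)| ≤
      Lf * unitBallVolume d * (M.size ^ d * (δ * D)) := by
  have hδ : 0 ≤ δ := by
    obtain ⟨y, hy⟩ := M.nonempty_interior i
    exact (abs_nonneg _).trans (hi y (interior_subset hy))
  have hc : Continuous fun x => f (pval (u i) x) := hf.continuous.comp (continuous_pval _)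
  rw [← integral_sub (integrableOn_carrier (hc.inner hg))
    (integrableOn_carrier (continuous_const.inner hg))]
  have h2 : |∫ x in M.carrier i, (inner ℝ (f (pval (u i) x)) (g x) - inner ℝ (f c) (g x))| ≤
      (Lf * δ * D) * volume.real (M.carrier i) := by
    rw [← Real.norm_eq_abs]
    refine norm_setIntegral_le_of_norm_le_const (M.isCompact_carrier i).measure_lt_top
      fun x hx => ?_
    rw [← inner_sub_left]
    refine (norm_inner_le_norm _ _).trans ?_
    refine mul_le_mul ?_ (hgD x hx) (norm_nonneg _) (by positivity)
    rw [← dist_eq_norm]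
    refine (hf.dist_le_mul _ _).trans (mul_le_mul_of_nonneg_left ?_ Lf.2)
    rw [Real.dist_eq]
    exact hi x hx
  calc _ ≤ _ := h2
    _ ≤ (Lf * δ * D) * (M.size ^ d * unitBallVolume d) :=
      mul_le_mul_of_nonneg_left (volume_real_carrier_le hh i) (by positivity)
    _ = _ := by ring

/-- Cauchy–Schwarz, read off from the nonnegative variance of `|p|` about its mean `I / V`. -/
theorem sq_integral_abs_le {p : MvPolynomial (Fin d) ℝ} (x₀ : Space d) {r : ℝ} (hr : 0 < r) :
    (∫ y in Metric.closedBall x₀ r, |pval p y|) ^ 2 ≤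
      r ^ d * unitBallVolume d * ∫ y in Metric.closedBall x₀ r, pval p y * pval p y := by
  set I := ∫ y in Metric.closedBall x₀ r, |pval p y| with hI
  have hV : volume.real (Metric.closedBall x₀ r) = r ^ d * unitBallVolume d :=
    volume_real_closedBall x₀ hr.le
  set V := r ^ d * unitBallVolume d with hVdef
  have hV0 : 0 < V := mul_pos (pow_pos hr d) unitBallVolume_pos
  have hp := continuous_pval p
  have h0 : 0 ≤ ∫ y in Metric.closedBall x₀ r, (|pval p y| - I / V) ^ 2 :=
    integral_nonneg fun _ => sq_nonneg _
  have h1 : ∀ y, (|pval p y| - I / V) ^ 2 =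
      (pval p y * pval p y - 2 * (I / V) * |pval p y|) + (I / V) ^ 2 := fun y => by
    rw [sub_sq, sq_abs]; ring
  simp only [h1] at h0
  have i1 : IntegrableOn (fun y => pval p y * pval p y) (Metric.closedBall x₀ r) :=
    integrableOn_closedBall (hp.mul hp) _ _
  have i2 : IntegrableOn (fun y => 2 * (I / V) * |pval p y|) (Metric.closedBall x₀ r) :=
    integrableOn_closedBall (continuous_const.mul hp.abs) _ _
  have i3 : IntegrableOn (fun y => pval p y * pval p y - 2 * (I / V) * |pval p y|)
    (Metric.closedBall x₀ r) := i1.sub i2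
  rw [integral_add i3 (integrableOn_closedBall continuous_const _ _), integral_sub i1 i2,
    integral_const_mul, ← hI,
    setIntegral_const, hV, smul_eq_mul] at h0
  have h2 : V * (I / V) ^ 2 = I ^ 2 / V := by field_simp
  have h3 : 2 * (I / V) * I = 2 * (I ^ 2 / V) := by field_simp
  rw [h2, h3] at h0
  have h4 : I ^ 2 / V ≤ ∫ y in Metric.closedBall x₀ r, pval p y * pval p y := by linarith
  rwa [div_le_iff₀ hV0, mul_comm] at h4

/-- The discrete divergence of a state that differs by at most `δ` from a constant near a cell is
bounded by a multiple of `δ / h`. -/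
theorem exists_dgDiv_bound (d k : ℕ) {σ : ℝ} (hσ : 0 < σ) (f : ℝ → Space d)
    (hf : ∃ Lf : NNReal, LipschitzWith Lf f) (C : ℝ) :
    ∃ Q : ℝ, 0 ≤ Q ∧ ∀ (M : Mesh d), M.IsQuasiUniform σ → 0 < M.size →
      ∀ F, M.IsNumericalFlux k f C F → ∀ ℓ ≤ k, ∀ u ∈ M.dgSpace k, ∀ w, M.IsDGDiv f F ℓ u w →
      ∀ (i : M.Cell) (c δ : ℝ), (∀ y ∈ M.carrier i, |pval (u i) y - c| ≤ δ) →
      (∀ j, M.Adj i j → ∀ y ∈ M.carrier j, |pval (u j) y - c| ≤ δ) →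
      ∀ y ∈ M.carrier i, M.size * |pval (w i) y| ≤ Q * δ := by
  obtain ⟨Lf, hf⟩ := hf
  obtain ⟨C₁, hC₁, hinv⟩ := inverse_estimate d k hσ
  have hω := unitBallVolume_pos (d := d)
  set K : ℝ := (2 / σ) ^ d * (2 ^ d * unitBallVolume d) * |C| * C₁ + Lf * unitBallVolume d * C₁
    with hK
  have hK0 : 0 ≤ K := by positivity
  refine ⟨C₁ * (σ ^ d * unitBallVolume d * K), by positivity, ?_⟩
  intro M hM hh F hF ℓ hℓ u hu w hw i c δ hi hj y hy
  have hδ : 0 ≤ δ := (abs_nonneg _).trans (hi y hy)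
  set h := M.size with hhdef
  obtain ⟨x₀, hx₀⟩ := hM i
  have hball : M.carrier i ⊆ Metric.closedBall x₀ h :=
    M.carrier_subset_closedBall (hx₀ (Metric.mem_closedBall_self (by positivity)))
  have hwk : w i ∈ MvPolynomial.restrictTotalDegree (Fin d) ℝ k :=
    restrictTotalDegree_mono hℓ (mem_dgSpace.1 hw.1 i)
  have hd : 0 < h ^ d := pow_pos hh d
  set I := ∫ z in Metric.closedBall x₀ (σ * h), |pval (w i) z| with hI
  have hI0 : 0 ≤ I := integral_nonneg fun _ => abs_nonneg _
  have hval : ∀ z ∈ M.carrier i, |pval (w i) z| ≤ C₁ * I / h ^ d := fun z hz => by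
    rw [le_div_iff₀ hd, mul_comm]
    exact (hinv _ hwk x₀ h hh z (hball hz)).1
  have hgrad : ∀ z ∈ M.carrier i, ‖pgrad (w i) z‖ ≤ C₁ * I / (h ^ d * h) := fun z hz => by
    rw [le_div_iff₀ (by positivity)]
    have := (hinv _ hwk x₀ h hh z (hball hz)).2
    linarith
  -- For the constant state the volume and boundary terms cancel exactly. Both may thus be
  -- subtracted, leaving only differences of order `δ`.
  have hdiv : ∫ x in M.carrier i, inner ℝ (f c) (pgrad (w i) x) =
      ∑ j ∈ M.neighbors i, inner ℝ (M.normal i j) (f c) *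
        ∫ x in M.face i j, pval (w i) x ∂(surface d) := by
    rw [← M.integral_fderiv_carrier i (contDiff_pval (w i)) (f c)]
    simp only [fderiv_pval, real_inner_comm]
  -- Testing with the discrete divergence itself turns the left side into its squared `L^2` norm.
  have hE := hw.2 i (w i) (mem_dgSpace.1 hw.1 i)
  have hA := abs_integral_inner_sub_le hf hh u (D := C₁ * I / (h ^ d * h)) (by positivity) hi
    (continuous_pgrad (w i)) hgrad
  have hB := hF.abs_sum_integral_sub_le hM hσ hh hu (P := C₁ * I / h ^ d) (by positivity) hi hj
    (continuous_pval (w i)) hval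
  rw [← hhdef] at hA hB
  have hsq : h * ∫ x in M.carrier i, pval (w i) x * pval (w i) x ≤ K * (δ * I) := by
    rw [hE]
    rw [hdiv] at hA
    set X := ∫ x in M.carrier i, inner ℝ (f (pval (u i) x)) (pgrad (w i) x)
    set Y := ∑ j ∈ M.neighbors i, inner ℝ (M.normal i j) (f c) *
        ∫ x in M.face i j, pval (w i) x ∂(surface d)
    set Z := ∑ j ∈ M.neighbors i, ∫ x in M.face i j, F i j u x * pval (w i) x ∂(surface d)
    have e1 : h ^ d * (δ * (C₁ * I / (h ^ d * h))) = C₁ * (δ * I) / h := by field_simp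
    have e2 : h ^ d * (δ * (C₁ * I / h ^ d)) = C₁ * (δ * I) := by field_simp
    rw [e1] at hA
    rw [e2] at hB
    have h1 : -(X - Y) ≤ Lf * unitBallVolume d * (C₁ * (δ * I) / h) := (neg_le_abs _).trans hA
    have h2 : (Z - Y) * h ≤ (2 / σ) ^ d * (2 ^ d * unitBallVolume d) * |C| * (C₁ * (δ * I)) :=
      (mul_le_mul_of_nonneg_right (le_abs_self _) hh.le).trans hB
    have h3 : h * -(X - Y) ≤ Lf * unitBallVolume d * (C₁ * (δ * I)) := by
      refine (mul_le_mul_of_nonneg_left h1 hh.le).trans_eq ?_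
      field_simp
    rw [hK]
    linarith
  have hBK : ∫ y in Metric.closedBall x₀ (σ * h), pval (w i) y * pval (w i) y ≤
      ∫ x in M.carrier i, pval (w i) x * pval (w i) x :=
    setIntegral_mono_set (integrableOn_carrier ((continuous_pval _).mul (continuous_pval _)))
      (Eventually.of_forall fun _ => mul_self_nonneg _) hx₀.eventuallyLE
  have hCS := sq_integral_abs_le (p := w i) x₀ (r := σ * h) (by positivity)
  rw [← hI] at hCS
  -- The estimate is quadratic in `I` on the left and linear on the right, so one factor `I`
  -- cancels; `I = 0` is treated apart.
  have hIδ : h * I ≤ (σ * h) ^ d * unitBallVolume d * K * δ := by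
    rcases hI0.eq_or_lt with h0 | h0
    · rw [← h0, mul_zero]; positivity
    · have h5 : h * I ^ 2 ≤ (σ * h) ^ d * unitBallVolume d * (K * (δ * I)) := by
        calc h * I ^ 2 ≤ h * ((σ * h) ^ d * unitBallVolume d *
              ∫ x in M.carrier i, pval (w i) x * pval (w i) x) :=
            mul_le_mul_of_nonneg_left (hCS.trans
              (mul_le_mul_of_nonneg_left hBK (by positivity))) hh.le
          _ = (σ * h) ^ d * unitBallVolume d *
              (h * ∫ x in M.carrier i, pval (w i) x * pval (w i) x) := by ring
          _ ≤ _ := mul_le_mul_of_nonneg_left hsq (by positivity)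
      refine le_of_mul_le_mul_right ?_ h0
      calc h * I * I = h * I ^ 2 := by ring
        _ ≤ _ := h5
        _ = _ := by ring
  have h6 := (hinv _ hwk x₀ h hh y (hball hy)).1
  refine le_of_mul_le_mul_left ?_ hd
  calc h ^ d * (h * |pval (w i) y|) = h * (h ^ d * |pval (w i) y|) := by ring
    _ ≤ h * (C₁ * I) := mul_le_mul_of_nonneg_left h6 hh.le
    _ = C₁ * (h * I) := by ring
    _ ≤ C₁ * ((σ * h) ^ d * unitBallVolume d * K * δ) := mul_le_mul_of_nonneg_left hIδ hC₁
    _ = _ := by rw [mul_pow]; ring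

/-- Cells adjacent to a cell inside a ball lie in a ball that is larger by the mesh size. -/
theorem Adj.carrier_subset {i j : M.Cell} (hij : M.Adj i j) {x₀ : Space d} {ρ : ℝ}
    (hi : M.carrier i ⊆ Metric.closedBall x₀ ρ) :
    M.carrier j ⊆ Metric.closedBall x₀ (ρ + M.size) := by
  obtain ⟨z, hzi, hzj⟩ := nonempty_of_measure_ne_zero hij.2.ne'
  intro y hy
  have h1 := hi hzi
  rw [Metric.mem_closedBall] at h1 ⊢
  linarith [dist_triangle y z x₀, M.dist_le_size hy hzj]

end Mesh

/-! ### Stability of the Runge–Kutta stages. -/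

theorem Tableau.D_le {s k : ℕ} (T : Tableau s k) (i j : Fin s) : T.D i j ≤ k := by
  rcases T.mem_D i j with h | h <;> omega

theorem Tableau.exists_row_bound {s k : ℕ} (T : Tableau s k) :
    ∃ a : ℝ, 0 ≤ a ∧ ∀ i, ∑ j ∈ Finset.Iio i, |T.A i j| ≤ a :=
  ⟨∑ i, ∑ j ∈ Finset.Iio i, |T.A i j|,
    Finset.sum_nonneg fun _ _ => Finset.sum_nonneg fun _ _ => abs_nonneg _, fun i =>
    Finset.single_le_sum (f := fun i => ∑ j ∈ Finset.Iio i, |T.A i j|)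
      (fun _ _ => Finset.sum_nonneg fun _ _ => abs_nonneg _) (Finset.mem_univ i)⟩

/-- The stages of a Runge-Kutta step stay as close to a constant as the initial state is, up to a
factor, on balls that shrink by the mesh size from stage to stage. -/
theorem exists_stage_bound {d s k : ℕ} {σ : ℝ} (hσ : 0 < σ) (T : Tableau s k) (f : ℝ → Space d)
    (hf : ∃ Lf : NNReal, LipschitzWith Lf f) (C lam : ℝ) :
    ∃ Q : ℝ, 1 ≤ Q ∧ ∀ (M : Mesh d), M.IsQuasiUniform σ → 0 < M.size →
      ∀ F, M.IsNumericalFlux k f C F → ∀ τ : ℝ, 0 < τ → τ / M.size ≤ lam → ∀ u ∈ M.dgSpace k,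
      ∀ (U : Fin s → M.PiecewisePoly) (G : Fin s → ℕ → M.PiecewisePoly),
      (∀ j, ∀ ℓ ∈ ({k - 1, k} : Set ℕ), M.IsDGDiv f F ℓ (U j) (G j ℓ)) →
      (∀ i, U i = u - τ • ∑ j ∈ Finset.Iio i, T.A i j • G j (T.D i j)) →
      (∀ i, U i ∈ M.dgSpace k) ∧
      ∀ (x₀ : Space d) (ρ c δ : ℝ), 0 ≤ δ →
      (∀ l, M.carrier l ⊆ Metric.closedBall x₀ ρ → ∀ y ∈ M.carrier l, |pval (u l) y - c| ≤ δ) →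
      ∀ i : Fin s, ∀ l, M.carrier l ⊆ Metric.closedBall x₀ (ρ - i * M.size) →
        ∀ y ∈ M.carrier l, |pval (U i l) y - c| ≤ Q ^ (i : ℕ) * δ := by
  obtain ⟨Q₀, hQ₀, H⟩ := Mesh.exists_dgDiv_bound d k hσ f hf C
  obtain ⟨a, ha0, ha⟩ := T.exists_row_bound
  -- Amplification by one stage: 1 from the initial state, the rest from `τ/h ≤ |lam|`, the row sum
  -- `a` of the tableau and the bound `Q₀ δ / h` on the discrete divergence.
  refine ⟨1 + |lam| * a * Q₀, by simp only [le_add_iff_nonneg_right]; positivity, ?_⟩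
  intro M hM hh F hF τ hτ hlam u hu U G hG hU
  set Q := 1 + |lam| * a * Q₀ with hQ
  have hQ1 : 1 ≤ Q := by simp only [hQ, le_add_iff_nonneg_right]; positivity
  have hD : ∀ i j, T.D i j ∈ ({k - 1, k} : Set ℕ) := fun i j => T.mem_D i j
  have hUk : ∀ i, U i ∈ M.dgSpace k := fun i => by
    rw [hU i]
    refine Submodule.sub_mem _ hu (Submodule.smul_mem _ _ (Submodule.sum_mem _ fun j _ =>
      Submodule.smul_mem _ _ ?_))
    exact Mesh.dgSpace_mono (T.D_le i j) (hG j _ (hD i j)).1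
  refine ⟨hUk, fun x₀ ρ c δ hδ hu0 i => ?_⟩
  obtain ⟨n, hn⟩ : ∃ n, (i : ℕ) = n := ⟨_, rfl⟩
  rw [hn]
  induction n using Nat.strong_induction_on generalizing i with
  | _ n ih =>
    intro l hl y hy
    have hn0 : (0 : ℝ) ≤ n * M.size := by positivity
    have h0 : |pval (u l) y - c| ≤ δ :=
      hu0 l (hl.trans (Metric.closedBall_subset_closedBall (by linarith))) y hy
    have hG' : ∀ j ∈ Finset.Iio i, |T.A i j * pval (G j (T.D i j) l) y| ≤
        |T.A i j| * (Q₀ * (Q ^ (n - 1) * δ) / M.size) := by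
      intro j hj
      have hji : (j : ℕ) < n := by
        rw [← hn]; exact Fin.lt_def.1 (Finset.mem_Iio.1 hj)
      -- An earlier stage has lost at least one `h` less, which leaves room for the neighbors that
      -- enter the divergence.
      have hle : ∀ m : M.Cell, M.carrier m ⊆ Metric.closedBall x₀ (ρ - n * M.size + M.size) →
          ∀ z ∈ M.carrier m, |pval (U j m) z - c| ≤ Q ^ (n - 1) * δ := fun m hm z hz => by
        have hjn : ((j : ℕ) : ℝ) + 1 ≤ n := by exact_mod_cast hji
        refine (ih j hji j rfl m (hm.trans (Metric.closedBall_subset_closedBall ?_)) z hz).trans ?_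
        · nlinarith
        · exact mul_le_mul_of_nonneg_right (pow_le_pow_right₀ hQ1 (by omega)) hδ
      have hb := H M hM hh F hF (T.D i j) (T.D_le i j) (U j) (hUk j) _ (hG j _ (hD i j)) l c
        (Q ^ (n - 1) * δ)
        (hle l (hl.trans (Metric.closedBall_subset_closedBall (by linarith))))
        (fun m hm => hle m (hm.carrier_subset hl)) y hy
      rw [abs_mul]
      refine mul_le_mul_of_nonneg_left ?_ (abs_nonneg _)
      rw [le_div_iff₀ hh, mul_comm]
      exact hb
    have hval : pval (U i l) y - c =
        (pval (u l) y - c) - τ * ∑ j ∈ Finset.Iio i, T.A i j * pval (G j (T.D i j) l) y := by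
      rw [hU i]
      simp only [Pi.sub_apply, Pi.smul_apply, Finset.sum_apply, pval_sub, pval_smul, pval_sum]
      ring
    have hsum : |∑ j ∈ Finset.Iio i, T.A i j * pval (G j (T.D i j) l) y| ≤
        a * (Q₀ * (Q ^ (n - 1) * δ) / M.size) := by
      refine (Finset.abs_sum_le_sum_abs _ _).trans ((Finset.sum_le_sum hG').trans ?_)
      rw [← Finset.sum_mul]
      exact mul_le_mul_of_nonneg_right (ha i) (by positivity)
    -- At `n = 0` the truncated exponent `n - 1` gives no gain, but the sum over earlier stages is
    -- empty.
    rcases Nat.eq_zero_or_pos n with hn0 | hnpos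
    · have hi0 : Finset.Iio i = ∅ := by
        ext j
        simp only [Finset.mem_Iio, Finset.notMem_empty, iff_false, not_lt]
        exact Fin.le_def.2 (by omega)
      rw [hval, hi0, hn0]
      simpa using h0
    · obtain ⟨p, rfl⟩ : ∃ p, n = p + 1 := ⟨n - 1, by omega⟩
      simp only [Nat.add_sub_cancel] at hsum
      have hQp : 1 ≤ Q ^ p := one_le_pow₀ hQ1
      have hτh : τ * (a * (Q₀ * (Q ^ p * δ) / M.size)) ≤ |lam| * (a * (Q₀ * (Q ^ p * δ))) := by
        calc τ * (a * (Q₀ * (Q ^ p * δ) / M.size)) =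
            τ / M.size * (a * (Q₀ * (Q ^ p * δ))) := by ring
          _ ≤ _ := mul_le_mul_of_nonneg_right (hlam.trans (le_abs_self _)) (by positivity)
      rw [hval]
      refine (abs_sub _ _).trans ?_
      rw [abs_mul, abs_of_pos hτ]
      calc _ ≤ δ + τ * (a * (Q₀ * (Q ^ p * δ) / M.size)) :=
            add_le_add h0 (mul_le_mul_of_nonneg_left hsum hτ.le)
        _ ≤ Q ^ p * δ + |lam| * (a * (Q₀ * (Q ^ p * δ))) :=
            add_le_add (le_mul_of_one_le_left hδ hQp) hτh
        _ = Q ^ (p + 1) * δ := by rw [pow_succ]; simp only [hQ]; ring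

/-! ### Piecewise polynomials as functions. -/

namespace Mesh

variable {M : Mesh d} {k : ℕ} {f : ℝ → Space d} {C : ℝ}
  {F : M.Cell → M.Cell → M.PiecewisePoly → Space d → ℝ}

/-- The cell used to evaluate piecewise functions at a point. -/
noncomputable def cellOf (M : Mesh d) (x : Space d) : M.Cell := (M.cover x).choose

theorem mem_carrier_cellOf (M : Mesh d) (x : Space d) : x ∈ M.carrier (M.cellOf x) :=
  (M.cover x).choose_spec

theorem toFun_eq (u : M.PiecewisePoly) (x : Space d) : M.toFun u x = pval (u (M.cellOf x)) x := rfl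

theorem ae_cellOf_eq (M : Mesh d) : ∀ᵐ x : Space d, ∀ i, x ∈ M.carrier i → M.cellOf x = i := by
  filter_upwards [M.ae_mem_unique] with x hx i hi
  exact hx _ _ (M.mem_carrier_cellOf x) hi

theorem toFun_ae_eq_carrier (u : M.PiecewisePoly) (i : M.Cell) :
    M.toFun u =ᵐ[volume.restrict (M.carrier i)] pval (u i) := by
  filter_upwards [ae_restrict_of_ae M.ae_cellOf_eq,
    ae_restrict_mem (M.measurableSet_carrier i)] with x hx hi
  rw [toFun_eq, hx i hi]

theorem finite_cells_inter (M : Mesh d) {S : Set (Space d)} (hS : IsCompact S) :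
    {i | (M.carrier i ∩ S).Nonempty}.Finite :=
  M.locallyFinite.finite_nonempty_inter_compact hS

theorem integrableOn_toFun (u : M.PiecewisePoly) {S : Set (Space d)} (hS : IsCompact S) :
    IntegrableOn (M.toFun u) S := by
  have h1 : IntegrableOn (M.toFun u) (⋃ i ∈ {i | (M.carrier i ∩ S).Nonempty}, M.carrier i) := by
    refine (integrableOn_finite_biUnion (M.finite_cells_inter hS)).2 fun i _ => ?_
    exact (integrableOn_carrier (continuous_pval (u i))).congr (toFun_ae_eq_carrier u i).symm
  refine h1.mono_set fun x hx => ?_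
  exact Set.mem_biUnion (show M.cellOf x ∈ {i | (M.carrier i ∩ S).Nonempty} from
    ⟨x, M.mem_carrier_cellOf x, hx⟩) (M.mem_carrier_cellOf x)

/-- The sup norm of a piecewise polynomial over the cells in a ball is controlled by the mean over
that ball. -/
theorem exists_sup_bound (d k : ℕ) {σ : ℝ} (hσ : 0 < σ) :
    ∃ C₁ : ℝ, 0 ≤ C₁ ∧ ∀ (M : Mesh d), M.IsQuasiUniform σ → 0 < M.size → ∀ u ∈ M.dgSpace k,
      ∀ (x₀ : Space d) (ρ c : ℝ) (l : M.Cell), M.carrier l ⊆ Metric.closedBall x₀ ρ →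
      ∀ y ∈ M.carrier l, M.size ^ d * |pval (u l) y - c| ≤
        C₁ * ∫ z in Metric.closedBall x₀ ρ, |M.toFun u z - c| := by
  obtain ⟨C₁, hC₁, H⟩ := inverse_estimate d k hσ
  refine ⟨C₁, hC₁, fun M hM hh u hu x₀ ρ c l hl y hy => ?_⟩
  obtain ⟨x₁, hx₁⟩ := hM l
  have hball : M.carrier l ⊆ Metric.closedBall x₁ M.size :=
    M.carrier_subset_closedBall (hx₁ (Metric.mem_closedBall_self (by positivity)))
  -- Subtracting a constant stays in the polynomial space, so the inverse estimate controls the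
  -- oscillation directly.
  have h1 := (H (u l - MvPolynomial.C c) (Submodule.sub_mem _ (mem_dgSpace.1 hu l)
    (C_mem_restrictTotalDegree k c)) x₁ M.size hh y (hball hy)).1
  simp only [pval_sub, pval_C] at h1
  refine h1.trans (mul_le_mul_of_nonneg_left ?_ hC₁)
  have hint : IntegrableOn (fun z => |M.toFun u z - c|) (Metric.closedBall x₀ ρ) :=
    ((integrableOn_toFun u (isCompact_closedBall x₀ ρ)).sub
      (integrableOn_closedBall continuous_const x₀ ρ)).abs
  calc ∫ z in Metric.closedBall x₁ (σ * M.size), |pval (u l) z - c|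
      ≤ ∫ z in M.carrier l, |pval (u l) z - c| :=
        setIntegral_mono_set
          (integrableOn_carrier ((continuous_pval (u l)).sub continuous_const).abs)
          (Eventually.of_forall fun _ => abs_nonneg _) hx₁.eventuallyLE
    _ = ∫ z in M.carrier l, |M.toFun u z - c| := by
        refine integral_congr_ae ?_
        filter_upwards [toFun_ae_eq_carrier u l] with z hz
        rw [hz]
    _ ≤ ∫ z in Metric.closedBall x₀ ρ, |M.toFun u z - c| :=
        setIntegral_mono_set hint (Eventually.of_forall fun _ => abs_nonneg _) hl.eventuallyLE

end Mesh

/-! ### Consistency and conservation. -/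

/-- The flux residual of a Runge-Kutta step on one cell. -/
noncomputable def fluxResidual {s k : ℕ} (T : Tableau s k) (M : Mesh d)
    (F : M.Cell → M.Cell → M.PiecewisePoly → Space d → ℝ) (U : Fin s → M.PiecewisePoly)
    (g : Space d → ℝ) (i : M.Cell) (x₀ : Space d) : ℝ :=
  ∑ q, T.b q * ∑ j ∈ M.neighbors i,
    ∫ y in M.face i j, F i j (U q) y * (g x₀ - g y) ∂(Mesh.surface d)

/-- Consistency of the scheme on one cell: the flux residual approximates `-∫ ∇g · f(u)` up to the
deviation of `u` from an arbitrary constant in a ball whose radius is a multiple of `h`. -/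
theorem exists_fluxResidual_bound {d s k : ℕ} {σ : ℝ} (hσ : 0 < σ) (T : Tableau s k)
    (f : ℝ → Space d) (hf : ∃ Lf : NNReal, LipschitzWith Lf f) (C lam : ℝ) :
    ∃ Q : ℝ, 0 ≤ Q ∧ ∀ (M : Mesh d), M.IsQuasiUniform σ → 0 < M.size →
      ∀ F, M.IsNumericalFlux k f C F → ∀ τ : ℝ, 0 < τ → τ / M.size ≤ lam → ∀ u ∈ M.dgSpace k,
      ∀ (U : Fin s → M.PiecewisePoly) (G : Fin s → ℕ → M.PiecewisePoly),
      (∀ j, ∀ ℓ ∈ ({k - 1, k} : Set ℕ), M.IsDGDiv f F ℓ (U j) (G j ℓ)) →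
      (∀ i, U i = u - τ • ∑ j ∈ Finset.Iio i, T.A i j • G j (T.D i j)) →
      ∀ (g : Space d → ℝ) (D : ℝ), ContDiff ℝ 1 g → (∀ x, ‖fderiv ℝ g x‖ ≤ D) →
      ∀ (i : M.Cell), ∀ x₀ ∈ M.carrier i, ∀ c : ℝ,
      |fluxResidual T M F U g i x₀ + ∫ y in M.carrier i, fderiv ℝ g y (f (pval (u i) y))| ≤
        Q * D * ∫ y in Metric.closedBall x₀ ((s + 2) * M.size), |M.toFun u y - c| := by
  obtain ⟨Q₁, hQ₁, hstage⟩ := exists_stage_bound hσ T f hf C lam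
  obtain ⟨C₁, hC₁, hsup⟩ := Mesh.exists_sup_bound d k hσ
  obtain ⟨Lf, hf⟩ := hf
  have hω := unitBallVolume_pos (d := d)
  set K₁ : ℝ := (2 / σ) ^ d * (2 ^ d * unitBallVolume d) * |C| with hK₁
  have hK₁0 : 0 ≤ K₁ := by positivity
  set b₁ : ℝ := ∑ q, |T.b q| with hb₁
  have hb₁0 : 0 ≤ b₁ := Finset.sum_nonneg fun _ _ => abs_nonneg _
  refine ⟨(b₁ * (K₁ * Q₁ ^ s) + Lf * unitBallVolume d) * C₁, by positivity, ?_⟩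
  intro M hM hh F hF τ hτ hlam u hu U G hG hU g D hg hD i x₀ hx₀ c
  obtain ⟨hUk, hst⟩ := hstage M hM hh F hF τ hτ hlam u hu U G hG hU
  set h := M.size with hhdef
  have hd : 0 < h ^ d := pow_pos hh d
  have hD0 : 0 ≤ D := (norm_nonneg _).trans (hD 0)
  set I := ∫ y in Metric.closedBall x₀ ((s + 2) * h), |M.toFun u y - c| with hI
  have hI0 : 0 ≤ I := integral_nonneg fun _ => abs_nonneg _
  set δ := C₁ * I / h ^ d with hδdef
  have hδ0 : 0 ≤ δ := by positivity
  have hδ : h ^ d * δ = C₁ * I := by rw [hδdef]; field_simp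
  have hu0 : ∀ l, M.carrier l ⊆ Metric.closedBall x₀ ((s + 2) * h) → ∀ y ∈ M.carrier l,
      |pval (u l) y - c| ≤ δ := fun l hl y hy => by
    rw [hδdef, le_div_iff₀ hd, mul_comm]
    exact hsup M hM hh u hu x₀ _ c l hl y hy
  have hsub : M.carrier i ⊆ Metric.closedBall x₀ h := M.carrier_subset_closedBall hx₀
  -- Of the radius `(s + 2) h` the stages consume less than `s h`; the remaining `2 h` hold the cell
  -- and its neighbors.
  have hqs : ∀ q : Fin s, 2 * h ≤ (s + 2) * h - (q : ℕ) * h := fun q => by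
    have h1 : ((q : ℕ) : ℝ) ≤ s := by exact_mod_cast q.2.le
    nlinarith
  have hUb : ∀ q : Fin s, ∀ l, M.carrier l ⊆ Metric.closedBall x₀ (2 * h) → ∀ y ∈ M.carrier l,
      |pval (U q l) y - c| ≤ Q₁ ^ s * δ := fun q l hl y hy =>
    (hst x₀ _ c δ hδ0 hu0 q l (hl.trans (Metric.closedBall_subset_closedBall (hqs q))) y hy).trans
      (mul_le_mul_of_nonneg_right (pow_le_pow_right₀ hQ₁ q.2.le) hδ0)
  have hsub2 : M.carrier i ⊆ Metric.closedBall x₀ (2 * h) :=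
    hsub.trans (Metric.closedBall_subset_closedBall (by linarith))
  have hgc := hg.continuous
  have hgd := hg.differentiable (by norm_num)
  -- This factor `h` compensates the face area `h^(d-1)`, so that the error per cell is of the order
  -- of a volume integral.
  have hlip : ∀ y ∈ M.carrier i, |g x₀ - g y| ≤ D * h := fun y hy => by
    have h1 := Convex.norm_image_sub_le_of_norm_fderiv_le (𝕜 := ℝ) (f := g) (s := Set.univ)
      (fun x _ => hgd x) (fun x _ => hD x) convex_univ (Set.mem_univ y) (Set.mem_univ x₀)
    rw [Real.norm_eq_abs] at h1
    refine h1.trans (mul_le_mul_of_nonneg_left ?_ hD0)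
    rw [← dist_eq_norm]
    exact M.dist_le_size hx₀ hy
  set Y := ∫ y in M.carrier i, fderiv ℝ g y (f c) with hY
  have hYdiv : ∑ j ∈ M.neighbors i, inner ℝ (M.normal i j) (f c) *
      ∫ y in M.face i j, (g x₀ - g y) ∂(Mesh.surface d) = -Y := by
    rw [← M.integral_fderiv_carrier i (contDiff_const.sub hg) (f c), hY, ← integral_neg]
    refine integral_congr_ae (Eventually.of_forall fun y => ?_)
    simp only [fderiv_const_sub]
    rfl
  have hX : ∀ q, |(∑ j ∈ M.neighbors i,
      ∫ y in M.face i j, F i j (U q) y * (g x₀ - g y) ∂(Mesh.surface d)) + Y| ≤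
      K₁ * Q₁ ^ s * (C₁ * I) * D := fun q => by
    have h1 := hF.abs_sum_integral_sub_le hM hσ hh (hUk q) (P := D * h) (by positivity)
      (hUb q i hsub2)
      (fun j hij => hUb q j ((hij.carrier_subset hsub).trans
        (Metric.closedBall_subset_closedBall (by linarith))))
      (g := fun y => g x₀ - g y) (continuous_const.sub hgc) hlip
    rw [hYdiv, sub_neg_eq_add, ← hhdef] at h1
    refine le_of_mul_le_mul_right (h1.trans_eq ?_) hh
    rw [← hδ, hK₁]
    ring
  have hYu : |(∫ y in M.carrier i, fderiv ℝ g y (f (pval (u i) y))) - Y| ≤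
      Lf * unitBallVolume d * (C₁ * I) * D := by
    have h1 := Mesh.abs_integral_inner_sub_le hf hh u (i := i) (c := c) (δ := δ) hD0
      (hu0 i (hsub2.trans (Metric.closedBall_subset_closedBall (by
        have : (0 : ℝ) ≤ s := Nat.cast_nonneg s
        nlinarith))))
      (g := fun y => (InnerProductSpace.toDual ℝ (Space d)).symm (fderiv ℝ g y))
      ((LinearIsometryEquiv.continuous _).comp (hg.continuous_fderiv (by norm_num)))
      (fun y _ => by rw [LinearIsometryEquiv.norm_map]; exact hD y)
    have hflip : ∀ (L : Space d →L[ℝ] ℝ) v,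
        inner ℝ v ((InnerProductSpace.toDual ℝ (Space d)).symm L) = L v := fun L v => by
      rw [real_inner_comm, InnerProductSpace.toDual_symm_apply]
    simp only [hflip] at h1
    refine h1.trans_eq ?_
    rw [← hδ]
    ring
  -- Since the weights `b` sum to 1, the constant-state term `Y` can be distributed over the stages.
  have hsplit : fluxResidual T M F U g i x₀ +
      ∫ y in M.carrier i, fderiv ℝ g y (f (pval (u i) y)) =
      (∑ q, T.b q * ((∑ j ∈ M.neighbors i,
        ∫ y in M.face i j, F i j (U q) y * (g x₀ - g y) ∂(Mesh.surface d)) + Y)) +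
      ((∫ y in M.carrier i, fderiv ℝ g y (f (pval (u i) y))) - Y) := by
    simp only [mul_add, Finset.sum_add_distrib, ← Finset.sum_mul, T.sum_b, fluxResidual]
    ring
  rw [hsplit]
  refine (abs_add_le _ _).trans ?_
  have h1 : |∑ q, T.b q * ((∑ j ∈ M.neighbors i,
        ∫ y in M.face i j, F i j (U q) y * (g x₀ - g y) ∂(Mesh.surface d)) + Y)| ≤
      b₁ * (K₁ * Q₁ ^ s * (C₁ * I) * D) := by
    refine (Finset.abs_sum_le_sum_abs _ _).trans ?_
    rw [hb₁, Finset.sum_mul]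
    refine Finset.sum_le_sum fun q _ => ?_
    rw [abs_mul]
    exact mul_le_mul_of_nonneg_left (hX q) (abs_nonneg _)
  calc _ ≤ b₁ * (K₁ * Q₁ ^ s * (C₁ * I) * D) + Lf * unitBallVolume d * (C₁ * I) * D :=
        add_le_add h1 hYu
    _ = _ := by ring

namespace Mesh

variable {M : Mesh d} {k : ℕ} {f : ℝ → Space d} {C : ℝ}
  {F : M.Cell → M.Cell → M.PiecewisePoly → Space d → ℝ}

/-- By conservation, the numerical fluxes weighted by a continuous function cancel. -/
theorem IsNumericalFlux.sum_integral_eq_zero (hF : M.IsNumericalFlux k f C F)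
    {u : M.PiecewisePoly} (hu : u ∈ M.dgSpace k) (I : Finset M.Cell) {g : Space d → ℝ}
    (hg : ∀ j ∉ I, ∀ y ∈ M.carrier j, g y = 0) :
    ∑ i ∈ I, ∑ j ∈ M.neighbors i, ∫ y in M.face i j, F i j u y * g y ∂(surface d) = 0 := by
  classical
  -- Extending the face terms by zero to all pairs of cells makes conservation an antisymmetry, and
  -- an antisymmetric double sum vanishes.
  let a : M.Cell → M.Cell → ℝ := fun i j =>
    if M.Adj i j then ∫ y in M.face i j, F i j u y * g y ∂(surface d) else 0
  have hanti : ∀ i j, a i j = -a j i := fun i j => by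
    simp only [a, M.adj_comm (i := j)]
    split_ifs with h
    · rw [← integral_neg, M.face_comm j i]
      refine setIntegral_congr_fun (M.measurableSet_face i j) fun y hy => ?_
      simp only [hF.conservative u hu i j h y hy]
      ring
    · simp
  have h1 : ∀ i, ∑ j ∈ M.neighbors i, ∫ y in M.face i j, F i j u y * g y ∂(surface d) =
      ∑ j ∈ I, a i j := fun i => by
    have e1 : ∑ j ∈ M.neighbors i, ∫ y in M.face i j, F i j u y * g y ∂(surface d) =
        ∑ j ∈ M.neighbors i, a i j :=
      Finset.sum_congr rfl fun j hj => (if_pos (M.mem_neighbors.1 hj)).symm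
    rw [e1]
    have e2 : ∀ j ∉ I, a i j = 0 := fun j hj => by
      simp only [a]
      split_ifs
      · refine setIntegral_eq_zero_of_forall_eq_zero fun y hy => ?_
        rw [hg j hj y hy.2, mul_zero]
      · rfl
    have e3 : ∀ j ∉ M.neighbors i, a i j = 0 := fun j hj =>
      if_neg fun h => hj (M.mem_neighbors.2 h)
    exact (Finset.sum_subset (Finset.subset_union_left (s₂ := I)) fun j _ hj => e3 j hj).trans
      (Finset.sum_subset Finset.subset_union_right fun j _ hj => e2 j hj).symm
  simp only [h1]
  have h2 : ∑ i ∈ I, ∑ j ∈ I, a i j = -∑ i ∈ I, ∑ j ∈ I, a i j := by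
    conv_lhs => rw [Finset.sum_comm]
    rw [← Finset.sum_neg_distrib]
    refine Finset.sum_congr rfl fun i _ => ?_
    rw [← Finset.sum_neg_distrib]
    exact Finset.sum_congr rfl fun j _ => hanti j i
  linarith

end Mesh

/-! ### Cell averages and the discrete weak form. -/

theorem Tableau.e_mem {s k : ℕ} (T : Tableau s k) (i : Fin s) :
    T.e i ∈ ({k - 1, k} : Set ℕ) := T.mem_e i

/-- The evolution of the cell averages. -/
theorem integral_step_sub {s k : ℕ} (T : Tableau s k) {M : Mesh d} {f : ℝ → Space d}
    {F : M.Cell → M.Cell → M.PiecewisePoly → Space d → ℝ} {τ : ℝ} {u u' : M.PiecewisePoly}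
    {U : Fin s → M.PiecewisePoly} {G : Fin s → ℕ → M.PiecewisePoly}
    (hG : ∀ j, ∀ ℓ ∈ ({k - 1, k} : Set ℕ), M.IsDGDiv f F ℓ (U j) (G j ℓ))
    (hu' : u' = u - τ • ∑ i, T.b i • G i (T.e i)) (i : M.Cell) :
    (∫ x in M.carrier i, pval (u' i) x) - ∫ x in M.carrier i, pval (u i) x =
      -(τ * ∑ q, T.b q * ∑ j ∈ M.neighbors i,
        ∫ y in M.face i j, F i j (U q) y ∂(Mesh.surface d)) := by
  have h1 : ∀ q, ∫ x in M.carrier i, pval (G q (T.e q) i) x =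
      ∑ j ∈ M.neighbors i, ∫ y in M.face i j, F i j (U q) y ∂(Mesh.surface d) := fun q => by
    -- The constant 1 is admissible for every degree `ℓ`, and its volume term vanishes.
    have := (hG q _ (T.e_mem q)).2 i (MvPolynomial.C 1) (C_mem_restrictTotalDegree _ 1)
    simpa only [pval_C, pgrad_C, mul_one, inner_zero_right, integral_zero, neg_zero,
      zero_add] using this
  rw [← integral_sub (Mesh.integrableOn_carrier (continuous_pval _))
    (Mesh.integrableOn_carrier (continuous_pval _))]
  have h2 : ∀ x, pval (u' i) x - pval (u i) x =
      -(τ * ∑ q, T.b q * pval (G q (T.e q) i) x) := fun x => by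
    rw [hu']
    simp only [Pi.sub_apply, Pi.smul_apply, Finset.sum_apply, pval_sub, pval_smul, pval_sum]
    ring
  simp only [h2]
  rw [integral_neg, integral_const_mul, integral_finsetSum _ fun q _ =>
    (Mesh.integrableOn_carrier (continuous_pval _)).const_mul _]
  simp only [integral_const_mul, h1]

/-- Abel summation. The second sequence stands for the test function one time step earlier; keeping
it separate allows its value at time `-τ` without an index `-1`. -/
theorem sum_mul_sub_add_eq (a ψ ψ' : ℕ → ℝ) (h : ∀ n, ψ' (n + 1) = ψ n) (N : ℕ) :
    ∑ n ∈ Finset.range N, a n * (ψ n - ψ' n) + a 0 * ψ' 0 =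
      a N * ψ' N - ∑ n ∈ Finset.range N, ψ n * (a (n + 1) - a n) := by
  induction N with
  | zero => simp
  | succ N ih =>
    rw [Finset.sum_range_succ, Finset.sum_range_succ, h]
    linarith

theorem hasFDerivAt_slice {φ : Space d × ℝ → ℝ} (hφ : ContDiff ℝ 1 φ) (t : ℝ) (x : Space d) :
    HasFDerivAt (fun y => φ (y, t))
      ((fderiv ℝ φ (x, t)).comp (ContinuousLinearMap.inl ℝ (Space d) ℝ)) x :=
  ((hφ.differentiable (by norm_num)) (x, t)).hasFDerivAt.comp x (hasFDerivAt_prodMk_left x t)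

theorem norm_fderiv_slice_le {φ : Space d × ℝ → ℝ} (hφ : ContDiff ℝ 1 φ) {D : ℝ}
    (hD : ∀ p, ‖fderiv ℝ φ p‖ ≤ D) (t : ℝ) (x : Space d) :
    ‖fderiv ℝ (fun y => φ (y, t)) x‖ ≤ D := by
  rw [(hasFDerivAt_slice hφ t x).fderiv]
  refine (ContinuousLinearMap.opNorm_comp_le _ _).trans ?_
  refine (mul_le_of_le_one_right (norm_nonneg _) ?_).trans (hD _)
  exact ContinuousLinearMap.norm_inl_le_one ℝ (Space d) ℝ

/-- The scheme tested with a piecewise constant interpolant of a test function, after summation by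
parts in time and in space. -/
theorem exists_discrete_weak_form {d s k : ℕ} {σ : ℝ} (hσ : 0 < σ) (T : Tableau s k)
    (f : ℝ → Space d) (hf : ∃ Lf : NNReal, LipschitzWith Lf f) (C lam : ℝ) :
    ∃ Q : ℝ, 0 ≤ Q ∧ ∀ (M : Mesh d), M.IsQuasiUniform σ → 0 < M.size →
      ∀ F, M.IsNumericalFlux k f C F → ∀ τ : ℝ, 0 < τ → τ / M.size ≤ lam →
      ∀ u : ℕ → M.PiecewisePoly, IsNumericalSolution T M f F τ u →
      ∀ (φ : Space d × ℝ → ℝ) (D : ℝ), ContDiff ℝ 1 φ → (∀ p, ‖fderiv ℝ φ p‖ ≤ D) →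
      ∀ (I : Finset M.Cell) (N : ℕ), (∀ j ∉ I, ∀ y ∈ M.carrier j, ∀ t, φ (y, t) = 0) →
      (∀ y, φ (y, N * τ - τ) = 0) → ∀ z : M.Cell → Space d, (∀ i, z i ∈ M.carrier i) →
      ∀ c : ℕ → M.Cell → ℝ,
      |(∑ n ∈ Finset.range N, ∑ i ∈ I,
          (∫ x in M.carrier i, pval (u n i) x) * (φ (z i, n * τ) - φ (z i, n * τ - τ))) +
        (∑ i ∈ I, (∫ x in M.carrier i, pval (u 0 i) x) * φ (z i, -τ)) +
        τ * ∑ n ∈ Finset.range N, ∑ i ∈ I,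
          ∫ y in M.carrier i, fderiv ℝ φ (y, n * τ) (f (pval (u n i) y), 0)| ≤
      Q * D * (τ * ∑ n ∈ Finset.range N, ∑ i ∈ I,
        ∫ y in Metric.closedBall (z i) ((s + 2) * M.size), |M.toFun (u n) y - c n i|) := by
  obtain ⟨Q, hQ, H⟩ := exists_fluxResidual_bound hσ T f hf C lam
  obtain ⟨Q₁, -, hst⟩ := exists_stage_bound hσ T f hf C lam
  refine ⟨Q, hQ, ?_⟩
  intro M hM hh F hF τ hτ hlam u hu φ D hφ hD I N hI hN z hz c
  choose U G hG hU hstep using hu.2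
  have hUk : ∀ n q, U n q ∈ M.dgSpace k := fun n =>
    (hst M hM hh F hF τ hτ hlam (u n) (hu.1 n) (U n) (G n) (hG n) (hU n)).1
  set a : ℕ → M.Cell → ℝ := fun n i => ∫ x in M.carrier i, pval (u n i) x with ha
  set R : ℕ → M.Cell → ℝ := fun n i =>
    fluxResidual T M F (U n) (fun y => φ (y, n * τ)) i (z i) with hR
  set Y : ℕ → M.Cell → ℝ := fun n i =>
    ∫ y in M.carrier i, fderiv ℝ φ (y, n * τ) (f (pval (u n i) y), 0) with hY
  have hslice : ∀ t : ℝ, ContDiff ℝ 1 (fun y => φ (y, t)) := fun t => hφ.comp (by fun_prop)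
  have hres : ∀ n i, |R n i + Y n i| ≤ Q * D *
      ∫ y in Metric.closedBall (z i) ((s + 2) * M.size), |M.toFun (u n) y - c n i| := fun n i => by
    have h1 := H M hM hh F hF τ hτ hlam (u n) (hu.1 n) (U n) (G n) (hG n) (hU n)
      (fun y => φ (y, n * τ)) D (hslice _) (norm_fderiv_slice_le hφ hD _) i (z i) (hz i) (c n i)
    simp only [(hasFDerivAt_slice hφ _ _).fderiv] at h1
    exact h1
  have hsum : ∀ n : ℕ, ∑ i ∈ I, φ (z i, n * τ) * (a (n + 1) i - a n i) = -(τ * ∑ i ∈ I, R n i) := by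
    intro n
    have h1 : ∀ i, R n i = φ (z i, n * τ) * (∑ q, T.b q * ∑ j ∈ M.neighbors i,
        ∫ y in M.face i j, F i j (U n q) y ∂(Mesh.surface d)) -
        ∑ q, T.b q * ∑ j ∈ M.neighbors i,
          ∫ y in M.face i j, F i j (U n q) y * φ (y, n * τ) ∂(Mesh.surface d) := fun i => by
      simp only [hR, fluxResidual, Finset.mul_sum]
      rw [← Finset.sum_sub_distrib]
      refine Finset.sum_congr rfl fun q _ => ?_
      rw [← Finset.sum_sub_distrib]
      refine Finset.sum_congr rfl fun j hj => ?_
      have hij := M.mem_neighbors.1 hj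
      simp only [mul_sub]
      rw [integral_sub ((hF.integrableOn (hUk n q) hij).mul_const _)
        (hF.integrableOn_mul (hUk n q) hij (hslice _).continuous), integral_mul_const]
      ring
    -- By conservation the part weighted by `φ(y, nτ)` costs nothing, which is why it may be
    -- included in the residual.
    have h2 : ∑ i ∈ I, ∑ q, T.b q * ∑ j ∈ M.neighbors i,
          ∫ y in M.face i j, F i j (U n q) y * φ (y, n * τ) ∂(Mesh.surface d) = 0 := by
      rw [Finset.sum_comm]
      refine Finset.sum_eq_zero fun q _ => ?_
      rw [← Finset.mul_sum, hF.sum_integral_eq_zero (hUk n q) I fun j hj y hy => hI j hj y hy _,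
        mul_zero]
    simp only [h1, Finset.sum_sub_distrib, h2, sub_zero]
    rw [Finset.mul_sum, ← Finset.sum_neg_distrib]
    refine Finset.sum_congr rfl fun i _ => ?_
    rw [ha]
    simp only
    rw [integral_step_sub T (hG n) (hstep n) i]
    ring
  have habel : (∑ n ∈ Finset.range N, ∑ i ∈ I, a n i * (φ (z i, n * τ) - φ (z i, n * τ - τ))) +
      ∑ i ∈ I, a 0 i * φ (z i, -τ) = τ * ∑ n ∈ Finset.range N, ∑ i ∈ I, R n i := by
    have h1 : ∀ i ∈ I, ∑ n ∈ Finset.range N, a n i * (φ (z i, n * τ) - φ (z i, n * τ - τ)) +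
        a 0 i * φ (z i, -τ) =
        -∑ n ∈ Finset.range N, φ (z i, n * τ) * (a (n + 1) i - a n i) := fun i _ => by
      have h2 := sum_mul_sub_add_eq (fun n => a n i) (fun n => φ (z i, n * τ))
        (fun n => φ (z i, n * τ - τ)) (fun n => by
          have : ((n + 1 : ℕ) : ℝ) * τ - τ = n * τ := by push_cast; ring
          simp only [this]) N
      -- The end term disappears because the test function vanishes at time `N τ - τ`, and the
      -- initial term survives at time `-τ`.
      simp only [hN, mul_zero, zero_sub, Nat.cast_zero, zero_mul] at h2
      exact h2
    rw [Finset.sum_comm, ← Finset.sum_add_distrib, Finset.sum_congr rfl h1,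
      Finset.sum_neg_distrib, Finset.sum_comm, Finset.sum_congr rfl fun n _ => hsum n,
      Finset.sum_neg_distrib, neg_neg, Finset.mul_sum]
  rw [habel, ← mul_add, ← Finset.sum_add_distrib, abs_mul, abs_of_pos hτ, mul_left_comm]
  refine mul_le_mul_of_nonneg_left ?_ hτ.le
  rw [Finset.mul_sum]
  refine (Finset.abs_sum_le_sum_abs _ _).trans (Finset.sum_le_sum fun n _ => ?_)
  rw [← Finset.sum_add_distrib, Finset.mul_sum]
  exact (Finset.abs_sum_le_sum_abs _ _).trans (Finset.sum_le_sum fun i _ => hres n i)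

/-! ### Space-time integrals of piecewise functions. -/

/-- Lebesgue measure on `ℝ^d × (0,∞)`. -/
noncomputable def spaceTime (d : ℕ) : Measure (Space d × ℝ) :=
  (volume : Measure (Space d)).prod (volume.restrict (Set.Ioi 0))

theorem volume_restrict_pos :
    (volume : Measure (Space d × ℝ)).restrict {p | 0 < p.2} = spaceTime d := by
  rw [spaceTime, ← Measure.restrict_univ (μ := (volume : Measure (Space d))),
    Measure.prod_restrict, Measure.volume_eq_prod]
  congr 1
  ext p
  simp

theorem ae_spaceTime_pos : ∀ᵐ p ∂(spaceTime d), 0 < p.2 := by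
  rw [← volume_restrict_pos]
  exact ae_restrict_mem (measurableSet_lt measurable_const measurable_snd)

theorem ae_spaceTime_of_ae {P : Space d → Prop} (h : ∀ᵐ x : Space d, P x) :
    ∀ᵐ p ∂(spaceTime d), P p.1 := by
  unfold spaceTime
  exact Measure.quasiMeasurePreserving_fst.ae h

/-- The `n`-th time slab. -/
def slab (τ : ℝ) (n : ℕ) : Set ℝ := Set.Ico (n * τ) (n * τ + τ)

theorem floor_eq_iff_mem_slab {τ : ℝ} (hτ : 0 < τ) {t : ℝ} (ht : 0 < t) {n : ℕ} :
    ⌊t / τ⌋₊ = n ↔ t ∈ slab τ n := by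
  rw [Nat.floor_eq_iff (by positivity), le_div_iff₀ hτ, div_lt_iff₀ hτ, add_mul, one_mul]
  rfl

theorem measurableSet_slab (τ : ℝ) (n : ℕ) : MeasurableSet (slab τ n) := measurableSet_Ico

theorem volume_slab {τ : ℝ} (hτ : 0 < τ) (n : ℕ) :
    (volume.restrict (Set.Ioi (0 : ℝ))) (slab τ n) = ENNReal.ofReal τ := by
  -- The first slab contains the time `0`, outside the open half-line; this point is null.
  have h1 : (volume.restrict (Set.Ioi (0 : ℝ))) (slab τ n) =
      (volume.restrict (Set.Ici (0 : ℝ))) (slab τ n) := by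
    rw [restrict_Ioi_eq_restrict_Ici]
  rw [h1, Measure.restrict_apply (measurableSet_slab τ n), Set.inter_eq_self_of_subset_left]
  · rw [slab, Real.volume_Ico, add_sub_cancel_left]
  · intro t ht
    exact (mul_nonneg (Nat.cast_nonneg n) hτ.le).trans ht.1

namespace Mesh

variable (M : Mesh d)

/-- The space-time function that equals `H n i` on the cell `i` in the `n`-th time slab. -/
noncomputable def tile {E : Type*} (τ : ℝ) (H : ℕ → M.Cell → Space d → E) (p : Space d × ℝ) : E :=
  H ⌊p.2 / τ⌋₊ (M.cellOf p.1) p.1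

/-- The cell at a point is chosen arbitrarily on the overlaps, so only almost everywhere
measurability is claimed: on each cell times slab the function agrees almost everywhere with a
continuous one, and countably many such pieces suffice. -/
theorem aestronglyMeasurable_tile {E : Type*} [NormedAddCommGroup E] {τ : ℝ} (hτ : 0 < τ)
    {H : ℕ → M.Cell → Space d → E} (hH : ∀ n i, Continuous (H n i)) :
    AEStronglyMeasurable (M.tile τ H) (spaceTime d) := by
  have h1 : AEStronglyMeasurable (M.tile τ H) ((spaceTime d).restrict
      (⋃ q : M.Cell × ℕ, M.carrier q.1 ×ˢ slab τ q.2)) := by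
    rw [aestronglyMeasurable_iUnion_iff]
    rintro ⟨i, n⟩
    have h2 : AEStronglyMeasurable (fun p : Space d × ℝ => H n i p.1)
        ((spaceTime d).restrict (M.carrier i ×ˢ slab τ n)) :=
      ((hH n i).stronglyMeasurable.comp_measurable measurable_fst).aestronglyMeasurable
    refine h2.congr ?_
    filter_upwards [ae_restrict_of_ae ae_spaceTime_pos,
      ae_restrict_of_ae (ae_spaceTime_of_ae M.ae_cellOf_eq),
      ae_restrict_mem ((M.measurableSet_carrier i).prod (measurableSet_slab τ n))] with p h0 hc hp
    rw [tile, hc i hp.1, (floor_eq_iff_mem_slab hτ h0).2 hp.2]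
  have h3 : (spaceTime d).restrict (⋃ q : M.Cell × ℕ, M.carrier q.1 ×ˢ slab τ q.2) =
      spaceTime d := by
    refine Measure.restrict_eq_self_of_ae_mem ?_
    filter_upwards [ae_spaceTime_pos] with p hp
    exact Set.mem_iUnion.2 ⟨(M.cellOf p.1, ⌊p.2 / τ⌋₊), M.mem_carrier_cellOf _,
      (floor_eq_iff_mem_slab hτ hp).1 rfl⟩
  rwa [h3] at h1

/-- Converts the double sums of the scheme into space-time integrals, to which dominated convergence
applies. -/
theorem integral_tile {τ : ℝ} (hτ : 0 < τ) {H : ℕ → M.Cell → Space d → ℝ}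
    (hH : ∀ n i, Continuous (H n i)) {I : Finset M.Cell} {N : ℕ}
    (hI : ∀ n, ∀ i ∉ I, ∀ x ∈ M.carrier i, H n i x = 0)
    (hN : ∀ n ≥ N, ∀ i x, H n i x = 0) :
    ∫ p, M.tile τ H p ∂(spaceTime d) =
      τ * ∑ n ∈ Finset.range N, ∑ i ∈ I, ∫ x in M.carrier i, H n i x := by
  classical
  have h1 : M.tile τ H =ᵐ[spaceTime d] fun p => ∑ n ∈ Finset.range N, ∑ i ∈ I,
      (M.carrier i).indicator (H n i) p.1 * (slab τ n).indicator (fun _ => (1 : ℝ)) p.2 := by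
    filter_upwards [ae_spaceTime_pos, ae_spaceTime_of_ae M.ae_cellOf_eq] with p h0 hc
    have hs : ∀ n, ⌊p.2 / τ⌋₊ ≠ n → p.2 ∉ slab τ n := fun n hn h =>
      hn ((floor_eq_iff_mem_slab hτ h0).2 h)
    have hi : ∀ i, M.cellOf p.1 ≠ i → p.1 ∉ M.carrier i := fun i hi h => hi (hc i h)
    have hmem := M.mem_carrier_cellOf p.1
    have hslab := (floor_eq_iff_mem_slab hτ h0).1 (rfl : ⌊p.2 / τ⌋₊ = _)
    have e1 : ∀ n, ∑ i ∈ I, (M.carrier i).indicator (H n i) p.1 *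
        (slab τ n).indicator (fun _ => (1 : ℝ)) p.2 =
        H n (M.cellOf p.1) p.1 * (slab τ n).indicator (fun _ => (1 : ℝ)) p.2 := fun n => by
      rw [← Finset.sum_mul]
      congr 1
      rw [Finset.sum_eq_single (M.cellOf p.1)]
      · rw [Set.indicator_of_mem hmem]
      · intro i _ hne
        rw [Set.indicator_of_notMem (hi i hne.symm)]
      · intro h
        rw [Set.indicator_of_mem hmem, hI n _ h _ hmem]
    simp only [e1]
    rw [tile, Finset.sum_eq_single ⌊p.2 / τ⌋₊]
    · rw [Set.indicator_of_mem hslab, mul_one]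
    · intro n _ hne
      rw [Set.indicator_of_notMem (hs n hne.symm), mul_zero]
    · intro h
      rw [hN _ (by simpa using h), zero_mul]
  have hint : ∀ n i, Integrable (fun p : Space d × ℝ => (M.carrier i).indicator (H n i) p.1 *
      (slab τ n).indicator (fun _ => (1 : ℝ)) p.2) (spaceTime d) := fun n i => by
    refine Integrable.mul_prod
      ((integrableOn_carrier (hH n i)).integrable_indicator (M.measurableSet_carrier i)) ?_
    refine (integrable_indicator_iff (measurableSet_slab τ n)).2 (integrableOn_const ?_)
    rw [volume_slab hτ]
    exact ENNReal.ofReal_ne_top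
  rw [integral_congr_ae h1, integral_finsetSum _ fun n _ => integrable_finsetSum _ fun i _ => hint n i,
    Finset.mul_sum]
  refine Finset.sum_congr rfl fun n _ => ?_
  rw [integral_finsetSum _ fun i _ => hint n i, Finset.mul_sum]
  refine Finset.sum_congr rfl fun i _ => ?_
  rw [spaceTime, integral_prod_mul, integral_indicator (M.measurableSet_carrier i),
    integral_indicator (measurableSet_slab τ n), setIntegral_const, Measure.real, volume_slab hτ,
    ENNReal.toReal_ofReal hτ.le, smul_eq_mul, mul_one, mul_comm]

theorem integral_tile_space {H : M.Cell → Space d → ℝ} (hH : ∀ i, Continuous (H i))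
    {I : Finset M.Cell} (hI : ∀ i ∉ I, ∀ x ∈ M.carrier i, H i x = 0) :
    ∫ x, H (M.cellOf x) x = ∑ i ∈ I, ∫ x in M.carrier i, H i x := by
  have h1 : (fun x => H (M.cellOf x) x) =ᵐ[volume] fun x =>
      ∑ i ∈ I, (M.carrier i).indicator (H i) x := by
    filter_upwards [M.ae_cellOf_eq] with x hc
    have hmem := M.mem_carrier_cellOf x
    rw [Finset.sum_eq_single (M.cellOf x)]
    · rw [Set.indicator_of_mem hmem]
    · intro i _ hne
      exact Set.indicator_of_notMem (fun h => hne (hc i h).symm) _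
    · intro h
      rw [Set.indicator_of_mem hmem, hI _ h _ hmem]
  rw [integral_congr_ae h1, integral_finsetSum _ fun i _ =>
    (integrableOn_carrier (hH i)).integrable_indicator (M.measurableSet_carrier i)]
  exact Finset.sum_congr rfl fun i _ => integral_indicator (M.measurableSet_carrier i)

theorem aestronglyMeasurable_tile_space {E : Type*} [NormedAddCommGroup E]
    {H : M.Cell → Space d → E} (hH : ∀ i, Continuous (H i)) :
    AEStronglyMeasurable (fun x => H (M.cellOf x) x) := by
  have h1 : AEStronglyMeasurable (fun x => H (M.cellOf x) x)
      (volume.restrict (⋃ i, M.carrier i)) := by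
    rw [aestronglyMeasurable_iUnion_iff]
    intro i
    refine (hH i).aestronglyMeasurable.congr ?_
    filter_upwards [ae_restrict_of_ae M.ae_cellOf_eq,
      ae_restrict_mem (M.measurableSet_carrier i)] with x hc hx
    rw [hc i hx]
  rwa [Set.iUnion_eq_univ_iff.2 M.cover, Measure.restrict_univ] at h1

/-- The numerical solution as a function of space and time. -/
noncomputable def evolution (τ : ℝ) (u : ℕ → M.PiecewisePoly) (p : Space d × ℝ) : ℝ :=
  M.toFun (u ⌊p.2 / τ⌋₊) p.1

theorem aestronglyMeasurable_evolution {τ : ℝ} (hτ : 0 < τ) (u : ℕ → M.PiecewisePoly) :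
    AEStronglyMeasurable (M.evolution τ u) (spaceTime d) :=
  M.aestronglyMeasurable_tile hτ (H := fun n i => pval (u n i)) fun _ _ => continuous_pval _

variable {M}

theorem abs_evolution_le {τ : ℝ} {u : ℕ → M.PiecewisePoly} {B : ℝ}
    (hB : ∀ n i, ∀ x ∈ M.carrier i, |pval (u n i) x| ≤ B) (p : Space d × ℝ) :
    |M.evolution τ u p| ≤ B :=
  hB _ _ _ (M.mem_carrier_cellOf p.1)

end Mesh

theorem spaceTime_prod_lt_top {S : Set (Space d)} (hS : volume S < ⊤) (T : ℝ) :
    spaceTime d (S ×ˢ Set.Iio T) < ⊤ := by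
  rw [spaceTime, Measure.prod_prod]
  refine ENNReal.mul_lt_top hS ?_
  rw [Measure.restrict_apply measurableSet_Iio, Set.Iio_inter_Ioi]
  exact measure_Ioo_lt_top

/-- The mean deviation of the numerical solution from constants near the cells is controlled by its
`L^1` distance to a uniformly continuous function. -/
theorem sum_integral_sub_le {M : Mesh d} {τ : ℝ} (hτ : 0 < τ) (u : ℕ → M.PiecewisePoly) {B : ℝ}
    (hB : ∀ n i, ∀ x ∈ M.carrier i, |pval (u n i) x| ≤ B) {g : Space d × ℝ → ℝ}
    (hg : Continuous g) {B' : ℝ} (hgB : ∀ p, |g p| ≤ B') {ε η : ℝ} (hε : 0 ≤ ε)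
    (hgε : ∀ p q, dist p q ≤ η → |g p - g q| ≤ ε) {ρ : ℝ} (hρ : ρ ≤ η) (hτη : τ ≤ η)
    {I : Finset M.Cell} {N : ℕ} {z : M.Cell → Space d} {R' T' : ℝ}
    (hz : ∀ i ∈ I, Metric.closedBall (z i) ρ ⊆ Metric.closedBall 0 R') (hN : N * τ ≤ T') {K : ℝ}
    (hK : ∀ y, ∀ J ⊆ I, (∀ i ∈ J, y ∈ Metric.closedBall (z i) ρ) → (J.card : ℝ) ≤ K) :
    τ * ∑ n ∈ Finset.range N, ∑ i ∈ I,
        ∫ y in Metric.closedBall (z i) ρ, |M.toFun (u n) y - g (z i, n * τ)| ≤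
      K * ∫ p in Metric.closedBall 0 R' ×ˢ Set.Iio T', (|M.evolution τ u p - g p| + ε)
        ∂(spaceTime d) := by
  classical
  set Ω : Set (Space d × ℝ) := Metric.closedBall 0 R' ×ˢ Set.Iio T' with hΩ
  have hΩfin : spaceTime d Ω < ⊤ := spaceTime_prod_lt_top measure_closedBall_lt_top T'
  have hΩm : MeasurableSet Ω := measurableSet_closedBall.prod measurableSet_Iio
  set w : Space d × ℝ → ℝ := fun p => |M.evolution τ u p - g p| + ε with hw
  have hw0 : ∀ p, 0 ≤ w p := fun p => add_nonneg (abs_nonneg _) hε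
  have hum := M.aestronglyMeasurable_evolution hτ u
  have hbnd : ∀ {v : Space d × ℝ → ℝ} {b : ℝ}, AEStronglyMeasurable v (spaceTime d) →
      (∀ p, |v p| ≤ b) → IntegrableOn v Ω (spaceTime d) := fun {v b} hv hb =>
    IntegrableOn.of_bound hΩfin hv.restrict b (Eventually.of_forall hb)
  have hui : IntegrableOn (M.evolution τ u) Ω (spaceTime d) :=
    hbnd hum fun p => Mesh.abs_evolution_le hB p
  have hgi : IntegrableOn g Ω (spaceTime d) := hbnd hg.aestronglyMeasurable hgB
  have hwi : IntegrableOn w Ω (spaceTime d) :=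
    (hui.sub hgi).abs.add (integrableOn_const hΩfin.ne)
  let A : ℕ → M.Cell → Set (Space d × ℝ) := fun n i => Metric.closedBall (z i) ρ ×ˢ slab τ n
  have hAm : ∀ n i, MeasurableSet (A n i) := fun n i =>
    measurableSet_closedBall.prod (measurableSet_slab τ n)
  have hAΩ : ∀ n ∈ Finset.range N, ∀ i ∈ I, A n i ⊆ Ω := fun n hn i hi p hp => by
    refine ⟨hz i hi hp.1, lt_of_lt_of_le hp.2.2 (le_trans ?_ hN)⟩
    have h1 : ((n : ℝ) + 1) ≤ N := by exact_mod_cast Finset.mem_range.1 hn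
    nlinarith
  have hterm : ∀ n ∈ Finset.range N, ∀ i ∈ I,
      τ * ∫ y in Metric.closedBall (z i) ρ, |M.toFun (u n) y - g (z i, n * τ)| ≤
        ∫ p in Ω, (A n i).indicator w p ∂(spaceTime d) := by
    intro n hn i hi
    have h1 : ∫ p in A n i, |M.evolution τ u p - g (z i, n * τ)| ∂(spaceTime d) =
        τ * ∫ y in Metric.closedBall (z i) ρ, |M.toFun (u n) y - g (z i, n * τ)| := by
      have h2 : ∫ p in A n i, |M.evolution τ u p - g (z i, n * τ)| ∂(spaceTime d) =
          ∫ p in A n i, |M.toFun (u n) p.1 - g (z i, n * τ)| * 1 ∂(spaceTime d) := by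
        refine integral_congr_ae ?_
        filter_upwards [ae_restrict_of_ae ae_spaceTime_pos, ae_restrict_mem (hAm n i)] with p h0 hp
        rw [mul_one, Mesh.evolution, (floor_eq_iff_mem_slab hτ h0).2 hp.2]
      rw [h2, spaceTime, setIntegral_prod_mul (fun y => |M.toFun (u n) y - g (z i, n * τ)|)
        (fun _ => (1 : ℝ)), setIntegral_const, Measure.real, volume_slab hτ,
        ENNReal.toReal_ofReal hτ.le, smul_eq_mul, mul_one, mul_comm]
    rw [← h1, setIntegral_indicator (hAm n i), Set.inter_eq_self_of_subset_right (hAΩ n hn i hi)]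
    have hsub := hAΩ n hn i hi
    refine setIntegral_mono_on ?_ (hwi.mono_set hsub) (hAm n i) fun p hp => ?_
    · exact ((hui.mono_set hsub).sub (integrableOn_const
        ((measure_mono hsub).trans_lt hΩfin).ne)).abs
    -- On a ball times a slab `g` varies by at most `ε`, so its value at the sample point can serve
    -- as the local constant.
    · have h3 : |g p - g (z i, n * τ)| ≤ ε := hgε _ _ (by
        rw [Prod.dist_eq]
        refine max_le (hp.1.trans hρ) ?_
        rw [Real.dist_eq, abs_of_nonneg (sub_nonneg.2 hp.2.1)]
        have := hp.2.2
        linarith)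
      calc |M.evolution τ u p - g (z i, n * τ)| ≤
            |M.evolution τ u p - g p| + |g p - g (z i, n * τ)| := abs_sub_le _ _ _
        _ ≤ w p := add_le_add le_rfl h3
  have hind : ∀ n i, IntegrableOn ((A n i).indicator w) Ω (spaceTime d) := fun n i =>
    hwi.indicator (hAm n i)
  calc _ = ∑ n ∈ Finset.range N, ∑ i ∈ I,
        τ * ∫ y in Metric.closedBall (z i) ρ, |M.toFun (u n) y - g (z i, n * τ)| := by
        simp only [Finset.mul_sum]
    _ ≤ ∑ n ∈ Finset.range N, ∑ i ∈ I, ∫ p in Ω, (A n i).indicator w p ∂(spaceTime d) :=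
        Finset.sum_le_sum fun n hn => Finset.sum_le_sum fun i hi => hterm n hn i hi
    _ = ∫ p in Ω, ∑ n ∈ Finset.range N, ∑ i ∈ I, (A n i).indicator w p ∂(spaceTime d) := by
        rw [integral_finsetSum _ fun n _ => integrable_finsetSum _ fun i _ => hind n i]
        exact Finset.sum_congr rfl fun n _ => (integral_finsetSum _ fun i _ => hind n i).symm
    _ ≤ ∫ p in Ω, K * w p ∂(spaceTime d) := by
        refine integral_mono_ae (integrable_finsetSum _ fun n _ =>
          integrable_finsetSum _ fun i _ => hind n i) (hwi.const_mul K) ?_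
        filter_upwards [ae_restrict_of_ae ae_spaceTime_pos] with p h0
        -- At a given time one slab is active, and at a given point at most `K` balls are; this is
        -- the bounded overlap.
        set J := I.filter fun i => p.1 ∈ Metric.closedBall (z i) ρ with hJ
        have hJK : (J.card : ℝ) ≤ K := hK p.1 J (Finset.filter_subset _ _) fun i hi =>
          (Finset.mem_filter.1 hi).2
        have hn : ∀ n, n ≠ ⌊p.2 / τ⌋₊ → ∑ i ∈ I, (A n i).indicator w p = 0 := fun n hne =>
          Finset.sum_eq_zero fun i _ => Set.indicator_of_notMem
            (fun hp => hne ((floor_eq_iff_mem_slab hτ h0).2 hp.2).symm) _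
        have hle : ∀ n, ∑ i ∈ I, (A n i).indicator w p ≤ K * w p := fun n => by
          calc ∑ i ∈ I, (A n i).indicator w p ≤
                ∑ i ∈ I, if p.1 ∈ Metric.closedBall (z i) ρ then w p else 0 := by
                refine Finset.sum_le_sum fun i _ => ?_
                by_cases hp : p ∈ A n i
                · rw [Set.indicator_of_mem hp, if_pos hp.1]
                · rw [Set.indicator_of_notMem hp]
                  split_ifs
                  exacts [hw0 p, le_rfl]
            _ = J.card * w p := by
                rw [← Finset.sum_filter, Finset.sum_const, nsmul_eq_mul]
            _ ≤ K * w p := mul_le_mul_of_nonneg_right hJK (hw0 p)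
        by_cases hmem : ⌊p.2 / τ⌋₊ ∈ Finset.range N
        · rw [Finset.sum_eq_single_of_mem _ hmem fun n _ hne => hn n hne]
          exact hle _
        · rw [Finset.sum_eq_zero fun n hn' => hn n fun h => hmem (h ▸ hn')]
          -- Here only `0 ≤ K * w p` is needed. It is read off from the following slab, whose sum is
          -- zero at `p`, without assuming a sign of `K`.
          exact (hn _ (ne_of_gt (Nat.lt_succ_self _))).symm.trans_le (hle _)
    _ = K * ∫ p in Ω, w p ∂(spaceTime d) := integral_const_mul _ _

/-! ### Limits of the individual terms. -/

/-- Both points of the difference quotient move with `m`, so ordinary differentiability at `p` does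
not suffice; strict differentiability does. -/
theorem tendsto_time_difference {φ : Space d × ℝ → ℝ} (hφ : ContDiff ℝ 1 φ) {p : Space d × ℝ}
    {x : ℕ → Space d} {t τ : ℕ → ℝ} (hx : Tendsto x atTop (𝓝 p.1))
    (ht : Tendsto t atTop (𝓝 p.2)) (hτ : ∀ m, 0 < τ m) (hτ0 : Tendsto τ atTop (𝓝 0)) :
    Tendsto (fun m => (φ (x m, t m) - φ (x m, t m - τ m)) / τ m) atTop
      (𝓝 (fderiv ℝ φ p (0, 1))) := by
  have h1 : HasStrictFDerivAt φ (fderiv ℝ φ p) p :=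
    hφ.contDiffAt.hasStrictFDerivAt (by norm_num)
  have h2 : Tendsto (fun m => ((x m, t m), (x m, t m - τ m))) atTop (𝓝 (p, p)) := by
    have e1 : Tendsto (fun m => (x m, t m)) atTop (𝓝 p) := hx.prodMk_nhds ht
    have e2 : Tendsto (fun m => (x m, t m - τ m)) atTop (𝓝 p) :=
      hx.prodMk_nhds (by simpa using ht.sub hτ0)
    exact e1.prodMk_nhds e2
  have h3 := h1.isLittleO.comp_tendsto h2
  have h4 : ∀ m, ((x m, t m) : Space d × ℝ) - (x m, t m - τ m) = τ m • (0, 1) := fun m => by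
    ext <;> simp
  simp only [Function.comp_def, h4, map_smul, smul_eq_mul] at h3
  have h5 : (fun m => φ (x m, t m) - φ (x m, t m - τ m) - τ m * fderiv ℝ φ p (0, 1)) =o[atTop] τ := by
    refine h3.trans_isBigO (Asymptotics.IsBigO.of_bound 1 (Eventually.of_forall fun m => ?_))
    rw [norm_smul, Prod.norm_mk]
    simp
  have h6 := h5.tendsto_div_nhds_zero
  have h7 := h6.add_const (fderiv ℝ φ p (0, 1))
  rw [zero_add] at h7
  refine h7.congr fun m => ?_
  have := (hτ m).ne'
  field_simp
  ring

theorem floor_mul_mem {τ t : ℝ} (hτ : 0 < τ) (ht : 0 < t) :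
    t - τ < ⌊t / τ⌋₊ * τ ∧ ⌊t / τ⌋₊ * τ ≤ t := by
  have h := (floor_eq_iff_mem_slab hτ ht).1 rfl
  exact ⟨by linarith [h.2], h.1⟩

theorem tendsto_floor_mul {τ : ℕ → ℝ} (hτ : ∀ m, 0 < τ m) (hτ0 : Tendsto τ atTop (𝓝 0)) {t : ℝ}
    (ht : 0 < t) : Tendsto (fun m => (⌊t / τ m⌋₊ : ℝ) * τ m) atTop (𝓝 t) := by
  have h1 : Tendsto (fun m => t - τ m) atTop (𝓝 t) := by simpa using hτ0.const_sub t
  exact tendsto_of_tendsto_of_tendsto_of_le_of_le h1 tendsto_const_nhds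
    (fun m => (floor_mul_mem (hτ m) ht).1.le) fun m => (floor_mul_mem (hτ m) ht).2

theorem tendsto_center {M : ℕ → Mesh d} (hh : Tendsto (fun m => (M m).size) atTop (𝓝 0))
    {z : ∀ m, (M m).Cell → Space d} (hz : ∀ m i, z m i ∈ (M m).carrier i) (x : Space d) :
    Tendsto (fun m => z m ((M m).cellOf x)) atTop (𝓝 x) := by
  rw [tendsto_iff_dist_tendsto_zero]
  exact squeeze_zero (fun _ => dist_nonneg)
    (fun m => (M m).dist_le_size (hz m _) ((M m).mem_carrier_cellOf x)) hh

theorem abs_sub_le_of_fderiv_le {φ : Space d × ℝ → ℝ} (hφ : ContDiff ℝ 1 φ) {D : ℝ}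
    (hD : ∀ p, ‖fderiv ℝ φ p‖ ≤ D) (x : Space d) {t τ : ℝ} (hτ : 0 < τ) :
    |φ (x, t) - φ (x, t - τ)| ≤ D * τ := by
  have h1 := Convex.norm_image_sub_le_of_norm_fderiv_le (𝕜 := ℝ) (f := φ) (s := Set.univ)
    (fun p _ => hφ.differentiable (by norm_num) p) (fun p _ => hD p) convex_univ
    (Set.mem_univ (x, t - τ)) (Set.mem_univ (x, t))
  refine h1.trans_eq ?_
  rw [Prod.mk_sub_mk, sub_self, sub_sub_cancel, Prod.norm_mk, norm_zero,
    max_eq_right (norm_nonneg _), Real.norm_of_nonneg hτ.le]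

/-- A region of space-time outside of which all terms of the scheme tested with `φ` vanish. -/
def testRegion (d : ℕ) (R : ℝ) : Set (Space d × ℝ) := Metric.closedBall 0 (R + 1) ×ˢ Set.Iio (R + 3)

theorem measurableSet_testRegion (R : ℝ) : MeasurableSet (testRegion d R) :=
  measurableSet_closedBall.prod measurableSet_Iio

theorem spaceTime_testRegion_lt_top (R : ℝ) : spaceTime d (testRegion d R) < ⊤ :=
  spaceTime_prod_lt_top measure_closedBall_lt_top _

/-- The margins of the region absorb the sampling: a sample point is within `h ≤ 1` of its cell, and
the earlier of the two times used is at least `t - 2τ ≥ t - 2`. -/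
theorem lt_norm_of_notMem_testRegion {R : ℝ} {p : Space d × ℝ} (hp : p ∉ testRegion d R)
    {x : Space d} {t : ℝ} (hx : dist x p.1 ≤ 1) (ht : p.2 - 2 ≤ t) : R < ‖(x, t)‖ := by
  rw [Prod.norm_mk]
  by_cases h : p.1 ∈ Metric.closedBall (0 : Space d) (R + 1)
  · refine lt_of_lt_of_le ?_ (le_max_right _ _)
    have h2 : R + 3 ≤ p.2 := by
      by_contra hlt
      exact hp ⟨h, not_le.1 hlt⟩
    exact lt_of_lt_of_le (by linarith) (le_abs_self t)
  · refine lt_of_lt_of_le ?_ (le_max_left _ _)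
    rw [mem_closedBall_zero_iff, not_le] at h
    rw [dist_eq_norm] at hx
    have := norm_sub_norm_le p.1 x
    rw [norm_sub_rev] at this
    linarith

section limits

variable {M : ℕ → Mesh d} {τ : ℕ → ℝ} {u : ∀ m, ℕ → (M m).PiecewisePoly} {B : ℝ}
  {v : Space d × ℝ → ℝ} {φ : Space d × ℝ → ℝ} {D R : ℝ}

/-- Dominated convergence: the quotient is bounded by `D` and converges pointwise, the numerical
solution is bounded by `B`, and everything vanishes off a region of finite measure. -/
theorem tendsto_integral_time_derivative (hh : Tendsto (fun m => (M m).size) atTop (𝓝 0))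
    (hτ : ∀ m, 0 < τ m) (hτ0 : Tendsto τ atTop (𝓝 0))
    (hB : ∀ m n i, ∀ x ∈ (M m).carrier i, |pval (u m n i) x| ≤ B)
    (hconv : ∀ᵐ p ∂(spaceTime d),
      Tendsto (fun m => (M m).evolution (τ m) (u m) p) atTop (𝓝 (v p)))
    (hφ : ContDiff ℝ 1 φ) (hD : ∀ p, ‖fderiv ℝ φ p‖ ≤ D) (hR : ∀ p, R < ‖p‖ → φ p = 0)
    {z : ∀ m, (M m).Cell → Space d} (hz : ∀ m i, z m i ∈ (M m).carrier i) :
    Tendsto (fun m => ∫ p, (M m).tile (τ m) (fun n i x => pval (u m n i) x *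
      ((φ (z m i, n * τ m) - φ (z m i, n * τ m - τ m)) / τ m)) p ∂(spaceTime d)) atTop
      (𝓝 (∫ p, v p * fderiv ℝ φ p (0, 1) ∂(spaceTime d))) := by
  have hB0 : 0 ≤ B := by
    obtain ⟨i, hi⟩ := (M 0).cover 0
    exact (abs_nonneg _).trans (hB 0 0 i 0 hi)
  have hD0 : 0 ≤ D := (norm_nonneg _).trans (hD 0)
  refine tendsto_integral_filter_of_dominated_convergence
    ((testRegion d R).indicator fun _ => B * D) ?_ ?_ ?_ ?_
  · exact Eventually.of_forall fun m => (M m).aestronglyMeasurable_tile (hτ m) fun n i =>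
      (continuous_pval _).mul continuous_const
  · filter_upwards [hh.eventually (eventually_le_nhds one_pos),
      hτ0.eventually (eventually_le_nhds one_pos)] with m hm1 hm2
    filter_upwards [ae_spaceTime_pos] with p hp
    simp only [Mesh.tile]
    obtain ⟨hf1, hf2⟩ := floor_mul_mem (hτ m) hp
    have hdist := (M m).dist_le_size (hz m _) ((M m).mem_carrier_cellOf p.1)
    by_cases hpR : p ∈ testRegion d R
    · rw [Set.indicator_of_mem hpR, norm_mul, norm_div, Real.norm_of_nonneg (hτ m).le]
      refine mul_le_mul (hB m _ _ _ ((M m).mem_carrier_cellOf p.1)) ?_ (by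
        have := (hτ m).le; positivity) hB0
      rw [div_le_iff₀ (hτ m)]
      exact abs_sub_le_of_fderiv_le hφ hD _ (hτ m)
    · rw [Set.indicator_of_notMem hpR,
        hR _ (lt_norm_of_notMem_testRegion hpR (hdist.trans hm1) (by linarith)),
        hR _ (lt_norm_of_notMem_testRegion hpR (hdist.trans hm1) (by linarith))]
      simp
  · exact (integrable_indicator_iff (measurableSet_testRegion R)).2
      (integrableOn_const (spaceTime_testRegion_lt_top R).ne)
  · filter_upwards [hconv, ae_spaceTime_pos] with p hp hp0
    exact hp.mul (tendsto_time_difference hφ (tendsto_center hh hz p.1)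
      (tendsto_floor_mul hτ hτ0 hp0) hτ hτ0)

theorem continuous_fderiv_flux {f : ℝ → Space d} (hf : Continuous f) (hφ : ContDiff ℝ 1 φ) :
    Continuous fun q : (Space d × ℝ) × ℝ => fderiv ℝ φ q.1 (f q.2, 0) :=
  ((hφ.continuous_fderiv (by norm_num)).comp continuous_fst).clm_apply
    ((hf.comp continuous_snd).prodMk continuous_const)

theorem abs_fderiv_flux_le {f : ℝ → Space d} {Lf : NNReal} (hf : LipschitzWith Lf f)
    (hD : ∀ p, ‖fderiv ℝ φ p‖ ≤ D) (p : Space d × ℝ) {r : ℝ} (hr : |r| ≤ B) :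
    |fderiv ℝ φ p (f r, 0)| ≤ D * (‖f 0‖ + Lf * B) := by
  have hD0 : 0 ≤ D := (norm_nonneg _).trans (hD 0)
  refine ((fderiv ℝ φ p).le_opNorm _).trans (mul_le_mul (hD p) ?_ (norm_nonneg _) hD0)
  rw [Prod.norm_mk, norm_zero, max_eq_left (norm_nonneg _)]
  have h1 := hf.dist_le_mul r 0
  rw [Real.dist_eq, sub_zero, dist_eq_norm] at h1
  have h2 := norm_le_norm_add_norm_sub' (f r) (f 0)
  have h3 : (Lf : ℝ) * |r| ≤ Lf * B := mul_le_mul_of_nonneg_left hr Lf.2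
  linarith

theorem tendsto_integral_flux {f : ℝ → Space d} {Lf : NNReal} (hf : LipschitzWith Lf f)
    (hτ : ∀ m, 0 < τ m) (hτ0 : Tendsto τ atTop (𝓝 0))
    (hB : ∀ m n i, ∀ x ∈ (M m).carrier i, |pval (u m n i) x| ≤ B)
    (hconv : ∀ᵐ p ∂(spaceTime d),
      Tendsto (fun m => (M m).evolution (τ m) (u m) p) atTop (𝓝 (v p)))
    (hφ : ContDiff ℝ 1 φ) (hD : ∀ p, ‖fderiv ℝ φ p‖ ≤ D) (hR : ∀ p, R < ‖p‖ → fderiv ℝ φ p = 0) :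
    Tendsto (fun m => ∫ p, (M m).tile (τ m) (fun n i x =>
      fderiv ℝ φ (x, n * τ m) (f (pval (u m n i) x), 0)) p ∂(spaceTime d)) atTop
      (𝓝 (∫ p, fderiv ℝ φ p (f (v p), 0) ∂(spaceTime d))) := by
  refine tendsto_integral_filter_of_dominated_convergence
    ((testRegion d R).indicator fun _ => D * (‖f 0‖ + Lf * B)) ?_ ?_ ?_ ?_
  · exact Eventually.of_forall fun m => (M m).aestronglyMeasurable_tile (hτ m) fun n i =>
      (continuous_fderiv_flux hf.continuous hφ).comp
        ((continuous_id.prodMk continuous_const).prodMk (continuous_pval _))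
  · filter_upwards [hτ0.eventually (eventually_le_nhds one_pos)] with m hm2
    filter_upwards [ae_spaceTime_pos] with p hp
    simp only [Mesh.tile]
    obtain ⟨hf1, hf2⟩ := floor_mul_mem (hτ m) hp
    by_cases hpR : p ∈ testRegion d R
    · rw [Set.indicator_of_mem hpR]
      exact abs_fderiv_flux_le hf hD _ (hB m _ _ _ ((M m).mem_carrier_cellOf p.1))
    · rw [Set.indicator_of_notMem hpR,
        hR _ (lt_norm_of_notMem_testRegion hpR (by rw [dist_self]; exact zero_le_one)
          (by linarith))]
      simp
  · exact (integrable_indicator_iff (measurableSet_testRegion R)).2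
      (integrableOn_const (spaceTime_testRegion_lt_top R).ne)
  · filter_upwards [hconv, ae_spaceTime_pos] with p hp hp0
    have h1 : Tendsto (fun m => ((p.1, (⌊p.2 / τ m⌋₊ : ℝ) * τ m),
        (M m).evolution (τ m) (u m) p)) atTop (𝓝 (p, v p)) :=
      (tendsto_const_nhds.prodMk_nhds (tendsto_floor_mul hτ hτ0 hp0)).prodMk_nhds hp
    exact ((continuous_fderiv_flux hf.continuous hφ).tendsto (p, v p)).comp h1

theorem integrable_initial {u₀ : Space d → ℝ} (hu₀ : LocallyIntegrable u₀)
    (hφ : Continuous φ) (hR : ∀ p, R < ‖p‖ → φ p = 0) :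
    Integrable fun x => u₀ x * φ (x, 0) := by
  have h1 : Continuous fun x : Space d => φ (x, 0) := hφ.comp (by fun_prop)
  have h2 : HasCompactSupport fun x : Space d => φ (x, 0) :=
    HasCompactSupport.intro (isCompact_closedBall (0 : Space d) R) fun x hx => hR _ (by
      rw [mem_closedBall_zero_iff, not_le] at hx
      exact lt_of_lt_of_le hx (by rw [Prod.norm_mk]; exact le_max_left _ _))
  simpa only [smul_eq_mul] using hu₀.integrable_smul_right_of_hasCompactSupport h1 h2

/-- The initial data converge only in `L^1_loc`. Hence `u_h` is first replaced by `u₀` at the cost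
of an `L^1` norm on a ball, and dominated convergence is then applied with the fixed function `|u₀|`
as majorant. -/
theorem tendsto_integral_initial {u₀ : Space d → ℝ} (hu₀ : LocallyIntegrable u₀)
    (hh : Tendsto (fun m => (M m).size) atTop (𝓝 0)) (hτ0 : Tendsto τ atTop (𝓝 0))
    (hinit : ∀ S : Set (Space d), IsCompact S →
      Tendsto (fun m => ∫⁻ x in S, ‖(M m).toFun (u m 0) x - u₀ x‖ₑ) atTop (𝓝 0))
    (hφ : Continuous φ) {P : ℝ} (hP : ∀ p, |φ p| ≤ P) (hR : ∀ p, R < ‖p‖ → φ p = 0)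
    {z : ∀ m, (M m).Cell → Space d} (hz : ∀ m i, z m i ∈ (M m).carrier i) :
    Tendsto (fun m => ∫ x, (M m).toFun (u m 0) x * φ (z m ((M m).cellOf x), -τ m)) atTop
      (𝓝 (∫ x, u₀ x * φ (x, 0))) := by
  set S := Metric.closedBall (0 : Space d) (R + 1) with hS
  have hSc : IsCompact S := isCompact_closedBall _ _
  have hu₀S : IntegrableOn u₀ S := hu₀.integrableOn_isCompact hSc
  have hP0 : 0 ≤ P := (abs_nonneg _).trans (hP 0)
  have hmeas : ∀ m, AEStronglyMeasurable (fun x => φ (z m ((M m).cellOf x), -τ m)) := fun m =>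
    (M m).aestronglyMeasurable_tile_space (H := fun i _ => φ (z m i, -τ m))
      fun _ => continuous_const
  have hzero : ∀ m, (M m).size ≤ 1 → ∀ x ∉ S, φ (z m ((M m).cellOf x), -τ m) = 0 := by
    intro m hm x hx
    refine hR _ ?_
    rw [mem_closedBall_zero_iff, not_le] at hx
    have h1 := (M m).dist_le_size (hz m _) ((M m).mem_carrier_cellOf x)
    rw [dist_eq_norm] at h1
    have h2 := norm_sub_norm_le x (z m ((M m).cellOf x))
    rw [norm_sub_rev] at h2
    rw [Prod.norm_mk]
    exact lt_of_lt_of_le (by linarith) (le_max_left _ _)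
  have hsize := hh.eventually (eventually_le_nhds one_pos)
  have h1 : Tendsto (fun m => ∫ x, u₀ x * φ (z m ((M m).cellOf x), -τ m)) atTop
      (𝓝 (∫ x, u₀ x * φ (x, 0))) := by
    refine tendsto_integral_filter_of_dominated_convergence
      (S.indicator fun x => |u₀ x| * P) ?_ ?_ ?_ ?_
    · exact Eventually.of_forall fun m => hu₀.aestronglyMeasurable.mul (hmeas m)
    · filter_upwards [hsize] with m hm
      refine Eventually.of_forall fun x => ?_
      by_cases hx : x ∈ S
      · rw [Set.indicator_of_mem hx, norm_mul]
        exact mul_le_mul_of_nonneg_left (hP _) (norm_nonneg _)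
      · rw [Set.indicator_of_notMem hx, hzero m hm x hx]
        simp
    · exact (integrable_indicator_iff measurableSet_closedBall).2 (hu₀S.abs.mul_const P)
    · refine Eventually.of_forall fun x => tendsto_const_nhds.mul ?_
      have h2 : Tendsto (fun m => (z m ((M m).cellOf x), -τ m)) atTop (𝓝 (x, 0)) :=
        (tendsto_center hh hz x).prodMk_nhds (by simpa using hτ0.neg)
      exact (hφ.tendsto _).comp h2
  have h2 : Tendsto (fun m => ∫ x in S, |(M m).toFun (u m 0) x - u₀ x|) atTop (𝓝 0) := by
    have h3 := (ENNReal.tendsto_toReal ENNReal.zero_ne_top).comp (hinit S hSc)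
    rw [ENNReal.toReal_zero] at h3
    refine h3.congr fun m => ?_
    have hd' : IntegrableOn (fun x => (M m).toFun (u m 0) x - u₀ x) S :=
      (Mesh.integrableOn_toFun _ hSc).sub hu₀S
    have hm : AEStronglyMeasurable (fun x => |(M m).toFun (u m 0) x - u₀ x|)
        (volume.restrict S) := hd'.abs.aestronglyMeasurable
    rw [integral_eq_lintegral_of_nonneg_ae (Eventually.of_forall fun _ => abs_nonneg _) hm]
    simp only [Function.comp_apply, ← Real.enorm_eq_ofReal_abs]
  have h4 : Tendsto (fun m => (∫ x, (M m).toFun (u m 0) x * φ (z m ((M m).cellOf x), -τ m)) -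
      ∫ x, u₀ x * φ (z m ((M m).cellOf x), -τ m)) atTop (𝓝 0) := by
    refine squeeze_zero_norm' ?_ (by simpa using h2.const_mul P)
    filter_upwards [hsize] with m hm
    have hS' : ∀ w : Space d → ℝ, IntegrableOn w S →
        Integrable (fun x => w x * φ (z m ((M m).cellOf x), -τ m)) := fun w hw => by
      have h5 : IntegrableOn (fun x => w x * φ (z m ((M m).cellOf x), -τ m)) S :=
        hw.mul_bdd (c := P) (hmeas m).restrict (Eventually.of_forall fun x => hP _)
      exact h5.integrable_of_forall_notMem_eq_zero fun x hx => by
        rw [hzero m hm x hx, mul_zero]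
    have hdiff : IntegrableOn (fun x => (M m).toFun (u m 0) x - u₀ x) S :=
      (Mesh.integrableOn_toFun _ hSc).sub hu₀S
    rw [← integral_sub (hS' _ (Mesh.integrableOn_toFun _ hSc)) (hS' _ hu₀S)]
    simp only [← sub_mul]
    rw [← setIntegral_eq_integral_of_forall_compl_eq_zero (s := S) fun x hx => by
      rw [hzero m hm x hx, mul_zero], ← integral_const_mul]
    refine norm_integral_le_of_norm_le (hdiff.abs.const_mul P)
      (Eventually.of_forall fun x => ?_)
    rw [norm_mul, mul_comm]
    exact mul_le_mul_of_nonneg_right (hP _) (abs_nonneg _)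
  simpa using h4.add h1

theorem tendsto_integral_deviation (hτ : ∀ m, 0 < τ m)
    (hB : ∀ m n i, ∀ x ∈ (M m).carrier i, |pval (u m n i) x| ≤ B)
    (hconv : ∀ᵐ p ∂(spaceTime d),
      Tendsto (fun m => (M m).evolution (τ m) (u m) p) atTop (𝓝 (v p)))
    {g : Space d × ℝ → ℝ} (hg : Continuous g) {B' : ℝ} (hgB : ∀ p, |g p| ≤ B') (ε R : ℝ) :
    Tendsto (fun m => ∫ p in testRegion d R, (|(M m).evolution (τ m) (u m) p - g p| + ε)
      ∂(spaceTime d)) atTop (𝓝 (∫ p in testRegion d R, (|v p - g p| + ε) ∂(spaceTime d))) := by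
  refine tendsto_integral_filter_of_dominated_convergence (fun _ => B + B' + |ε|) ?_ ?_ ?_ ?_
  · exact Eventually.of_forall fun m =>
      ((((M m).aestronglyMeasurable_evolution (hτ m) (u m)).sub
        hg.aestronglyMeasurable).norm.add_const ε).restrict
  · refine Eventually.of_forall fun m => Eventually.of_forall fun p => ?_
    rw [Real.norm_eq_abs]
    refine (abs_add_le _ _).trans (add_le_add ?_ le_rfl)
    rw [abs_abs]
    exact (abs_sub _ _).trans (add_le_add (Mesh.abs_evolution_le (hB m) p) (hgB p))
  · exact integrableOn_const (spaceTime_testRegion_lt_top R).ne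
  · filter_upwards [ae_restrict_of_ae hconv] with p hp
    exact ((hp.sub_const _).abs).add_const ε

end limits

/-! ### The weak form in the limit. -/

/-- A numerical solution satisfies the weak form up to its `L^1` distance from a uniformly
continuous function. -/
theorem exists_weak_form_defect_le {s k : ℕ} (hd : 1 ≤ d) {σ : ℝ} (hσ : 0 < σ) (T : Tableau s k)
    (f : ℝ → Space d) (hf : ∃ Lf : NNReal, LipschitzWith Lf f) (C lam B : ℝ) :
    ∃ Q : ℝ, 0 ≤ Q ∧ ∀ (M : Mesh d), M.IsQuasiUniform σ →
      ∀ F, M.IsNumericalFlux k f C F → ∀ τ : ℝ, 0 < τ → τ / M.size ≤ lam →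
      ∀ u : ℕ → M.PiecewisePoly, IsNumericalSolution T M f F τ u →
      (∀ n i, ∀ x ∈ M.carrier i, |pval (u n i) x| ≤ B) →
      ∀ (φ : Space d × ℝ → ℝ) (D R : ℝ), ContDiff ℝ 1 φ → (∀ p, ‖fderiv ℝ φ p‖ ≤ D) → 0 ≤ R →
      (∀ p, R < ‖p‖ → φ p = 0) → (∀ p, R < ‖p‖ → fderiv ℝ φ p = 0) →
      ∀ z : M.Cell → Space d, (∀ i, z i ∈ M.carrier i) →
      ∀ (g : Space d × ℝ → ℝ) (B' ε η : ℝ), Continuous g → (∀ p, |g p| ≤ B') → 0 ≤ ε →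
      (∀ p q, dist p q ≤ η → |g p - g q| ≤ ε) → (s + 3) * M.size ≤ 1 → (s + 3) * M.size ≤ η →
      τ ≤ 1 → τ ≤ η →
      |(∫ p, M.tile τ (fun n i x => pval (u n i) x *
          ((φ (z i, n * τ) - φ (z i, n * τ - τ)) / τ)) p ∂(spaceTime d)) +
        (∫ x, M.toFun (u 0) x * φ (z (M.cellOf x), -τ)) +
        ∫ p, M.tile τ (fun n i x => fderiv ℝ φ (x, n * τ) (f (pval (u n i) x), 0)) p
          ∂(spaceTime d)| ≤
      Q * D * ∫ p in testRegion d R, (|M.evolution τ u p - g p| + ε) ∂(spaceTime d) := by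
  obtain ⟨Q, hQ, h⟩ := exists_discrete_weak_form hσ T f hf C lam
  -- The second factor is the overlap: if a ball of radius `(s + 2) h` about a sample point contains
  -- `y`, the cell lies within `(s + 3) h` of `y`, and packing counts such cells.
  refine ⟨Q * ((s + 3) / σ) ^ d, by positivity, ?_⟩
  intro M hM F hF τ hτ hlam u hu hB φ D R hφ hD hR0 hR hR' z hz g B' ε η hg hgB hε hgε hM1 hMη hτ1 hτη
  obtain ⟨Lf, hLf⟩ := hf
  have hsize := M.size_pos hd
  have hD0 : 0 ≤ D := (norm_nonneg _).trans (hD 0)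
  have hfin := M.finite_cells_inter (isCompact_closedBall (0 : Space d) R)
  set I := hfin.toFinset with hI
  have hout : ∀ j ∉ I, ∀ y ∈ M.carrier j, ∀ t, R < ‖((y, t) : Space d × ℝ)‖ := by
    intro j hj y hy t
    have h1 : y ∉ Metric.closedBall (0 : Space d) R := fun hmem =>
      hj (hfin.mem_toFinset.2 ⟨y, hy, hmem⟩)
    rw [mem_closedBall_zero_iff, not_le] at h1
    exact h1.trans_le (by rw [Prod.norm_mk]; exact le_max_left _ _)
  -- The `2` ensures that `φ` already vanishes at `N τ - τ`, while `N τ ≤ R + 3 τ` still fits into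
  -- the test region.
  set N := ⌈R / τ⌉₊ + 2 with hN
  have hceil : R ≤ ⌈R / τ⌉₊ * τ := (div_le_iff₀ hτ).1 (Nat.le_ceil _)
  have hceil' : ⌈R / τ⌉₊ * τ ≤ R + τ := by
    have h1 := (Nat.ceil_lt_add_one (div_nonneg hR0 hτ.le)).le
    have h2 := mul_le_mul_of_nonneg_right h1 hτ.le
    rwa [add_mul, div_mul_cancel₀ _ hτ.ne', one_mul] at h2
  have hlate : ∀ n ≥ N, R < n * τ - τ := fun n hn => by
    have h1 : ((⌈R / τ⌉₊ : ℝ) + 2) ≤ n := by exact_mod_cast hn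
    have h2 := mul_le_mul_of_nonneg_right h1 hτ.le
    linarith
  have hlate' : ∀ (y : Space d) (t : ℝ), R < t → R < ‖(y, t)‖ := fun y t ht => by
    rw [Prod.norm_mk]
    exact lt_of_lt_of_le ht ((le_abs_self t).trans (le_max_right _ _))
  have hA : ∫ p, M.tile τ (fun n i x => pval (u n i) x *
      ((φ (z i, n * τ) - φ (z i, n * τ - τ)) / τ)) p ∂(spaceTime d) =
      ∑ n ∈ Finset.range N, ∑ i ∈ I,
        (∫ x in M.carrier i, pval (u n i) x) * (φ (z i, n * τ) - φ (z i, n * τ - τ)) := by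
    rw [M.integral_tile hτ (I := I) (N := N) (H := fun n i x => pval (u n i) x *
      ((φ (z i, n * τ) - φ (z i, n * τ - τ)) / τ)) fun n i =>
        (continuous_pval _).mul continuous_const]
    · simp only [Finset.mul_sum, integral_mul_const]
      refine Finset.sum_congr rfl fun n _ => Finset.sum_congr rfl fun i _ => ?_
      field_simp
    · intro n i hi x _
      rw [hR _ (hout i hi _ (hz i) _), hR _ (hout i hi _ (hz i) _), sub_zero, zero_div, mul_zero]
    · intro n hn i x
      rw [hR _ (hlate' _ _ (hlate n hn)), hR _ (hlate' _ _ ((hlate n hn).trans (by linarith))),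
        sub_zero, zero_div, mul_zero]
  have hA0 : ∫ x, M.toFun (u 0) x * φ (z (M.cellOf x), -τ) =
      ∑ i ∈ I, (∫ x in M.carrier i, pval (u 0 i) x) * φ (z i, -τ) := by
    simp only [← integral_mul_const]
    exact M.integral_tile_space (H := fun i x => pval (u 0 i) x * φ (z i, -τ))
      (fun i => (continuous_pval _).mul continuous_const) fun i hi x _ => by
        rw [hR _ (hout i hi _ (hz i) _), mul_zero]
  have hA1 := M.integral_tile hτ (I := I) (N := N)
    (H := fun n i x => fderiv ℝ φ (x, n * τ) (f (pval (u n i) x), 0))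
    (fun n i => (continuous_fderiv_flux hLf.continuous hφ).comp
        ((continuous_id.prodMk continuous_const).prodMk (continuous_pval _)))
    (fun n i hi x hx => by rw [hR' _ (hout i hi _ hx _)]; rfl)
    (fun n hn i x => by rw [hR' _ (hlate' _ _ ((hlate n hn).trans (by linarith)))]; rfl)
  rw [hA, hA0, hA1]
  refine (h M hM hsize F hF τ hτ hlam u hu φ D hφ hD I N (fun j hj y hy t => hR _ (hout j hj y hy t))
    -- The local constants are the values of `g` at the sample points and discrete times.
    (fun y => hR _ (hlate' _ _ (hlate N le_rfl))) z hz fun n i => g (z i, n * τ)).trans ?_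
  rw [mul_right_comm Q _ D, mul_assoc (Q * D)]
  refine mul_le_mul_of_nonneg_left ?_ (mul_nonneg hQ hD0)
  refine sum_integral_sub_le hτ u hB hg hgB hε hgε (by linarith) hτη (fun i hi => ?_) ?_ ?_
  · obtain ⟨w, hwi, hw⟩ := hfin.mem_toFinset.1 hi
    refine Metric.closedBall_subset_closedBall' ?_
    linarith [dist_triangle (z i) w 0, M.dist_le_size (hz i) hwi, Metric.mem_closedBall.1 hw]
  · rw [hN]
    push_cast
    linarith
  · intro y J _ hJ
    refine hM.card_le hσ hsize (y := y) (by positivity) J fun i hi x hx => ?_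
    rw [Metric.mem_closedBall]
    linarith [dist_triangle x (z i) y, M.dist_le_size hx (hz i), Metric.mem_closedBall'.1 (hJ i hi)]

theorem _root_.HasCompactSupport.exists_eq_zero_of_lt_norm {E F : Type*} [NormedAddCommGroup E]
    [Zero F] {φ : E → F} (h : HasCompactSupport φ) : ∃ R : ℝ, 0 ≤ R ∧ ∀ p, R < ‖p‖ → φ p = 0 := by
  obtain ⟨R, hR⟩ := h.isCompact.isBounded.subset_closedBall 0
  refine ⟨max R 0, le_max_right _ _, fun p hp => ?_⟩
  by_contra hne
  have := mem_closedBall_zero_iff.1 (hR (subset_tsupport _ hne))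
  exact absurd hp (not_lt.2 (this.trans (le_max_left _ _)))

theorem integrable_of_abs_le {w : Space d × ℝ → ℝ} (hw : AEStronglyMeasurable w (spaceTime d))
    {b R : ℝ} (hb : ∀ᵐ p ∂(spaceTime d), |w p| ≤ b) (hR : ∀ p, R < ‖p‖ → w p = 0) :
    Integrable w (spaceTime d) := by
  have h1 : IntegrableOn w (testRegion d R) (spaceTime d) :=
    IntegrableOn.of_bound (spaceTime_testRegion_lt_top R) hw.restrict b (ae_restrict_of_ae hb)
  exact h1.integrable_of_forall_notMem_eq_zero fun p hp =>
    hR p (lt_norm_of_notMem_testRegion hp (x := p.1) (t := p.2) (by simp) (by linarith))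

/-- Density of continuous compactly supported functions in `L^1`; compact support supplies the bound
and the uniform continuity. One `ε` is the `L^1` error, the other is integrated over the region. -/
theorem exists_uniformly_continuous_approximation {v : Space d × ℝ → ℝ} {R : ℝ}
    (hv : IntegrableOn v (testRegion d R) (spaceTime d)) {ε : ℝ} (hε : 0 < ε) :
    ∃ (g : Space d × ℝ → ℝ) (B' η : ℝ), Continuous g ∧ (∀ p, |g p| ≤ B') ∧ 0 < η ∧
      (∀ p q, dist p q ≤ η → |g p - g q| ≤ ε) ∧
      ∫ p in testRegion d R, (|v p - g p| + ε) ∂(spaceTime d) ≤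
        ε * (1 + (spaceTime d).real (testRegion d R)) := by
  have hfin : IsFiniteMeasure ((spaceTime d).restrict (testRegion d R)) :=
    ⟨by rw [Measure.restrict_apply_univ]; exact spaceTime_testRegion_lt_top R⟩
  obtain ⟨g, hgc, hgε, hg, hgi⟩ := hv.exists_hasCompactSupport_integral_sub_le hε
  obtain ⟨B', hB'⟩ := hgc.exists_bound_of_continuous hg
  obtain ⟨η, hη, h⟩ := Metric.uniformContinuous_iff_le.1
    (hgc.uniformContinuous_of_continuous hg) ε hε
  refine ⟨g, B', η, hg, hB', hη, fun p q hpq => h hpq, ?_⟩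
  have h1 : Integrable (fun p => |v p - g p|) ((spaceTime d).restrict (testRegion d R)) :=
    (hv.sub hgi).abs
  rw [integral_add h1 (integrable_const _), setIntegral_const, smul_eq_mul]
  simp only [Real.norm_eq_abs] at hgε
  linarith

/-- Bounded almost everywhere limits of numerical solutions are weak solutions. -/
theorem isWeakSolution_of_tendsto {s k : ℕ} (hd : 1 ≤ d) (T : Tableau s k) {f : ℝ → Space d}
    {Lf : NNReal} (hf : LipschitzWith Lf f) {u₀ : Space d → ℝ} (hu₀ : LocallyIntegrable u₀)
    {M : ℕ → Mesh d} {σ : ℝ} (hσ : 0 < σ) (hM : ∀ m, (M m).IsQuasiUniform σ)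
    (hh : Tendsto (fun m => (M m).size) atTop (𝓝 0))
    {F : ∀ m, (M m).Cell → (M m).Cell → (M m).PiecewisePoly → Space d → ℝ} {C : ℝ}
    (hF : ∀ m, (M m).IsNumericalFlux k f C (F m)) {τ : ℕ → ℝ} (hτ : ∀ m, 0 < τ m)
    (hτ0 : Tendsto τ atTop (𝓝 0)) {lam : ℝ} (hCFL : ∀ m, τ m / (M m).size ≤ lam)
    {u : ∀ m, ℕ → (M m).PiecewisePoly}
    (hu : ∀ m, IsNumericalSolution T (M m) f (F m) (τ m) (u m))
    (hinit : ∀ S : Set (Space d), IsCompact S →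
      Tendsto (fun m => ∫⁻ x in S, ‖(M m).toFun (u m 0) x - u₀ x‖ₑ) atTop (𝓝 0))
    {B : ℝ} (hB : ∀ m n i, ∀ x ∈ (M m).carrier i, |pval (u m n i) x| ≤ B)
    {v : Space d × ℝ → ℝ} (hconv : ∀ᵐ p ∂(spaceTime d),
      Tendsto (fun m => (M m).evolution (τ m) (u m) p) atTop (𝓝 (v p))) :
    IsWeakSolution f u₀ v := by
  intro φ hφ hsupp
  have hφ1 : ContDiff ℝ 1 φ := hφ.of_le (by simp)
  have hφ' : Continuous (fderiv ℝ φ) := hφ1.continuous_fderiv (by norm_num)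
  obtain ⟨R₁, hR₁, hφR₁⟩ := hsupp.exists_eq_zero_of_lt_norm
  obtain ⟨R₂, hR₂, hφR₂⟩ := (hsupp.fderiv (𝕜 := ℝ)).exists_eq_zero_of_lt_norm
  obtain ⟨D, hD⟩ := (hsupp.fderiv (𝕜 := ℝ)).exists_bound_of_continuous hφ'
  obtain ⟨P, hP⟩ := hsupp.exists_bound_of_continuous hφ1.continuous
  set R := max R₁ R₂ with hR
  have hR0 : 0 ≤ R := hR₁.trans (le_max_left _ _)
  have hφR : ∀ p, R < ‖p‖ → φ p = 0 := fun p hp => hφR₁ p ((le_max_left _ _).trans_lt hp)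
  have hφR' : ∀ p, R < ‖p‖ → fderiv ℝ φ p = 0 := fun p hp =>
    hφR₂ p ((le_max_right _ _).trans_lt hp)
  have hD0 : 0 ≤ D := (norm_nonneg _).trans (hD 0)
  -- Measurability and the bound of the limit are inherited through almost everywhere convergence.
  have hvm : AEStronglyMeasurable v (spaceTime d) := aestronglyMeasurable_of_tendsto_ae atTop
    (fun m => (M m).aestronglyMeasurable_evolution (hτ m) (u m)) hconv
  have hvB : ∀ᵐ p ∂(spaceTime d), |v p| ≤ B := by
    filter_upwards [hconv] with p hp
    exact le_of_tendsto hp.abs (Eventually.of_forall fun m => Mesh.abs_evolution_le (hB m) p)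
  have hint₁ : Integrable (fun p => v p * fderiv ℝ φ p (0, 1)) (spaceTime d) := by
    refine integrable_of_abs_le (b := B * (D * 1)) (R := R) (hvm.mul
      (hφ'.clm_apply continuous_const).aestronglyMeasurable) ?_ fun p hp => by
        rw [hφR' p hp]; simp
    filter_upwards [hvB] with p hp
    rw [abs_mul]
    refine mul_le_mul hp ?_ (abs_nonneg _) ((abs_nonneg _).trans hp)
    refine ((fderiv ℝ φ p).le_opNorm _).trans (mul_le_mul (hD p) ?_ (norm_nonneg _) hD0)
    simp [Prod.norm_mk]
  have hint₂ : Integrable (fun p => fderiv ℝ φ p (f (v p), 0)) (spaceTime d) := by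
    refine integrable_of_abs_le (b := D * (‖f 0‖ + Lf * B)) (R := R)
      ((continuous_fderiv_flux hf.continuous hφ1).comp_aestronglyMeasurable
        (continuous_id.aestronglyMeasurable.prodMk hvm)) ?_ fun p hp => by
        rw [hφR' p hp]; rfl
    filter_upwards [hvB] with p hp
    exact abs_fderiv_flux_le hf hD p hp
  refine ⟨integrable_initial hu₀ hφ1.continuous hφR, ?_⟩
  rw [IntegrableOn, IntegrableOn, volume_restrict_pos]
  refine ⟨hint₁, hint₂, ?_⟩
  let z : ∀ m, (M m).Cell → Space d := fun m i => ((M m).nonempty_interior i).some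
  have hz : ∀ m i, z m i ∈ (M m).carrier i := fun m i =>
    interior_subset ((M m).nonempty_interior i).some_mem
  have hlim := (((tendsto_integral_time_derivative hh hτ hτ0 hB hconv hφ1 hD hφR hz).add
    (tendsto_integral_initial hu₀ hh hτ0 hinit hφ1.continuous hP hφR hz)).add
    (tendsto_integral_flux hf hτ hτ0 hB hconv hφ1 hD hφR')).abs
  obtain ⟨Q, hQ, hweak⟩ := exists_weak_form_defect_le hd hσ T f ⟨Lf, hf⟩ C lam B
  have hvi : IntegrableOn v (testRegion d R) (spaceTime d) := IntegrableOn.of_bound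
    (spaceTime_testRegion_lt_top R) hvm.restrict B (ae_restrict_of_ae hvB)
  -- For fixed `g` and `ε` first let `m` tend to infinity, then use that `g` is close to `v`. The
  -- weak-form expression does not depend on `g`, so it must vanish.
  have hsmall : ∀ ε > 0, |(∫ p, v p * fderiv ℝ φ p (0, 1) ∂(spaceTime d)) +
      (∫ x, u₀ x * φ (x, 0)) + ∫ p, fderiv ℝ φ p (f (v p), 0) ∂(spaceTime d)| ≤
      Q * D * (1 + (spaceTime d).real (testRegion d R)) * ε := by
    intro ε hε
    obtain ⟨g, B', η, hg, hgB, hη, hgε, hvg⟩ := exists_uniformly_continuous_approximation hvi hε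
    have hh3 : Tendsto (fun m => ((s : ℝ) + 3) * (M m).size) atTop (𝓝 0) := by
      simpa using hh.const_mul ((s : ℝ) + 3)
    have hle := le_of_tendsto_of_tendsto hlim
      ((tendsto_integral_deviation hτ hB hconv hg hgB ε R).const_mul (Q * D)) (by
        filter_upwards [hh3.eventually (eventually_le_nhds one_pos),
          hh3.eventually (eventually_le_nhds hη), hτ0.eventually (eventually_le_nhds one_pos),
          hτ0.eventually (eventually_le_nhds hη)] with m h1 h2 h3 h4
        exact hweak (M m) (hM m) (F m) (hF m) (τ m) (hτ m) (hCFL m) (u m) (hu m) (hB m) φ D R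
          hφ1 hD hR0 hφR hφR' (z m) (hz m) g B' ε η hg hgB hε.le hgε h1 h2 h3 h4)
    refine hle.trans ((mul_le_mul_of_nonneg_left hvg (mul_nonneg hQ hD0)).trans_eq ?_)
    ring
  have hzero := le_of_forall_pos_le_add (a := |(∫ p, v p * fderiv ℝ φ p (0, 1) ∂(spaceTime d)) +
      (∫ x, u₀ x * φ (x, 0)) + ∫ p, fderiv ℝ φ p (f (v p), 0) ∂(spaceTime d)|) (b := 0) ?_
  · rw [add_comm (∫ x, u₀ x * φ (x, 0))]
    exact abs_eq_zero.1 (le_antisymm hzero (abs_nonneg _))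
  · intro ε hε
    have hK : 0 ≤ Q * D * (1 + (spaceTime d).real (testRegion d R)) := by positivity
    -- The added 1 keeps the denominator positive when the constant is zero.
    refine (hsmall (ε / (Q * D * (1 + (spaceTime d).real (testRegion d R)) + 1))
      (by positivity)).trans ?_
    rw [zero_add, mul_div_assoc', div_le_iff₀ (by positivity)]
    linarith

end SdRKDG

theorem theorem3p1 {d k s : ℕ} (hd : 1 ≤ d) (hk : 1 ≤ k) (T : SdRKDG.Tableau s k)
    (f : ℝ → SdRKDG.Space d) (hf : ∃ Lf : NNReal, LipschitzWith Lf f)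
    (u₀ : SdRKDG.Space d → ℝ) (hu₀ : LocallyIntegrable u₀)
    -- a sequence of quasi-uniform meshes with mesh sizes tending to zero
    (M : ℕ → SdRKDG.Mesh d)
    (hM : ∃ σ : ℝ, 0 < σ ∧ ∀ m, (M m).IsQuasiUniform σ)
    (hh : Tendsto (fun m => (M m).size) atTop (𝓝 0))
    -- numerical fluxes whose Lipschitz constant does not depend on the mesh
    (F : ∀ m, (M m).Cell → (M m).Cell → (M m).PiecewisePoly → SdRKDG.Space d → ℝ)
    (hF : ∃ C : ℝ, ∀ m, (M m).IsNumericalFlux k f C (F m))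
    -- time steps with the CFL condition
    (τ : ℕ → ℝ) (hτ : ∀ m, 0 < τ m) (hτ0 : Tendsto τ atTop (𝓝 0))
    (hCFL : ∃ lam : ℝ, ∀ m, τ m / (M m).size ≤ lam)
    -- numerical solutions, with initial data approximating `u₀` in `L^1_loc`
    (u : ∀ m, ℕ → (M m).PiecewisePoly)
    (hu : ∀ m, SdRKDG.IsNumericalSolution T (M m) f (F m) (τ m) (u m))
    (hinit : ∀ S : Set (SdRKDG.Space d), IsCompact S →
      Tendsto (fun m => ∫⁻ x in S, ‖(M m).toFun (u m 0) x - u₀ x‖ₑ) atTop (𝓝 0))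
    -- bounded convergence almost everywhere on `ℝ^d × (0,∞)`
    (hbdd : ∃ B : ℝ, ∀ m n i, ∀ x ∈ (M m).carrier i, |SdRKDG.pval (u m n i) x| ≤ B)
    (v : SdRKDG.Space d × ℝ → ℝ)
    (hconv : ∀ᵐ p ∂((volume : Measure (SdRKDG.Space d × ℝ)).restrict {p | 0 < p.2}),
      Tendsto (fun m => (M m).toFun (u m ⌊p.2 / τ m⌋₊) p.1) atTop (𝓝 (v p))) :
    SdRKDG.IsWeakSolution f u₀ v := by
  obtain ⟨Lf, hLf⟩ := hf
  obtain ⟨σ, hσ, hMσ⟩ := hM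
  obtain ⟨C, hC⟩ := hF
  obtain ⟨lam, hlam⟩ := hCFL
  obtain ⟨B, hB⟩ := hbdd
  rw [SdRKDG.volume_restrict_pos] at hconv
  exact SdRKDG.isWeakSolution_of_tendsto hd T hLf hu₀ hσ hMσ hh hC hτ hτ0 hlam hu hinit hB hconv
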